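/- Proposition 17.2. A Gaussian integer $z=r+is$ is called primary if $z\equiv 1 \pmod{2(1+i)}$; for such $z$ (so $r$ is odd) let $$[z]=i^{\frac{r-1}{2}}\left(\frac{s}{|r|}\right)$$ be the Jacobi–Kubota symbol, where $\left(\frac{\cdot}{\cdot}\right)$ is the Jacobi symbol. Let $N\ge 1$, $N<N'<2N$, $0<\theta\le 1$ and $C\geq 1$ be real numbers, let $p:\mathbb R\to\mathbb R$ be a twice differentiable function supported on $N'<t\le(1+\theta)N'$ with $|p^{(j)}|\le K(\theta N)^{-j}$ for $j=0,1,2$, and put $$\beta_z=p(n)\,\mu(n)\sum_{c\mid n,\ c\le C}\mu(c),\qquad n=z\bar z .$$ Let $\Pi$ be the product of all primes not exceeding a real number $P$. For an integer $d\ge1$, a multiplicative character $\chi$ of $(\mathbb Z[i]/4d\,\mathbb Z[i])^*$ (extended by $0$ to the classes not prime to $4d$) and $k\in\mathbb Z$, define $$S_\chi^k(\beta')=\sum_{\substack{z\ \text{primary}\\ (z,\Pi)=1}}\beta_z\,[z]\,\chi(z)\left(\frac{z}{|z|}\right)^k .$$ Then for every $\eta>0$ there is a $\delta=\delta(\eta)>0$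 such that $$S_\chi^k(\beta')\ll N^{1-\delta}$$ whenever $1\le C\le N^{1-\eta}$ and $d(|k|+1)\le N^{\delta}$, with an implied constant depending only on $\eta$ and $K$; in particular the bound is uniform in $N,N',\theta,C,P,p,d,k,\chi$. -/

import Mathlib

noncomputable section

namespace GaussSum

/-- A Gaussian integer is primary if it is `≡ 1` modulo `2(1 + i)`. -/
def IsPrimary (z : GaussianInt) : Prop :=
  (⟨2, 2⟩ : GaussianInt) ∣ z - 1

/-- The Jacobi–Kubota symbol `[z] = i^((r-1)/2) (s/|r|)` of `z = r + is`, meant for `r` odd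
(so that the integer division is exact and the last factor is the usual Jacobi symbol). -/
def jacobiKubota (z : GaussianInt) : ℂ :=
  Complex.I ^ ((z.re - 1) / 2) * (jacobiSym z.im z.re.natAbs : ℂ)

/-- The residue ring `ℤ[i] / 4d ℤ[i]`. -/
abbrev ResidueRing (d : ℕ) : Type :=
  GaussianInt ⧸ Ideal.span {((4 * d : ℕ) : GaussianInt)}

/-- The Grössencharacter `ψ(z) = χ(z) (z/|z|)^k`, with `χ` a multiplicative character modulo
`4d` on `ℤ[i]` (zero on classes that are not invertible). -/
def grossencharacter {d : ℕ} (χ : MulChar (ResidueRing d) ℂ) (k : ℤ) (z : GaussianInt) : ℂ :=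
  χ (Ideal.Quotient.mk (Ideal.span {((4 * d : ℕ) : GaussianInt)}) z) *
    ((z : ℂ) / ((‖(z : ℂ)‖ : ℝ) : ℂ)) ^ k

/-- `p` is twice differentiable, supported on `N' < t ≤ (1 + θ) N'`, and
`|p⁽ʲ⁾| ≤ K (θ N)⁻ʲ` for `j = 0, 1, 2`. -/
structure IsRadiusMollifier (K N N' θ : ℝ) (p : ℝ → ℝ) : Prop where
  differentiable : Differentiable ℝ p
  differentiable_deriv : Differentiable ℝ (deriv p)
  support_subset : Function.support p ⊆ Set.Ioc N' ((1 + θ) * N')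
  bound : ∀ j : ℕ, j ≤ 2 → ∀ t : ℝ, |iteratedDeriv j p t| ≤ K / (θ * N) ^ j

/-- The coefficient `β_z = p(n) μ(n) ∑_{c ∣ n, c ≤ C} μ(c)`, where `n = z z̄`. -/
def beta (p : ℝ → ℝ) (C : ℝ) (z : GaussianInt) : ℝ :=
  p (z.norm.natAbs : ℝ) * (ArithmeticFunction.moebius z.norm.natAbs : ℝ) *
    ∑ c ∈ z.norm.natAbs.divisors with ((c : ℕ) : ℝ) ≤ C, (ArithmeticFunction.moebius c : ℝ)

/-- The sum of `β_z [z] χ(z) (z/|z|)^k` over primary `z` prime to the product `Π` of the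
rational primes `≤ P`. Only finitely many terms are nonzero when `p` has bounded support. -/
def charSum (p : ℝ → ℝ) (C P : ℝ) {d : ℕ} (χ : MulChar (ResidueRing d) ℂ) (k : ℤ) : ℂ :=
  ∑ᶠ z ∈ {z : GaussianInt | IsPrimary z ∧ IsCoprime z ((primorial ⌊P⌋₊ : ℕ) : GaussianInt)},
    (beta p C z : ℂ) * jacobiKubota z * grossencharacter χ k z

end GaussSum

end

/-! Write `ψ` for the Grössencharacter `χ(z)(z/|z|)^k`. The total variation of `p` over the integers
is `O(K)`, so partial summation over the norm reduces the claim to a power saving for sums of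
`sieveWeight · [z] · ψ(z)` over primary `z` with a sharp cutoff on the norm. A nonzero `[z]` forces
the coordinates of `z` to be coprime, hence `z` to be coprime to its conjugate. The factorizations
of such a `z` into two primary numbers then correspond exactly to the factorizations of its norm in
`ℕ`. Combinatorial identities for the norm thereby become double sums over Gaussian integers.

Two estimates carry the proof. The linear one (`exists_norm_sum_jacobiKubota_mul_le`) bounds sums of
`[xv] ψ(v)` over `v`: with `xv = R + iS` the symbol is `i^((R-1)/2) (S/|R|)`, so the sum is itself a
bilinear form in rational Jacobi symbols. The loss is a factor `d |x|² (|k| + 1)`. The bilinear one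
(`exists_bilinBound_jacobiKubota`) rests on a reciprocity law (`jacobiKubota_mul`): `[wz]` is a
function of `w` times a function of `z` times the quadratic symbol `(Re(wz)/|w|²)` times a twist,
and the twist sees only residues modulo 8, signs and one inequality. For primitive `w` the quadratic
symbol is multiplicative in `z`.

Both use `bilinBound_of_multiplicative`. Hölder's inequality replaces the variable in which the
kernel is multiplicative by a product of several copies, long compared with the modulus. After
Cauchy's inequality the complete sums vanish unless a product of two moduli is a perfect square,
which is rare. Inequalities, congruences and the slowly varying angle that tie the two variables
together are removed by the calculus of `Separable` kernels, at a cost that is logarithmic, the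
number of classes, or the total variation.

For the combinatorics, let the norm `n ≤ Z` be squarefree (this is what `μ(n)` provides), and put `Y
= Z^ε`, `W = Z^(1-2ε)`. Multiply the primes of `n` in increasing order until the product `a` first
exceeds `Y`. If `a ≤ W`, both variables are long enough for the bilinear estimate. If `a > W`, then
`n` is a prime `q` times a cofactor at most `Y`. Here `C ≤ Z^(1-η)` makes `q > C`, so the truncated
divisor sum does not see `q`, and what remains is a sum of `[wv] ψ(v)` over `v` of prime norm. Those
sums are treated by Legendre's sieve, with the linear estimate for small sieving divisors and the
same prefix splitting and bilinear estimate for large ones. -/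

open Finset
open scoped NumberTheorySymbols ArithmeticFunction.Moebius

/-! ### Bilinear forms and separation of variables -/

/-- `M` bounds every bilinear form `∑ αᵢ βⱼ Kᵢⱼ` with coefficients in the unit disc. -/
def BilinBound {ι κ : Type*} (I : Finset ι) (J : Finset κ) (K : ι → κ → ℂ) (M : ℝ) : Prop :=
  ∀ (α : ι → ℂ) (β : κ → ℂ), (∀ i, ‖α i‖ ≤ 1) → (∀ j, ‖β j‖ ≤ 1) →
    ‖∑ i ∈ I, ∑ j ∈ J, α i * β j * K i j‖ ≤ M

/-- Multiplying a kernel by `F` enlarges its bilinear bounds at most by the factor `c`. -/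
def Separable {ι κ : Type*} (I : Finset ι) (J : Finset κ) (F : ι → κ → ℂ) (c : ℝ) : Prop :=
  ∀ (K : ι → κ → ℂ) (M : ℝ), BilinBound I J K M → BilinBound I J (fun i j => F i j * K i j) (c * M)

section Bilinear

variable {ι κ : Type*} {I : Finset ι} {J : Finset κ}

theorem BilinBound.nonneg {K : ι → κ → ℂ} {M : ℝ} (h : BilinBound I J K M) : 0 ≤ M :=
  (_root_.norm_nonneg _).trans (h (fun _ => 0) (fun _ => 0) (by simp) (by simp))

theorem BilinBound.mono {K : ι → κ → ℂ} {M M' : ℝ} (h : BilinBound I J K M) (hM : M ≤ M') :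
    BilinBound I J K M' := fun α β hα hβ => (h α β hα hβ).trans hM

theorem BilinBound.congr {K K' : ι → κ → ℂ} {M : ℝ} (h : BilinBound I J K M)
    (hK : ∀ i ∈ I, ∀ j ∈ J, K i j = K' i j) : BilinBound I J K' M := by
  intro α β hα hβ
  have : ∑ i ∈ I, ∑ j ∈ J, α i * β j * K' i j = ∑ i ∈ I, ∑ j ∈ J, α i * β j * K i j :=
    Finset.sum_congr rfl fun i hi => Finset.sum_congr rfl fun j hj => by rw [hK i hi j hj]
  rw [this]
  exact h α β hα hβ

theorem BilinBound.add {K K' : ι → κ → ℂ} {M M' : ℝ} (h : BilinBound I J K M)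
    (h' : BilinBound I J K' M') : BilinBound I J (fun i j => K i j + K' i j) (M + M') := by
  intro α β hα hβ
  simp only [mul_add, Finset.sum_add_distrib]
  exact (norm_add_le _ _).trans (add_le_add (h α β hα hβ) (h' α β hα hβ))

theorem BilinBound.sum {γ : Type*} (s : Finset γ) {K : γ → ι → κ → ℂ} {M : γ → ℝ}
    (h : ∀ c ∈ s, BilinBound I J (K c) (M c)) :
    BilinBound I J (fun i j => ∑ c ∈ s, K c i j) (∑ c ∈ s, M c) := by
  classical
  induction s using Finset.induction_on with
  | empty => intro α β _ _; simp
  | insert c s hc ih =>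
    simp only [Finset.sum_insert hc]
    exact (h c (by simp)).add (ih fun c' hc' => h c' (by simp [hc']))

theorem BilinBound.const_mul {K : ι → κ → ℂ} {M : ℝ} (h : BilinBound I J K M) (c : ℂ) :
    BilinBound I J (fun i j => c * K i j) (‖c‖ * M) := by
  intro α β hα hβ
  have : ∑ i ∈ I, ∑ j ∈ J, α i * β j * (c * K i j) = c * ∑ i ∈ I, ∑ j ∈ J, α i * β j * K i j := by
    simp only [Finset.mul_sum]
    exact Finset.sum_congr rfl fun i _ => Finset.sum_congr rfl fun j _ => by ring
  rw [this, norm_mul]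
  exact mul_le_mul_of_nonneg_left (h α β hα hβ) (_root_.norm_nonneg _)

theorem exists_eq_mul_norm_le_one {γ : Type*} (S : Finset γ) (A : ℝ) (f : γ → ℂ) (hA : 0 ≤ A)
    (hf : ∀ i ∈ S, ‖f i‖ ≤ A) : ∃ g : γ → ℂ, (∀ i, ‖g i‖ ≤ 1) ∧ ∀ i ∈ S, f i = A * g i := by
  classical
  -- For `A = 0` the convention `x / 0 = 0` gives the value `0`, which is correct because `f` then
  -- vanishes on `S`.
  refine ⟨fun i => if i ∈ S then f i / A else 0, fun i => ?_, fun i hi => ?_⟩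
  · by_cases hi : i ∈ S
    · simp only [hi, if_true, norm_div, Complex.norm_real, Real.norm_of_nonneg hA]
      exact div_le_one_of_le₀ (hf i hi) hA
    · simp [hi]
  · simp only [hi, if_true]
    rcases hA.eq_or_lt with h0 | h0
    · have := hf i hi
      rw [← h0] at this
      simp [← h0, norm_le_zero_iff.1 this]
    · have : (A : ℂ) ≠ 0 := by exact_mod_cast h0.ne'
      field_simp

theorem BilinBound.apply_of_bounds {K : ι → κ → ℂ} {M A B : ℝ} (h : BilinBound I J K M)
    (hA : 0 ≤ A) (hB : 0 ≤ B) {α : ι → ℂ} {β : κ → ℂ} (hα : ∀ i ∈ I, ‖α i‖ ≤ A)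
    (hβ : ∀ j ∈ J, ‖β j‖ ≤ B) : ‖∑ i ∈ I, ∑ j ∈ J, α i * β j * K i j‖ ≤ A * B * M := by
  obtain ⟨a, ha, ha'⟩ := exists_eq_mul_norm_le_one I A α hA hα
  obtain ⟨b, hb, hb'⟩ := exists_eq_mul_norm_le_one J B β hB hβ
  have : ∑ i ∈ I, ∑ j ∈ J, α i * β j * K i j
      = (A * B : ℝ) * ∑ i ∈ I, ∑ j ∈ J, a i * b j * K i j := by
    simp only [Finset.mul_sum]
    refine Finset.sum_congr rfl fun i hi => Finset.sum_congr rfl fun j hj => ?_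
    rw [ha' i hi, hb' j hj]; push_cast; ring
  rw [this, norm_mul, Complex.norm_real, Real.norm_of_nonneg (mul_nonneg hA hB)]
  exact mul_le_mul_of_nonneg_left (h a b ha hb) (mul_nonneg hA hB)

theorem Separable.mul {F G : ι → κ → ℂ} {c c' : ℝ} (hF : Separable I J F c)
    (hG : Separable I J G c') : Separable I J (fun i j => F i j * G i j) (c * c') := by
  intro K M h
  have := hF _ _ (hG _ _ h)
  simpa only [mul_assoc] using this

theorem Separable.add {F G : ι → κ → ℂ} {c c' : ℝ} (hF : Separable I J F c)
    (hG : Separable I J G c') : Separable I J (fun i j => F i j + G i j) (c + c') := by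
  intro K M h
  have := (hF _ _ h).add (hG _ _ h)
  simpa only [add_mul] using this

theorem Separable.congr {F G : ι → κ → ℂ} {c : ℝ} (hF : Separable I J F c)
    (h : ∀ i ∈ I, ∀ j ∈ J, F i j = G i j) : Separable I J G c := fun K M hK =>
  (hF K M hK).congr fun i hi j hj => by rw [h i hi j hj]

theorem Separable.mono {F : ι → κ → ℂ} {c c' : ℝ} (hF : Separable I J F c) (h : c ≤ c') :
    Separable I J F c' := fun K M hK =>
  (hF K M hK).mono (mul_le_mul_of_nonneg_right h hK.nonneg)

theorem Separable.sum {γ : Type*} (s : Finset γ) {F : γ → ι → κ → ℂ} {c : γ → ℝ}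
    (h : ∀ x ∈ s, Separable I J (F x) (c x)) :
    Separable I J (fun i j => ∑ x ∈ s, F x i j) (∑ x ∈ s, c x) := by
  intro K M hK
  have := BilinBound.sum s fun x hx => h x hx K M hK
  simpa only [Finset.sum_mul] using this

theorem Separable.const_mul {F : ι → κ → ℂ} {c : ℝ} (hF : Separable I J F c) (a : ℂ) :
    Separable I J (fun i j => a * F i j) (‖a‖ * c) := by
  intro K M hK
  have := (hF K M hK).const_mul a
  simpa only [mul_assoc] using this

theorem separable_mul_mul {g : ι → ℂ} {h : κ → ℂ} (hg : ∀ i, ‖g i‖ ≤ 1) (hh : ∀ j, ‖h j‖ ≤ 1) :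
    Separable I J (fun i j => g i * h j) 1 := by
  intro K M hK α β hα hβ
  have := hK (fun i => α i * g i) (fun j => β j * h j)
    (fun i => by rw [norm_mul]; exact mul_le_one₀ (hα i) (_root_.norm_nonneg _) (hg i))
    (fun j => by rw [norm_mul]; exact mul_le_one₀ (hβ j) (_root_.norm_nonneg _) (hh j))
  rw [one_mul]
  refine le_of_eq_of_le (congrArg _ ?_) this
  exact Finset.sum_congr rfl fun i _ => Finset.sum_congr rfl fun j _ => by ring

theorem separable_one : Separable I J (fun _ _ => 1) 1 := by
  simpa using separable_mul_mul (I := I) (J := J) (g := fun _ => 1) (h := fun _ => 1)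
    (by simp) (by simp)

/-- Additive characters modulo an `n` above all the values detect equality: the indicator is an
average of `n` product kernels, so nothing is lost. -/
theorem separable_eq (x : ι → ℕ) (y : κ → ℕ) :
    Separable I J (fun i j => if x i = y j then 1 else 0) 1 := by
  classical
  obtain ⟨n, hn⟩ : ∃ n : ℕ, ∀ m ∈ I.image x ∪ J.image y, m < n :=
    ⟨(I.image x ∪ J.image y).sup id + 1, fun m hm =>
      Nat.lt_succ_of_le (Finset.le_sup (f := id) hm)⟩
  rcases Nat.eq_zero_or_pos n with h0 | h0
  · subst h0
    have hI : I = ∅ := by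
      rw [Finset.eq_empty_iff_forall_notMem]
      intro i hi
      exact absurd (hn (x i) (by simp only [mem_union, mem_image]; exact Or.inl ⟨i, hi, rfl⟩))
        (by omega)
    subst hI
    intro K M hK
    simpa [BilinBound] using hK
  have : NeZero n := ⟨h0.ne'⟩
  have hsep : ∀ h : ZMod n, Separable I J
      (fun i j => ZMod.stdAddChar (h * (x i : ZMod n)) * ZMod.stdAddChar (-(h * (y j : ZMod n)))) 1 :=
    fun h => separable_mul_mul (fun i => (AddChar.norm_apply _ _).le)
      (fun j => (AddChar.norm_apply _ _).le)
  have := (Separable.sum Finset.univ fun h _ => hsep h).const_mul ((n : ℂ)⁻¹)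
  have hc : ‖((n : ℂ)⁻¹)‖ * ∑ _h : ZMod n, (1 : ℝ) = 1 := by
    simp [ZMod.card, h0.ne']
  rw [hc] at this
  refine this.congr fun i hi j hj => ?_
  have h1 := AddChar.sum_mulShift (R := ZMod n) (R' := ℂ) ((x i : ZMod n) - (y j : ZMod n))
    (ZMod.isPrimitive_stdAddChar n)
  have h2 : ∑ h : ZMod n, (ZMod.stdAddChar (h * (x i : ZMod n)) *
      ZMod.stdAddChar (-(h * (y j : ZMod n))) : ℂ) =
      ∑ h : ZMod n, ZMod.stdAddChar (h * ((x i : ZMod n) - (y j : ZMod n))) := by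
    refine Finset.sum_congr rfl fun h _ => ?_
    rw [← AddChar.map_add_eq_mul]
    congr 1; ring
  rw [h2, h1, ZMod.card]
  have hxi : x i < n := hn _ (by simp only [mem_union, mem_image]; exact Or.inl ⟨i, hi, rfl⟩)
  have hyj : y j < n := hn _ (by simp only [mem_union, mem_image]; exact Or.inr ⟨j, hj, rfl⟩)
  have h3 : ((x i : ZMod n) - (y j : ZMod n) = 0) ↔ x i = y j := by
    rw [sub_eq_zero, ZMod.natCast_eq_natCast_iff']
    rw [Nat.mod_eq_of_lt hxi, Nat.mod_eq_of_lt hyj]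
  by_cases h : x i = y j
  · rw [if_pos (h3.2 h), if_pos h]
    have : (n : ℂ) ≠ 0 := by exact_mod_cast h0.ne'
    field_simp
  · rw [if_neg (fun h' => h (h3.1 h')), if_neg h]; simp

/-- Comparison digit by digit: `x < y` means that the halves are ordered, or that the halves agree
and the last bits are `0` and `1`. Each binary digit costs one equality kernel. -/
theorem separable_nat_lt (L : ℕ) : ∀ (x : ι → ℕ) (y : κ → ℕ), (∀ i ∈ I, x i < 2 ^ L) →
    (∀ j ∈ J, y j < 2 ^ L) → Separable I J (fun i j => if x i < y j then 1 else 0) L := by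
  induction L with
  | zero =>
    intro x y hx hy K M hK α β hα hβ
    rw [Finset.sum_eq_zero fun i hi => Finset.sum_eq_zero fun j hj => ?_]
    · simp
    · have h1 := hx i hi; have h2 := hy j hj
      simp only [pow_zero] at h1 h2
      have h3 : ¬ x i < y j := by omega
      simp [h3]
  | succ L ih =>
    intro x y hx hy
    have h1 := ih (fun i => x i / 2) (fun j => y j / 2)
      (fun i hi => by have := hx i hi; rw [pow_succ] at this; omega)
      (fun j hj => by have := hy j hj; rw [pow_succ] at this; omega)
    have h2 := (separable_eq (I := I) (J := J) (fun i => x i / 2) (fun j => y j / 2)).mul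
      (separable_mul_mul (I := I) (J := J) (g := fun i => if x i % 2 = 0 then 1 else 0)
        (h := fun j => if y j % 2 = 1 then 1 else 0)
        (fun i => by split_ifs <;> simp) (fun j => by split_ifs <;> simp))
    refine ((h1.add h2).congr fun i _ j _ => ?_).mono (by push_cast; linarith)
    have e1 : (x i < y j) ↔ (x i / 2 < y j / 2) ∨ (x i / 2 = y j / 2 ∧ x i % 2 = 0 ∧ y j % 2 = 1) := by
      omega
    have e2 : x i / 2 < y j / 2 → ¬ x i / 2 = y j / 2 := by omega
    by_cases ha : x i / 2 < y j / 2
    · simp [e1, ha, e2 ha]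
    · by_cases hb : x i / 2 = y j / 2 <;> by_cases hc : x i % 2 = 0 <;>
        by_cases hd : y j % 2 = 1 <;> simp [e1, ha, hb, hc, hd]

/-- Comparison of two real parameters separates at logarithmic cost. -/
theorem separable_lt (x : ι → ℝ) (y : κ → ℝ) :
    Separable I J (fun i j => if x i < y j then 1 else 0) (Nat.size #I) := by
  classical
  -- Real parameters are replaced by their rank among the `x i`. This preserves the comparison and
  -- produces integers with about `log #I` binary digits.
  set r : ℝ → ℕ := fun t => #(I.filter fun i => x i < t) with hr
  have hlt : ∀ t, r t < 2 ^ Nat.size #I := fun t =>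
    (Finset.card_filter_le _ _).trans_lt (Nat.lt_size_self _)
  refine (separable_nat_lt (I := I) (J := J) (Nat.size #I) (fun i => r (x i)) (fun j => r (y j))
    (fun i _ => hlt _) (fun j _ => hlt _)).congr fun i hi j _ => ?_
  have : r (x i) < r (y j) ↔ x i < y j := by
    constructor
    · intro h
      by_contra hc
      exact absurd h (not_lt.2 (Finset.card_le_card (Finset.monotone_filter_right I
        fun k _ hk => lt_of_lt_of_le hk (not_lt.1 hc))))
    · intro h
      refine Finset.card_lt_card ⟨Finset.monotone_filter_right I fun k _ hk => lt_trans hk h, ?_⟩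
      intro hc
      have := hc (show i ∈ I.filter fun k => x k < y j by simp [hi, h])
      simp at this
  simp only [this]

/-- Ranks again, but the rank of `y j` counts the `x i` up to and including it; a strict comparison
of ranks then encodes the weak comparison of values. -/
theorem separable_le (x : ι → ℝ) (y : κ → ℝ) :
    Separable I J (fun i j => if x i ≤ y j then 1 else 0) (Nat.size #I) := by
  classical
  set r : ℝ → ℕ := fun t => #(I.filter fun i => x i < t) with hr
  set r' : ℝ → ℕ := fun t => #(I.filter fun i => x i ≤ t) with hr'
  refine (separable_nat_lt (I := I) (J := J) (Nat.size #I) (fun i => r (x i)) (fun j => r' (y j))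
    (fun i _ => (Finset.card_filter_le _ _).trans_lt (Nat.lt_size_self _))
    (fun j _ => (Finset.card_filter_le _ _).trans_lt (Nat.lt_size_self _))).congr
    fun i hi j _ => ?_
  have : r (x i) < r' (y j) ↔ x i ≤ y j := by
    constructor
    · intro h
      by_contra hc
      exact absurd h (not_lt.2 (Finset.card_le_card (Finset.monotone_filter_right I
        fun k _ hk => lt_of_le_of_lt hk (not_le.1 hc))))
    · intro h
      refine Finset.card_lt_card ⟨Finset.monotone_filter_right I fun k _ hk => hk.le.trans h, ?_⟩
      intro hc
      have := hc (show i ∈ I.filter fun k => x k ≤ y j by simp [hi, h])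
      simp at this
  simp only [this]

/-- Once the class of `i` is fixed, the kernel depends on `j` alone. The cost is the number of
classes of the first variable only. -/
theorem separable_finite_class {P Q : Type*} [Fintype P] [Fintype Q] (p : ι → P) (q : κ → Q)
    (f : P → Q → ℂ) (hf : ∀ a b, ‖f a b‖ ≤ 1) :
    Separable I J (fun i j => f (p i) (q j)) (Fintype.card P) := by
  classical
  have := Separable.sum (I := I) (J := J) (Finset.univ : Finset P)
    (F := fun a i j => (if p i = a then 1 else 0) * f a (q j)) (c := fun _ => 1)
    fun a _ => separable_mul_mul (fun i => by split_ifs <;> simp) (fun j => hf _ _)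
  refine (this.congr fun i _ j _ => ?_).mono (by simp)
  simp

/-- Abel summation: `F i s` is `F i M` plus the differences `F i t - F i (t + 1)` for `s ≤ t < M`.
In each of these terms the variables meet only through the indicator of `s ≤ t`, which is free of
`i`. -/
theorem separable_of_variation (F : ι → ℤ → ℂ) {J : Finset ℤ} (M : ℕ) (D : ℤ → ℝ)
    (hJ : ∀ s ∈ J, -(M : ℤ) ≤ s ∧ s ≤ M) (hF : ∀ i, ‖F i M‖ ≤ 1)
    (hD : ∀ i ∈ I, ∀ s, ‖F i (s + 1) - F i s‖ ≤ D s) (hD0 : ∀ s, 0 ≤ D s) :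
    Separable I J F (1 + ∑ s ∈ Finset.Ico (-(M : ℤ)) M, D s) := by
  have h1 : Separable I J (fun i _ => F i M * 1) 1 :=
    separable_mul_mul (h := fun _ => 1) hF (by simp)
  have h2 : ∀ t ∈ Finset.Ico (-(M : ℤ)) M, Separable I J
      (fun i s => (F i t - F i (t + 1)) * if s ≤ t then 1 else 0) (D t) := by
    intro t _
    obtain ⟨g, hg, hg'⟩ := exists_eq_mul_norm_le_one I (D t) (fun i => F i t - F i (t + 1)) (hD0 t)
      (fun i hi => by rw [norm_sub_rev]; exact hD i hi t)
    have := (separable_mul_mul (I := I) (J := J) (h := fun s : ℤ => if s ≤ t then 1 else 0) hg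
      (fun s => by split_ifs <;> simp)).const_mul (D t)
    refine (this.congr fun i hi s _ => ?_).mono (by simp [abs_of_nonneg (hD0 t)])
    rw [hg' i hi]; ring
  refine (h1.add (Separable.sum _ h2)).congr fun i _ s hs => ?_
  obtain ⟨hs1, hs2⟩ := hJ s hs
  have h3 : ∑ t ∈ Finset.Ico (-(M : ℤ)) M, (F i t - F i (t + 1)) * (if s ≤ t then 1 else 0) =
      ∑ t ∈ Finset.Ico s M, (F i t - F i (t + 1)) := by
    simp only [mul_ite, mul_one, mul_zero]
    rw [← Finset.sum_filter]
    refine Finset.sum_congr ?_ fun _ _ => rfl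
    ext t; simp only [Finset.mem_filter, Finset.mem_Ico]; omega
  rw [h3]
  have h4 : ∀ n : ℕ, ∑ t ∈ Finset.Ico s (s + n), (F i t - F i (t + 1)) = F i s - F i (s + n) := by
    intro n
    induction n with
    | zero => simp
    | succ n ih =>
      have : Finset.Ico s (s + (n + 1 : ℕ)) = insert (s + (n : ℤ)) (Finset.Ico s (s + n)) := by
        ext t; simp only [Finset.mem_insert, Finset.mem_Ico]; omega
      rw [this, Finset.sum_insert (by simp), ih]
      push_cast
      rw [← add_assoc]; ring
  obtain ⟨n, hn⟩ := Int.eq_ofNat_of_zero_le (sub_nonneg.2 hs2)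
  have hn' : (M : ℤ) = s + n := by omega
  rw [hn', h4]; ring

/-- Coefficients over a fibre add up to a single coefficient, of size at most the number of elements
of the fibre. This lets indices carry extra data at the price of the multiplicities. -/
theorem BilinBound.comp {ι' κ' : Type*} {I' : Finset ι'} {J' : Finset κ'} {K : ι → κ → ℂ} {M : ℝ}
    (h : BilinBound I J K M) (π : ι' → ι) (ρ : κ' → κ) (F G : ℕ)
    (hπ : ∀ i ∈ I', π i ∈ I) (hρ : ∀ j ∈ J', ρ j ∈ J) 
    (hF : ∀ i ∈ I, ∀ s ⊆ I', (∀ x ∈ s, π x = i) → #s ≤ F)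
    (hG : ∀ j ∈ J, ∀ s ⊆ J', (∀ x ∈ s, ρ x = j) → #s ≤ G) :
    BilinBound I' J' (fun i j => K (π i) (ρ j)) (F * G * M) := by
  classical
  intro α β hα hβ
  have key : ∑ i ∈ I', ∑ j ∈ J', α i * β j * K (π i) (ρ j) =
      ∑ i ∈ I, ∑ j ∈ J, (∑ i' ∈ I' with π i' = i, α i') * (∑ j' ∈ J' with ρ j' = j, β j') * K i j := by
    rw [← Finset.sum_fiberwise_of_maps_to hπ]
    refine Finset.sum_congr rfl fun i _ => ?_
    have : ∀ i' ∈ I'.filter (fun i' => π i' = i), ∑ j ∈ J', α i' * β j * K (π i') (ρ j) =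
        ∑ j ∈ J, α i' * (∑ j' ∈ J' with ρ j' = j, β j') * K i j := by
      intro i' hi'
      rw [← Finset.sum_fiberwise_of_maps_to hρ]
      refine Finset.sum_congr rfl fun j _ => ?_
      rw [Finset.mul_sum, Finset.sum_mul]
      refine Finset.sum_congr rfl fun j' hj' => ?_
      rw [(Finset.mem_filter.1 hi').2, (Finset.mem_filter.1 hj').2]
    rw [Finset.sum_congr rfl this, Finset.sum_comm]
    refine Finset.sum_congr rfl fun j _ => ?_
    rw [Finset.sum_mul, Finset.sum_mul]
  rw [key]
  refine h.apply_of_bounds (by positivity) (by positivity) (fun i hi => ?_) (fun j hj => ?_)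
  · refine (norm_sum_le_of_le _ (fun x _ => hα x)).trans ?_
    rw [Finset.sum_const, nsmul_eq_mul, mul_one]
    exact_mod_cast hF i hi _ (Finset.filter_subset _ _) fun x hx => (Finset.mem_filter.1 hx).2
  · refine (norm_sum_le_of_le _ (fun x _ => hβ x)).trans ?_
    rw [Finset.sum_const, nsmul_eq_mul, mul_one]
    exact_mod_cast hG j hj _ (Finset.filter_subset _ _) fun x hx => (Finset.mem_filter.1 hx).2

end Bilinear

/-! ### Norms and divisor bounds in `ℤ[i]` -/

namespace GaussSum

/-- The norm `r² + s²` of the Gaussian integer `r + is`, as a natural number. -/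
def nrm (z : GaussianInt) : ℕ := z.norm.natAbs

theorem nrm_mul (z w : GaussianInt) : nrm (z * w) = nrm z * nrm w := by
  simp [nrm, Zsqrtd.norm_mul, Int.natAbs_mul]

@[simp] theorem nrm_one : nrm 1 = 1 := by simp [nrm]

theorem nrm_pow (z : GaussianInt) (e : ℕ) : nrm (z ^ e) = nrm z ^ e := by
  induction e with
  | zero => simp
  | succ e ih => rw [pow_succ, nrm_mul, ih, pow_succ]

theorem cast_nrm (z : GaussianInt) : (nrm z : ℤ) = z.re ^ 2 + z.im ^ 2 := by
  rw [nrm, GaussianInt.abs_natCast_norm, Zsqrtd.norm_def]; ring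

theorem nrm_eq_zero {z : GaussianInt} : nrm z = 0 ↔ z = 0 := by
  rw [nrm, Int.natAbs_eq_zero, GaussianInt.norm_eq_zero]

theorem nrm_pos {z : GaussianInt} : 0 < nrm z ↔ z ≠ 0 := by
  rw [Nat.pos_iff_ne_zero, Ne, nrm_eq_zero]

theorem nrm_dvd_nrm {z w : GaussianInt} (h : z ∣ w) : nrm z ∣ nrm w := by
  obtain ⟨c, rfl⟩ := h; exact ⟨_, nrm_mul _ _⟩

theorem isUnit_iff_nrm {z : GaussianInt} : IsUnit z ↔ nrm z = 1 := by
  rw [← Zsqrtd.norm_eq_one_iff]; rfl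

theorem two_le_nrm_of_prime {π : GaussianInt} (h : Prime π) : 2 ≤ nrm π := by
  have h0 : nrm π ≠ 0 := fun h' => h.ne_zero (nrm_eq_zero.1 h')
  have h1 : nrm π ≠ 1 := fun h' => h.not_isUnit (isUnit_iff_nrm.2 h')
  omega

/-- The Gaussian integers of norm at most `X`. -/
noncomputable def ball (X : ℕ) : Finset GaussianInt :=
  ((Icc (-(Nat.sqrt X : ℤ)) (Nat.sqrt X) ×ˢ Icc (-(Nat.sqrt X : ℤ)) (Nat.sqrt X)).image
    fun p => (⟨p.1, p.2⟩ : GaussianInt)).filter fun z => nrm z ≤ X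

theorem mem_ball {X : ℕ} {z : GaussianInt} : z ∈ ball X ↔ nrm z ≤ X := by
  simp only [ball, mem_filter, mem_image, mem_product, mem_Icc, Prod.exists, and_iff_right_iff_imp]
  intro h
  have h1 := cast_nrm z
  have key : ∀ a : ℤ, a ^ 2 ≤ nrm z → -(Nat.sqrt X : ℤ) ≤ a ∧ a ≤ Nat.sqrt X := by
    intro a ha
    have : a.natAbs ≤ Nat.sqrt X := by
      rw [Nat.le_sqrt']
      zify
      rw [sq_abs]
      exact ha.trans (by exact_mod_cast h)
    omega
  have hr := key z.re (by nlinarith [sq_nonneg z.im])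
  have hi := key z.im (by nlinarith [sq_nonneg z.re])
  exact ⟨z.re, z.im, ⟨hr, hi⟩, rfl⟩

theorem card_ball_le (X : ℕ) (hX : 1 ≤ X) : #(ball X) ≤ 9 * X := by
  have h1 : #(ball X) ≤ (2 * Nat.sqrt X + 1) * (2 * Nat.sqrt X + 1) := by
    refine (card_filter_le _ _).trans (card_image_le.trans ?_)
    rw [card_product, Int.card_Icc]
    have : ((Nat.sqrt X : ℤ) + 1 - -(Nat.sqrt X : ℤ)).toNat = 2 * Nat.sqrt X + 1 := by omega
    rw [this]
  have h2 : Nat.sqrt X * Nat.sqrt X ≤ X := Nat.sqrt_le X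
  have h3 : 1 ≤ Nat.sqrt X := Nat.le_sqrt.2 (by simpa using hX)
  nlinarith

/-- The set of divisors of `z` up to units. -/
def divClasses (z : GaussianInt) : Set (Associates GaussianInt) :=
  {a | ∃ w, w ∣ z ∧ Associates.mk w = a}

theorem finite_divClasses {z : GaussianInt} (hz : z ≠ 0) : (divClasses z).Finite := by
  refine ((ball (nrm z)).finite_toSet.image Associates.mk).subset ?_
  rintro _ ⟨w, hw, rfl⟩
  refine ⟨w, ?_, rfl⟩
  rw [mem_coe, mem_ball]
  exact Nat.le_of_dvd (nrm_pos.2 hz) (nrm_dvd_nrm hw)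

theorem ncard_divClasses_mul {x y : GaussianInt} (hx : x ≠ 0) (hy : y ≠ 0) :
    (divClasses (x * y)).ncard ≤ (divClasses x).ncard * (divClasses y).ncard := by
  rw [← Set.ncard_prod]
  have hfin := (finite_divClasses hx).prod (finite_divClasses hy)
  refine (Set.ncard_le_ncard ?_ (hfin.image fun p => p.1 * p.2)).trans (Set.ncard_image_le hfin)
  rintro _ ⟨w, hw, rfl⟩
  obtain ⟨a, b, ha, hb, rfl⟩ := exists_dvd_and_dvd_of_dvd_mul hw
  exact ⟨(Associates.mk a, Associates.mk b), ⟨⟨a, ha, rfl⟩, ⟨b, hb, rfl⟩⟩, rfl⟩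

theorem ncard_divClasses_prime_pow {π : GaussianInt} (hπ : Prime π) (e : ℕ) :
    (divClasses (π ^ e)).ncard ≤ e + 1 := by
  classical
  have h : divClasses (π ^ e) ⊆ ((range (e + 1)).image fun i => Associates.mk (π ^ i) : Finset _) := by
    rintro _ ⟨w, hw, rfl⟩
    obtain ⟨i, hi, h⟩ := (dvd_prime_pow hπ e).1 hw
    rw [coe_image]
    exact ⟨i, by simpa using Nat.lt_succ_of_le hi, (Associates.mk_eq_mk_iff_associated.2 h).symm⟩
  refine (Set.ncard_le_ncard h (finite_toSet _)).trans ?_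
  rw [Set.ncard_coe_finset]
  exact card_image_le.trans (by simp)

theorem ncard_divClasses_unit {x : GaussianInt} (hx : IsUnit x) : (divClasses x).ncard ≤ 1 := by
  refine (Set.ncard_le_ncard (t := {1}) ?_ (Set.finite_singleton _)).trans (by simp)
  rintro _ ⟨w, hw, rfl⟩
  exact Associates.mk_eq_one.2 (isUnit_of_dvd_unit hw hx)

/-- The classical argument prime by prime: a prime of large norm satisfies `e + 1 ≤ 2^e ≤ (nrm
π)^(eε)`, and each of the finitely many small primes costs at most a constant factor `A`. The weight
`wt` collects these factors and is multiplicative on coprime arguments, so the induction on coprime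
factorizations closes. -/
theorem exists_ncard_divClasses_le (ε : ℝ) (hε : 0 < ε) :
    ∃ C : ℝ, 0 < C ∧ ∀ z : GaussianInt, z ≠ 0 → ((divClasses z).ncard : ℝ) ≤ C * (nrm z : ℝ) ^ ε := by
  classical
  set A : ℝ := max 1 (1 / (ε * Real.log 2)) with hA
  have hA1 : 1 ≤ A := le_max_left _ _
  have hlog : 0 < Real.log 2 := Real.log_pos (by norm_num)
  -- Beyond this norm `(nrm π)^ε ≥ 2`.
  set B : ℕ := ⌈(2 : ℝ) ^ (1 / ε)⌉₊ with hB
  set S : Finset (Associates GaussianInt) := ((ball B).filter fun π => Prime π).image Associates.mk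
    with hS
  have hSp : ∀ p ∈ S, Prime p := by
    intro p hp
    obtain ⟨π, hπ, rfl⟩ := mem_image.1 hp
    exact Associates.prime_mk.2 (mem_filter.1 hπ).2
  set wt : GaussianInt → ℝ := fun z => ∏ p ∈ S, if p ∣ Associates.mk z then A else 1 with hwt
  have hwt1 : ∀ z, 1 ≤ wt z := fun z => by
    exact Finset.prod_induction _ (fun t : ℝ => 1 ≤ t)
      (fun a b ha hb => one_le_mul_of_one_le_of_one_le ha hb) le_rfl
      fun p _ => by split_ifs <;> linarith
  have hpow : ∀ (e : ℕ), (e : ℝ) + 1 ≤ A * ((2 : ℝ) ^ e) ^ ε := by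
    intro e
    have h1 : 1 + ε * e * Real.log 2 ≤ ((2 : ℝ) ^ e) ^ ε := by
      rw [← Real.rpow_natCast, ← Real.rpow_mul (by norm_num), Real.rpow_def_of_pos (by norm_num)]
      have := Real.add_one_le_exp (Real.log 2 * (e * ε))
      linarith
    have h2 : 1 ≤ A * (ε * Real.log 2) := by
      have := le_max_right 1 (1 / (ε * Real.log 2))
      rw [← hA, div_le_iff₀ (by positivity)] at this
      exact this
    have h3 : 0 ≤ A := by linarith
    have h4 : (0 : ℝ) ≤ e := by positivity
    nlinarith [mul_le_mul_of_nonneg_left h1 h3, mul_le_mul_of_nonneg_right h2 h4]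
  have main : ∀ z : GaussianInt, z ≠ 0 → ((divClasses z).ncard : ℝ) ≤ wt z * (nrm z : ℝ) ^ ε := by
    intro z
    refine UniqueFactorizationMonoid.induction_on_coprime z (fun h => absurd rfl h) ?_ ?_ ?_
    · intro x hx _
      rw [isUnit_iff_nrm.1 hx]
      have : ((divClasses x).ncard : ℝ) ≤ 1 := by exact_mod_cast ncard_divClasses_unit hx
      simpa using this.trans (hwt1 x)
    · intro π e hπ _
      have h1 : ((divClasses (π ^ e)).ncard : ℝ) ≤ e + 1 := by
        exact_mod_cast ncard_divClasses_prime_pow hπ e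
      refine h1.trans ?_
      rw [nrm_pow]
      rcases Nat.eq_zero_or_pos e with rfl | he
      · simpa using hwt1 1
      by_cases hs : nrm π ≤ B
      · have hmem : Associates.mk π ∈ S :=
          mem_image_of_mem _ (mem_filter.2 ⟨mem_ball.2 hs, hπ⟩)
        have hAw : A ≤ wt (π ^ e) := by
          rw [hwt]
          simp only
          rw [← Finset.mul_prod_erase S _ hmem,
            if_pos (Associates.mk_dvd_mk.2 (dvd_pow_self π he.ne'))]
          refine le_mul_of_one_le_right (by linarith) (Finset.prod_induction _ (fun t : ℝ => 1 ≤ t)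
            (fun a b ha hb => one_le_mul_of_one_le_of_one_le ha hb) le_rfl
            fun p _ => by split_ifs <;> linarith)
        refine (hpow e).trans (mul_le_mul hAw ?_ (by positivity) (by linarith [hwt1 (π ^ e)]))
        refine Real.rpow_le_rpow (by positivity) ?_ hε.le
        push_cast
        exact pow_le_pow_left₀ (by norm_num) (by exact_mod_cast two_le_nrm_of_prime hπ) e
      · have hb : (2 : ℝ) ^ (1 / ε) ≤ nrm π := (Nat.le_ceil _).trans (by exact_mod_cast (not_le.1 hs).le)
        have h2 : (2 : ℝ) ≤ (nrm π : ℝ) ^ ε := by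
          have := Real.rpow_le_rpow (by positivity) hb hε.le
          rwa [← Real.rpow_mul (by norm_num), one_div_mul_cancel hε.ne', Real.rpow_one] at this
        have h3 : (e : ℝ) + 1 ≤ 2 ^ e := by exact_mod_cast Nat.lt_two_pow_self
        calc (e : ℝ) + 1 ≤ 2 ^ e := h3
          _ ≤ ((nrm π : ℝ) ^ ε) ^ e := pow_le_pow_left₀ (by norm_num) h2 e
          _ = 1 * ((nrm π ^ e : ℕ) : ℝ) ^ ε := by
            rw [one_mul]; push_cast
            rw [← Real.rpow_natCast, ← Real.rpow_natCast, ← Real.rpow_mul (by positivity),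
              ← Real.rpow_mul (by positivity), mul_comm]
          _ ≤ _ := mul_le_mul_of_nonneg_right (hwt1 _) (by positivity)
    · intro x y hxy hx hy hxy0
      have hx0 : x ≠ 0 := left_ne_zero_of_mul hxy0
      have hy0 : y ≠ 0 := right_ne_zero_of_mul hxy0
      have hw : wt x * wt y = wt (x * y) := by
        rw [hwt]
        simp only
        rw [← Finset.prod_mul_distrib]
        refine Finset.prod_congr rfl fun p hp => ?_
        have hpp := hSp p hp
        obtain ⟨π, rfl⟩ := Associates.mk_surjective p
        rw [Associates.prime_mk] at hpp
        simp only [Associates.mk_dvd_mk, hpp.dvd_mul]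
        by_cases h1 : π ∣ x <;> by_cases h2 : π ∣ y <;> simp [h1, h2]
        exact absurd (hxy h1 h2) hpp.not_isUnit
      calc ((divClasses (x * y)).ncard : ℝ) ≤ (divClasses x).ncard * (divClasses y).ncard := by
            exact_mod_cast ncard_divClasses_mul hx0 hy0
        _ ≤ (wt x * (nrm x : ℝ) ^ ε) * (wt y * (nrm y : ℝ) ^ ε) := by
            have := hwt1 x
            exact mul_le_mul (hx hx0) (hy hy0) (by positivity) (by positivity)
        _ = wt (x * y) * (nrm (x * y) : ℝ) ^ ε := by
            rw [← hw, nrm_mul]; push_cast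
            rw [Real.mul_rpow (by positivity) (by positivity)]; ring
  refine ⟨A ^ #S, by positivity, fun z hz => (main z hz).trans ?_⟩
  refine mul_le_mul_of_nonneg_right ?_ (by positivity)
  rw [hwt]
  refine (Finset.prod_le_prod (fun p _ => by split_ifs <;> linarith)
    (g := fun _ => A) fun p _ => by split_ifs <;> linarith).trans (by simp)

/-- The divisor bound in `ℤ[i]`. -/
theorem exists_card_divisors_le (ε : ℝ) (hε : 0 < ε) :
    ∃ C : ℝ, 1 ≤ C ∧ ∀ z : GaussianInt, z ≠ 0 → ∀ s : Finset GaussianInt, (∀ w ∈ s, w ∣ z) →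
      (#s : ℝ) ≤ C * (nrm z : ℝ) ^ ε := by
  classical
  obtain ⟨C, hC, h⟩ := exists_ncard_divClasses_le ε hε
  refine ⟨max 1 (9 * C), le_max_left _ _, fun z hz s hs => ?_⟩
  -- Associates differ by a unit, and units lie in `ball 1`, which has at most 9 elements.
  have h1 : #s ≤ 9 * #(s.image (Associates.mk (M := GaussianInt))) := by
    refine Finset.card_le_mul_card_image (f := (Associates.mk (M := GaussianInt))) s 9 fun a ha => ?_
    obtain ⟨w, hw, rfl⟩ := mem_image.1 ha
    refine (Finset.card_le_card (t := (ball 1).image fun u : GaussianInt => w * u) ?_).trans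
      (card_image_le.trans (card_ball_le 1 le_rfl))
    intro x hx
    obtain ⟨u, hu⟩ := Associates.mk_eq_mk_iff_associated.1 (mem_filter.1 hx).2.symm
    exact mem_image.2 ⟨u, mem_ball.2 (isUnit_iff_nrm.1 u.isUnit).le, hu⟩
  have h2 : #(s.image (Associates.mk (M := GaussianInt))) ≤ (divClasses z).ncard := by
    rw [← Set.ncard_coe_finset]
    refine Set.ncard_le_ncard ?_ (finite_divClasses hz)
    intro a ha
    obtain ⟨w, hw, rfl⟩ := mem_image.1 (mem_coe.1 ha)
    exact ⟨w, hs w hw, rfl⟩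
  calc (#s : ℝ) ≤ 9 * (divClasses z).ncard := by exact_mod_cast h1.trans (by omega)
    _ ≤ 9 * (C * (nrm z : ℝ) ^ ε) := by gcongr; exact h z hz
    _ = (9 * C) * (nrm z : ℝ) ^ ε := by ring
    _ ≤ _ := mul_le_mul_of_nonneg_right (le_max_right _ _) (by positivity)

theorem nrm_natCast (n : ℕ) : nrm (n : GaussianInt) = n ^ 2 := by
  have := cast_nrm (n : GaussianInt)
  simp only [Zsqrtd.re_natCast, Zsqrtd.im_natCast] at this
  zify; rw [this]; ring

theorem nrm_intCast (n : ℤ) : nrm (n : GaussianInt) = n.natAbs ^ 2 := by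
  have := cast_nrm (n : GaussianInt)
  simp only [Zsqrtd.re_intCast, Zsqrtd.im_intCast] at this
  zify; rw [this, sq_abs]; ring

/-- The divisor bound in `ℤ`. -/
theorem exists_card_int_divisors_le (ε : ℝ) (hε : 0 < ε) :
    ∃ C : ℝ, 1 ≤ C ∧ ∀ n : ℤ, n ≠ 0 → ∀ s : Finset ℤ, (∀ w ∈ s, w ∣ n) →
      (#s : ℝ) ≤ C * (n.natAbs : ℝ) ^ ε := by
  -- Integer divisors are Gaussian divisors, and the norm of `n` is `n²`; hence the halved exponent.
  obtain ⟨C, hC, h⟩ := exists_card_divisors_le (ε / 2) (by positivity)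
  refine ⟨C, hC, fun n hn s hs => ?_⟩
  have h1 := h n (by exact_mod_cast hn) (s.map ⟨Int.cast, Int.cast_injective⟩) (by
    intro w hw
    obtain ⟨m, hm, rfl⟩ := mem_map.1 hw
    exact Int.cast_dvd_cast _ _ (hs m hm))
  rw [card_map, nrm_intCast] at h1
  refine h1.trans_eq ?_
  push_cast
  rw [← Real.rpow_natCast, ← Real.rpow_mul (by positivity)]
  congr 2; push_cast; ring

theorem exists_card_nat_divisors_le (ε : ℝ) (hε : 0 < ε) :
    ∃ C : ℝ, 1 ≤ C ∧ ∀ n : ℕ, n ≠ 0 → (#n.divisors : ℝ) ≤ C * (n : ℝ) ^ ε := by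
  obtain ⟨C, hC, h⟩ := exists_card_int_divisors_le ε hε
  refine ⟨C, hC, fun n hn => ?_⟩
  have h1 := h n (by exact_mod_cast hn) (n.divisors.map ⟨Nat.cast, Nat.cast_injective⟩) (by
    intro w hw
    obtain ⟨m, hm, rfl⟩ := mem_map.1 hw
    exact Int.natCast_dvd_natCast.2 (Nat.dvd_of_mem_divisors hm))
  simpa using h1

end GaussSum

/-! ### Kernels multiplicative in one variable -/

/-- Hölder's inequality in one variable followed by Cauchy's inequality in the products of the other:
a bilinear bound for a kernel that is multiplicative in one variable. -/
theorem bilinBound_of_multiplicative {V ι : Type*} [CommMonoid V] [DecidableEq V]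
    (I : Finset ι) (J J' : Finset V) (κ : V → ι → ℤ) (n : ℕ) (T D M : ℝ)
    (hmul : ∀ w ∈ I, ∀ v v', κ (v * v') w = κ v w * κ v' w) (hone : ∀ w ∈ I, κ 1 w = 1)
    (hmem : ∀ f : Fin (n + 1) → V, (∀ i, f i ∈ J) → ∏ i, f i ∈ J') (hT0 : 0 ≤ T)
    (hT : ∀ v ∈ J', (#{f ∈ Fintype.piFinset fun _ : Fin (n + 1) => J | ∏ i, f i = v} : ℝ) ≤ T)
    (hD : ∑ w ∈ I, ∑ w' ∈ I, |((∑ v ∈ J', κ v w * κ v w' : ℤ) : ℝ)| ≤ D)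
    (hM : 0 ≤ M) (hMD : (#I : ℝ) ^ n * (T * Real.sqrt (#J' * D)) ≤ M ^ (n + 1)) :
    BilinBound I J (fun w v => (κ v w : ℂ)) M := by
  classical
  intro α β hα hβ
  set B : ι → ℂ := fun w => ∑ v ∈ J, β v * κ v w with hB
  have h1 : ‖∑ w ∈ I, ∑ v ∈ J, α w * β v * (κ v w : ℂ)‖ ≤ ∑ w ∈ I, ‖B w‖ := by
    refine norm_sum_le_of_le _ fun w _ => ?_
    have : ∑ v ∈ J, α w * β v * (κ v w : ℂ) = α w * B w := by
      rw [hB, Finset.mul_sum]; exact Finset.sum_congr rfl fun _ _ => by ring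
    rw [this, norm_mul]
    exact mul_le_of_le_one_left (norm_nonneg _) (hα w)
  have h2 : (∑ w ∈ I, ‖B w‖) ^ (n + 1) ≤ (#I : ℝ) ^ n * ∑ w ∈ I, ‖B w‖ ^ (n + 1) := by
    rcases I.eq_empty_or_nonempty with rfl | hI
    · simp
    have h := pow_sum_div_card_le_sum_pow (s := I) (f := fun w => ‖B w‖) (fun _ _ => norm_nonneg _) n
    rwa [div_le_iff₀ (by have := hI.card_pos; positivity), mul_comm] at h
  -- Unimodular factors that turn the absolute values into the analytic expressions `B w ^ (n + 1)`,
  -- which can be expanded.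
  have hc : ∀ w, ∃ c : ℂ, ‖c‖ ≤ 1 ∧ ((‖B w‖ ^ (n + 1) : ℝ) : ℂ) = c * B w ^ (n + 1) := by
    intro w
    by_cases h0 : B w = 0
    · exact ⟨0, by simp, by simp [h0]⟩
    · refine ⟨(‖B w‖ / B w) ^ (n + 1), ?_, ?_⟩
      · rw [norm_pow, norm_div, Complex.norm_real, norm_norm, div_self (norm_ne_zero_iff.2 h0)]
        simp
      · rw [div_pow, div_mul_cancel₀ _ (pow_ne_zero _ h0)]; push_cast; rfl
  choose c hc1 hc2 using hc
  set G : V → ℂ := fun v => ∑ w ∈ I, c w * κ v w with hG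
  have hprod : ∀ w ∈ I, ∀ f : Fin (n + 1) → V, κ (∏ i, f i) w = ∏ i, κ (f i) w := by
    intro w hw f
    let φ : V →* ℤ := ⟨⟨fun v => κ v w, hone w hw⟩, hmul w hw⟩
    exact map_prod φ f Finset.univ
  have hpow : ∀ w ∈ I, B w ^ (n + 1) = ∑ f ∈ Fintype.piFinset fun _ : Fin (n + 1) => J,
      (∏ i, β (f i)) * κ (∏ i, f i) w := by
    intro w hw
    have := Finset.prod_univ_sum (fun _ : Fin (n + 1) => J) (fun _ v => β v * (κ v w : ℂ))
    rw [Finset.prod_const, Finset.card_univ, Fintype.card_fin] at this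
    rw [hB]
    refine this.trans (Finset.sum_congr rfl fun f _ => ?_)
    rw [Finset.prod_mul_distrib, hprod w hw]; push_cast; rfl
  -- In the expanded power the kernel depends only on the product `v` of the variables, and each `v`
  -- is hit at most `T` times.
  have h3 : ∑ w ∈ I, ‖B w‖ ^ (n + 1) ≤ T * ∑ v ∈ J', ‖G v‖ := by
    have e1 : ((∑ w ∈ I, ‖B w‖ ^ (n + 1) : ℝ) : ℂ) =
        ∑ f ∈ Fintype.piFinset fun _ : Fin (n + 1) => J, (∏ i, β (f i)) * G (∏ i, f i) := by
      push_cast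
      have : ∀ w ∈ I, ((‖B w‖ : ℂ)) ^ (n + 1) =
          ∑ f ∈ Fintype.piFinset fun _ : Fin (n + 1) => J, (∏ i, β (f i)) * (c w * κ (∏ i, f i) w) := by
        intro w hw
        have := hc2 w
        push_cast at this
        rw [this, hpow w hw, Finset.mul_sum]
        exact Finset.sum_congr rfl fun _ _ => by ring
      rw [Finset.sum_congr rfl this, Finset.sum_comm]
      exact Finset.sum_congr rfl fun f _ => by rw [hG, Finset.mul_sum]
    have e2 : ∑ w ∈ I, ‖B w‖ ^ (n + 1) = ‖((∑ w ∈ I, ‖B w‖ ^ (n + 1) : ℝ) : ℂ)‖ := by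
      rw [Complex.norm_real, Real.norm_of_nonneg (Finset.sum_nonneg fun _ _ => by positivity)]
    rw [e2, e1]
    refine (norm_sum_le_of_le (f := fun f : Fin (n + 1) → V => (∏ i, β (f i)) * G (∏ i, f i)) (n := fun f => ‖G (∏ i, f i)‖) _ fun f _ => ?_).trans ?_
    · rw [norm_mul]
      refine mul_le_of_le_one_left (norm_nonneg _) ?_
      rw [norm_prod]
      exact Finset.prod_le_one (fun _ _ => norm_nonneg _) fun i _ => hβ _
    · rw [← Finset.sum_fiberwise_of_maps_to (t := J') (g := fun f : Fin (n + 1) → V => ∏ i, f i)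
        (fun f hf => hmem f fun i => Fintype.mem_piFinset.1 hf i), Finset.mul_sum]
      refine Finset.sum_le_sum fun v hv => ?_
      rw [Finset.sum_congr rfl (g := fun _ => ‖G v‖) fun f hf => by rw [(mem_filter.1 hf).2],
        Finset.sum_const, nsmul_eq_mul]
      exact mul_le_mul_of_nonneg_right (hT v hv) (norm_nonneg _)
  -- Opening the square leaves sums over all `v ∈ J'` with no coefficients depending on `v`; the
  -- cancellation recorded in `D` enters here.
  have h4 : ∑ v ∈ J', ‖G v‖ ^ 2 ≤ D := by
    have e1 : ((∑ v ∈ J', ‖G v‖ ^ 2 : ℝ) : ℂ) = ∑ w ∈ I, ∑ w' ∈ I,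
        c w * (starRingEnd ℂ) (c w') * ((∑ v ∈ J', κ v w * κ v w' : ℤ) : ℂ) := by
      push_cast
      have : ∀ v ∈ J', ((‖G v‖ : ℂ)) ^ 2 =
          ∑ w ∈ I, ∑ w' ∈ I, c w * (starRingEnd ℂ) (c w') * ((κ v w : ℂ) * κ v w') := by
        intro v _
        rw [← Complex.mul_conj', hG]
        simp only [map_sum, map_mul, map_intCast]
        rw [Finset.sum_mul_sum]
        exact Finset.sum_congr rfl fun _ _ => Finset.sum_congr rfl fun _ _ => by ring
      rw [Finset.sum_congr rfl this, Finset.sum_comm]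
      refine Finset.sum_congr rfl fun w _ => ?_
      rw [Finset.sum_comm]
      exact Finset.sum_congr rfl fun w' _ => by rw [Finset.mul_sum]
    have e2 : ∑ v ∈ J', ‖G v‖ ^ 2 = ‖((∑ v ∈ J', ‖G v‖ ^ 2 : ℝ) : ℂ)‖ := by
      rw [Complex.norm_real, Real.norm_of_nonneg (Finset.sum_nonneg fun _ _ => by positivity)]
    rw [e2, e1]
    refine le_trans (norm_sum_le_of_le _ fun w _ => norm_sum_le_of_le _ fun w' _ => ?_) hD
    rw [norm_mul, norm_mul, RCLike.norm_conj, Complex.norm_intCast]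
    exact mul_le_of_le_one_left (abs_nonneg _) (mul_le_one₀ (hc1 w) (norm_nonneg _) (hc1 w'))
  have h5 : ∑ v ∈ J', ‖G v‖ ≤ Real.sqrt (#J' * D) := by
    refine Real.le_sqrt_of_sq_le ?_
    exact sq_sum_le_card_mul_sum_sq.trans (mul_le_mul_of_nonneg_left h4 (by positivity))
  refine h1.trans (le_of_pow_le_pow_left₀ (n := n + 1) (by omega) hM ?_)
  calc (∑ w ∈ I, ‖B w‖) ^ (n + 1) ≤ (#I : ℝ) ^ n * ∑ w ∈ I, ‖B w‖ ^ (n + 1) := h2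
    _ ≤ (#I : ℝ) ^ n * (T * Real.sqrt (#J' * D)) := by
        refine mul_le_mul_of_nonneg_left (h3.trans ?_) (by positivity)
        exact mul_le_mul_of_nonneg_left h5 hT0
    _ ≤ _ := hMD

/-! ### Incomplete periodic sums and bilinear forms in rational Jacobi symbols -/

/-- Blocks of length `q` contribute nothing; fewer than `q` terms are left over. -/
theorem abs_sum_range_le_of_sum_period_eq_zero (f : ℤ → ℤ) (q : ℕ) (hq : 0 < q) (B : ℤ)
    (hB : ∀ x, |f x| ≤ B) (h0 : ∀ a : ℤ, ∑ i ∈ range q, f (a + i) = 0) (n : ℕ) :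
    ∀ a : ℤ, |∑ i ∈ range n, f (a + i)| ≤ q * B := by
  have hB0 : 0 ≤ B := (abs_nonneg _).trans (hB 0)
  induction n using Nat.strong_induction_on with
  | _ n ih =>
    intro a
    by_cases hn : n < q
    · refine (abs_sum_le_sum_abs _ _).trans ((Finset.sum_le_sum fun i _ => hB _).trans ?_)
      rw [Finset.sum_const, card_range, nsmul_eq_mul]
      exact mul_le_mul_of_nonneg_right (by exact_mod_cast hn.le) hB0
    · obtain ⟨m, rfl⟩ := Nat.exists_eq_add_of_le (not_lt.1 hn)
      rw [Finset.sum_range_add, h0, zero_add]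
      have := ih m (by omega) (a + q)
      simpa [add_assoc] using this

/-- Strips of width `q` in the second variable are removed one at a time. Within a strip the
one-dimensional lemma applies to the inner sums, which are at most `q` in size; a last strip of
width below `q` is bounded trivially. -/
theorem abs_sum_range_range_le (g : ℤ → ℤ → ℤ) (q : ℕ) (hq : 0 < q)
    (hg : ∀ x y, |g x y| ≤ 1)
    (h0 : ∀ a b : ℤ, ∑ i ∈ range q, ∑ j ∈ range q, g (a + i) (b + j) = 0) (n m : ℕ) :
    ∀ a b : ℤ, |∑ i ∈ range n, ∑ j ∈ range m, g (a + i) (b + j)| ≤ q * m + q * n := by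
  induction m using Nat.strong_induction_on with
  | _ m ih =>
    intro a b
    by_cases hm : m < q
    · have : |∑ i ∈ range n, ∑ j ∈ range m, g (a + i) (b + j)| ≤ ∑ i ∈ range n, (m : ℤ) := by
        refine (abs_sum_le_sum_abs _ _).trans (Finset.sum_le_sum fun i _ => ?_)
        refine (abs_sum_le_sum_abs _ _).trans ((Finset.sum_le_sum fun j _ => hg _ _).trans ?_)
        simp
      refine this.trans ?_
      rw [Finset.sum_const, card_range, nsmul_eq_mul]
      have : (n : ℤ) * m ≤ n * q := mul_le_mul_of_nonneg_left (by exact_mod_cast hm.le) (by positivity)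
      have : (0 : ℤ) ≤ q * m := by positivity
      nlinarith
    · obtain ⟨m', rfl⟩ := Nat.exists_eq_add_of_le (not_lt.1 hm)
      have h1 := abs_sum_range_le_of_sum_period_eq_zero (fun x => ∑ j ∈ range q, g x (b + j)) q hq q
        (fun x => (abs_sum_le_sum_abs _ _).trans ((Finset.sum_le_sum fun j _ => hg _ _).trans
          (by simp))) (fun a => h0 a b) n a
      have h2 := ih m' (by omega) a (b + q)
      simp only [Finset.sum_range_add, Finset.sum_add_distrib]
      refine (abs_add_le _ _).trans ?_
      push_cast
      simp only [add_assoc] at h2 ⊢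
      nlinarith

theorem sum_range_intCast {β : Type*} [AddCommMonoid β] (q : ℕ) [NeZero q] (F : ZMod q → β) (a : ℤ) :
    ∑ i ∈ range q, F ((a + i : ℤ) : ZMod q) = ∑ y, F y := by
  have h1 : ∀ F' : ZMod q → β, ∑ i ∈ range q, F' (i : ZMod q) = ∑ y, F' y := by
    intro F'
    refine Finset.sum_nbij' (fun n => (n : ZMod q)) (fun y => y.val) (by simp)
      (fun y _ => by simpa using y.val_lt) (fun n hn => ?_) (fun y _ => by simp) (by simp)
    simpa [ZMod.val_natCast] using Nat.mod_eq_of_lt (mem_range.1 hn)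
  have h2 := h1 fun y => F ((a : ZMod q) + y)
  rw [← Equiv.sum_comp (Equiv.addLeft (a : ZMod q)) F]
  simpa using h2

/-- Multiplication by the unit `c` permutes the residues and changes the sign of `f`, so the
complete sum equals its own negative. -/
theorem sum_range_eq_zero_of_antiperiodic (f : ℤ → ℤ) (q : ℕ) [NeZero q] (c : ℤ)
    (hper : ∀ x y : ℤ, (x : ZMod q) = y → f x = f y) (hc : IsUnit (c : ZMod q))
    (hf : ∀ x, f (c * x) = - f x) (a : ℤ) : ∑ i ∈ range q, f (a + i) = 0 := by
  have h1 : ∀ x : ℤ, f x = (fun y : ZMod q => f (y.val : ℤ)) (x : ZMod q) := fun x =>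
    hper _ _ (by simp)
  have h0 : ∑ i ∈ range q, f (a + i) = ∑ y : ZMod q, f (y.val : ℤ) :=
    (Finset.sum_congr rfl fun i _ => h1 _).trans (sum_range_intCast q (fun y : ZMod q => f (y.val : ℤ)) a)
  rw [h0]
  obtain ⟨u, hu⟩ := hc
  have h2 := Equiv.sum_comp (Units.mulLeft u) fun y : ZMod q => f (y.val : ℤ)
  have h3 : ∀ y : ZMod q, f ((((Units.mulLeft u) y).val : ℕ) : ℤ) = - f (y.val : ℤ) := by
    intro y
    rw [← hf]
    exact hper _ _ (by simp [hu])
  rw [Finset.sum_congr rfl fun y _ => h3 y, Finset.sum_neg_distrib] at h2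
  linarith

theorem sum_range_range_eq_zero_of_antiperiodic (g : ℤ → ℤ → ℤ) (q : ℕ) [NeZero q] (c : ℤ)
    (hper : ∀ x y x' y' : ℤ, (x : ZMod q) = x' → (y : ZMod q) = y' → g x y = g x' y')
    (hc : IsUnit (c : ZMod q)) (hg : ∀ x y, g (c * x) (c * y) = - g x y) (a b : ℤ) :
    ∑ i ∈ range q, ∑ j ∈ range q, g (a + i) (b + j) = 0 := by
  set G : ZMod q → ZMod q → ℤ := fun x y => g (x.val : ℤ) (y.val : ℤ) with hG
  have h1 : ∀ x y : ℤ, g x y = G (x : ZMod q) (y : ZMod q) := fun x y =>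
    hper _ _ _ _ (by simp) (by simp)
  have h0 : ∑ i ∈ range q, ∑ j ∈ range q, g (a + i) (b + j) = ∑ x, ∑ y, G x y := by
    rw [← sum_range_intCast q (fun x => ∑ y, G x y) a]
    refine Finset.sum_congr rfl fun i _ => ?_
    rw [← sum_range_intCast q (fun y => G _ y) b]
    exact Finset.sum_congr rfl fun j _ => h1 _ _
  rw [h0]
  obtain ⟨u, hu⟩ := hc
  have h2 : ∑ x, ∑ y, G (Units.mulLeft u x) (Units.mulLeft u y) = ∑ x, ∑ y, G x y := by
    rw [Equiv.sum_comp (Units.mulLeft u) (fun x => ∑ y, G x (Units.mulLeft u y))]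
    exact Finset.sum_congr rfl fun x _ => Equiv.sum_comp (Units.mulLeft u) (fun y => G x y)
  have h3 : ∀ x y : ZMod q, G (Units.mulLeft u x) (Units.mulLeft u y) = - G x y := by
    intro x y
    rw [hG]
    simp only
    rw [← hg]
    exact hper _ _ _ _ (by simp [hu]) (by simp [hu])
  simp only [h3, Finset.sum_neg_distrib] at h2
  linarith

open NumberTheorySymbols in
-- Some prime divides a nonsquare `M` to an odd power. By the Chinese remainder theorem `c` can be a
-- nonresidue at that prime and `1` modulo the rest of `M`.
theorem exists_jacobiSym_eq_neg_one {M : ℕ} (hM : Odd M) (hsq : ¬ IsSquare M) :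
    ∃ c : ℤ, J(c | M) = -1 := by
  have hM0 : M ≠ 0 := by rintro rfl; simp at hM
  obtain ⟨p, hp, hodd⟩ : ∃ p, p.Prime ∧ Odd (M.factorization p) := by
    by_contra! h
    apply hsq
    rw [← Nat.prod_factorization_pow_eq_self hM0, Finsupp.prod]
    refine Finset.isSquare_prod _ fun p hp => ?_
    have := h p (Nat.prime_of_mem_primeFactors hp)
    exact (Nat.not_odd_iff_even.1 this).isSquare_pow _
  have : Fact p.Prime := ⟨hp⟩
  have hp2 : p ≠ 2 := by
    rintro rfl
    have : M.factorization 2 ≠ 0 := by rintro h; rw [h] at hodd; simp at hodd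
    have := Nat.dvd_of_factorization_pos this
    exact (Nat.not_even_iff_odd.2 hM) (even_iff_two_dvd.2 this)
  obtain ⟨a, ha⟩ := FiniteField.exists_nonsquare (F := ZMod p) (by rwa [ZMod.ringChar_zmod_n])
  set e := M.factorization p
  have hM' : p ^ e * (M / p ^ e) = M := Nat.ordProj_mul_ordCompl_eq_self M p
  have hcop : Nat.Coprime (p ^ e) (M / p ^ e) := (Nat.coprime_ordCompl hp hM0).pow_left _
  obtain ⟨c, hc1, hc2⟩ := Nat.chineseRemainder hcop a.val 1
  have hne : M / p ^ e ≠ 0 := fun h => hM0 (by rw [← hM', h, mul_zero])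
  refine ⟨c, ?_⟩
  rw [← hM', jacobiSym.mul_right' _ (pow_ne_zero _ hp.ne_zero) hne, jacobiSym.pow_right]
  have e1 : J((c : ℤ) | p) = -1 := by
    rw [← jacobiSym.legendreSym.to_jacobiSym, legendreSym.eq_neg_one_iff]
    have : ((c : ℤ) : ZMod p) = a := by
      have h : c ≡ a.val [MOD p] := hc1.of_dvd (dvd_pow_self p (by
        rintro h; rw [h] at hodd; simp at hodd))
      have := (ZMod.natCast_eq_natCast_iff _ _ _).2 h
      simpa using this
    rwa [this]
  have e2 : J((c : ℤ) | M / p ^ e) = 1 := by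
    rw [jacobiSym.mod_left' (a₂ := 1), jacobiSym.one_left]
    exact_mod_cast hc2
  rw [e1, e2, mul_one, hodd.neg_one_pow]

/-- If `a` is the squarefree part of `m`, then `mn` is a square only for `n = a r²`, so `r ≤ √W`
determines `n`. -/
theorem card_isSquare_mul_le {m : ℕ} (hm : m ≠ 0) (W : ℕ) :
    #{n ∈ Icc 1 W | IsSquare (m * n)} ≤ Nat.sqrt W := by
  obtain ⟨a, b, hab, ha⟩ := Nat.sq_mul_squarefree m
  have hb : b ≠ 0 := by rintro rfl; simp at hab; exact hm hab.symm
  have ha0 : a ≠ 0 := by rintro rfl; simp at hab; exact hm hab.symm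
  refine (card_le_card (t := (Icc 1 (Nat.sqrt W)).image fun t => a * t ^ 2) ?_).trans
    (card_image_le.trans (by simp))
  intro n hn
  simp only [mem_filter, mem_Icc] at hn
  obtain ⟨⟨hn1, hnW⟩, s, hs⟩ := hn
  have hbs : b ∣ s := by
    rw [← Nat.pow_dvd_pow_iff (n := 2) (by norm_num)]
    exact ⟨a * n, by rw [sq s, ← hs, ← hab]; ring⟩
  obtain ⟨t, rfl⟩ := hbs
  have h1 : a * n = t ^ 2 := by
    have : b ^ 2 * (a * n) = b ^ 2 * t ^ 2 := by rw [← mul_assoc, hab, hs]; ring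
    exact Nat.eq_of_mul_eq_mul_left (by positivity) this
  have h2 : a ∣ t := (ha.dvd_pow_iff_dvd (by norm_num)).1 ⟨n, h1.symm⟩
  obtain ⟨r, rfl⟩ := h2
  have h3 : n = a * r ^ 2 := by
    have : a * n = a * (a * r ^ 2) := by rw [h1]; ring
    exact Nat.eq_of_mul_eq_mul_left (by positivity) this
  refine mem_image.2 ⟨r, mem_Icc.2 ⟨?_, ?_⟩, h3.symm⟩
  · rcases Nat.eq_zero_or_pos r with rfl | h
    · simp at h3; omega
    · exact h
  · rw [Nat.le_sqrt']
    calc r ^ 2 ≤ a * r ^ 2 := Nat.le_mul_of_pos_left _ (by positivity)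
      _ ≤ W := h3 ▸ hnW

/-- Every factor of `v` divides `v`, so divisor bounds control the multiplicity `T` in
`bilinBound_of_multiplicative`. -/
theorem card_piFinset_prod_eq_le {V : Type*} [CommMonoid V] [DecidableEq V] (J : Finset V)
    [DecidableRel ((· ∣ ·) : V → V → Prop)] (n : ℕ) (v : V) :
    #{f ∈ Fintype.piFinset fun _ : Fin n => J | ∏ i, f i = v} ≤ #{d ∈ J | d ∣ v} ^ n := by
  refine (card_le_card (t := Fintype.piFinset fun _ : Fin n => J.filter (· ∣ v)) ?_).trans
    (by simp)
  intro f hf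
  obtain ⟨h1, rfl⟩ := mem_filter.1 hf
  rw [Fintype.mem_piFinset] at h1 ⊢
  exact fun i => mem_filter.2 ⟨h1 i, Finset.dvd_prod_of_mem f (mem_univ i)⟩

theorem sum_Icc_neg_eq_sum_range {β : Type*} [AddCommMonoid β] (f : ℤ → β) (A : ℕ) :
    ∑ v ∈ Icc (-(A : ℤ)) A, f v = ∑ i ∈ range (2 * A + 1), f (-(A : ℤ) + i) := by
  refine (Finset.sum_nbij' (fun i : ℕ => -(A : ℤ) + i) (fun v => (v + A).toNat) ?_ ?_ ?_ ?_ ?_).symm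
  · intro i hi; simp only [mem_range, mem_Icc] at *; omega
  · intro i hi; simp only [mem_range, mem_Icc] at *; omega
  · intro i hi; simp only [mem_range] at *; omega
  · intro i hi; simp only [mem_Icc] at *; omega
  · intro i _; rfl

theorem abs_jacobiSym_le_one (a : ℤ) (b : ℕ) : |J(a | b)| ≤ 1 := by
  rcases jacobiSym.trichotomy a b with h | h | h <;> rw [h] <;> norm_num

theorem norm_jacobiSym_le_one (a : ℤ) (b : ℕ) : ‖(J(a | b) : ℂ)‖ ≤ 1 := by
  rw [Complex.norm_intCast]; exact_mod_cast abs_jacobiSym_le_one a b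

theorem jacobiSym_congr_of_cast_eq {b q : ℕ} (hbq : b ∣ q) {x y : ℤ} (h : (x : ZMod q) = y) :
    J(x | b) = J(y | b) := by
  refine jacobiSym.mod_left' ?_
  have := (ZMod.intCast_eq_intCast_iff _ _ _).1 h
  exact this.of_dvd (by exact_mod_cast hbq)

theorem isUnit_cast_of_jacobiSym_eq_neg_one {c : ℤ} {q : ℕ} (h : J(c | q) = -1) :
    IsUnit (c : ZMod q) := by
  have : c.gcd q = 1 := by
    by_contra hc
    rcases Nat.eq_zero_or_pos q with rfl | hq
    · simp at h
    have : NeZero q := ⟨hq.ne'⟩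
    rw [jacobiSym.eq_zero_iff_not_coprime.2 hc] at h
    norm_num at h
  rw [ZMod.coe_int_isUnit_iff_isCoprime]
  exact (Int.isCoprime_iff_gcd_eq_one.2 this).symm

/-- Bilinear forms in Jacobi symbols of rational integers. -/
theorem exists_bilinBound_jacobi : ∃ C : ℝ, 0 < C ∧ ∀ L : ℕ, 1 ≤ L →
    BilinBound {R ∈ Icc (-(L : ℤ)) L | Odd R} {S ∈ Icc (-(L : ℤ)) L | S ≠ 0}
      (fun R S => (J(S | R.natAbs) : ℂ)) (C * (L : ℝ) ^ (39 / 20 : ℝ)) := by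
  obtain ⟨C, hC, hdiv⟩ := GaussSum.exists_card_int_divisors_le (1 / 100) (by norm_num)
  refine ⟨5 * C, by positivity, fun L hL => ?_⟩
  have hL' : (1 : ℝ) ≤ L := by exact_mod_cast hL
  set I : Finset ℤ := {R ∈ Icc (-(L : ℤ)) L | Odd R} with hI
  set J₀ : Finset ℤ := {S ∈ Icc (-(L : ℤ)) L | S ≠ 0} with hJ₀
  have hcardI : #I ≤ 3 * L := by
    refine (card_filter_le _ _).trans ?_
    rw [Int.card_Icc]; omega
  have hImem : ∀ R ∈ I, R ≠ 0 ∧ Odd R.natAbs ∧ R.natAbs ≤ L ∧ 1 ≤ R.natAbs := by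
    intro R hR
    obtain ⟨h1, h2⟩ := mem_filter.1 hR
    have h0 : R ≠ 0 := by rintro rfl; simp at h2
    rw [mem_Icc] at h1
    exact ⟨h0, Int.natAbs_odd.2 h2, by omega, by omega⟩
  have hdeg : ∀ R ∈ I, #{R' ∈ I | IsSquare (R.natAbs * R'.natAbs)} ≤ 2 * Nat.sqrt L := by
    intro R hR
    have h1 : #{R' ∈ I | IsSquare (R.natAbs * R'.natAbs)} ≤
        2 * #{n ∈ Icc 1 L | IsSquare (R.natAbs * n)} := by
      refine card_le_mul_card_image_of_maps_to (f := Int.natAbs) ?_ 2 ?_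
      · intro R' hR'
        obtain ⟨h2, h3⟩ := mem_filter.1 hR'
        have := hImem R' h2
        exact mem_filter.2 ⟨mem_Icc.2 ⟨this.2.2.2, this.2.2.1⟩, h3⟩
      · intro n _
        refine (card_le_card (t := {(n : ℤ), -(n : ℤ)}) ?_).trans card_le_two
        intro x hx
        have := (mem_filter.1 hx).2
        simp only [mem_insert, mem_singleton]
        omega
    exact h1.trans (Nat.mul_le_mul_left _ (card_isSquare_mul_le (by have := hImem R hR; omega) L))
  -- Off the squares the product of symbols has modulus at most `L²` and its complete sums vanish.
  -- This is shorter than the range `L³` of triple products, which is why three copies of `S` are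
  -- multiplied.
  have hinner : ∀ R ∈ I, ∀ R' ∈ I,
      |((∑ v ∈ Icc (-((L ^ 3 : ℕ) : ℤ)) (L ^ 3 : ℕ), J(v | R.natAbs) * J(v | R'.natAbs) : ℤ) : ℝ)| ≤
        (if IsSquare (R.natAbs * R'.natAbs) then 3 * (L : ℝ) ^ 3 else 0) + (L : ℝ) ^ 2 := by
    intro R hR R' hR'
    obtain ⟨h1, h2, h3, h4⟩ := hImem R hR
    obtain ⟨h1', h2', h3', h4'⟩ := hImem R' hR'
    split_ifs with hs
    · have : |(∑ v ∈ Icc (-((L ^ 3 : ℕ) : ℤ)) (L ^ 3 : ℕ), J(v | R.natAbs) * J(v | R'.natAbs) : ℤ)| ≤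
          2 * (L ^ 3 : ℕ) + 1 := by
        refine (abs_sum_le_sum_abs _ _).trans ((Finset.sum_le_sum (g := fun _ => (1 : ℤ))
          fun v _ => ?_).trans ?_)
        · rw [abs_mul]; exact mul_le_one₀ (abs_jacobiSym_le_one _ _) (abs_nonneg _) (abs_jacobiSym_le_one _ _)
        · rw [Finset.sum_const, Int.card_Icc, nsmul_eq_mul]; omega
      have h5 : |((∑ v ∈ Icc (-((L ^ 3 : ℕ) : ℤ)) (L ^ 3 : ℕ), J(v | R.natAbs) * J(v | R'.natAbs) : ℤ) : ℝ)| ≤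
          2 * (L : ℝ) ^ 3 + 1 := by exact_mod_cast this
      have : (1 : ℝ) ≤ (L : ℝ) ^ 3 := one_le_pow₀ hL'
      nlinarith [sq_nonneg (L : ℝ)]
    · rw [zero_add]
      have hq0 : 0 < R.natAbs * R'.natAbs := Nat.mul_pos h4 h4'
      have : NeZero (R.natAbs * R'.natAbs) := ⟨hq0.ne'⟩
      obtain ⟨c, hc⟩ := exists_jacobiSym_eq_neg_one (h2.mul h2') hs
      rw [sum_Icc_neg_eq_sum_range]
      have hz := sum_range_eq_zero_of_antiperiodic (fun v => J(v | R.natAbs) * J(v | R'.natAbs))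
        (R.natAbs * R'.natAbs) c
        (fun x y hxy => by
          rw [jacobiSym_congr_of_cast_eq (dvd_mul_right _ _) hxy,
            jacobiSym_congr_of_cast_eq (dvd_mul_left _ _) hxy])
        (isUnit_cast_of_jacobiSym_eq_neg_one hc)
        (fun x => by
          rw [jacobiSym.mul_left, jacobiSym.mul_left]
          rw [jacobiSym.mul_right' _ (by omega) (by omega)] at hc
          linear_combination (J(x | R.natAbs) * J(x | R'.natAbs)) * hc)
      have := abs_sum_range_le_of_sum_period_eq_zero (fun v => J(v | R.natAbs) * J(v | R'.natAbs))
        (R.natAbs * R'.natAbs) hq0 1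
        (fun x => by
          rw [abs_mul]
          exact mul_le_one₀ (abs_jacobiSym_le_one _ _) (abs_nonneg _) (abs_jacobiSym_le_one _ _))
        hz (2 * L ^ 3 + 1) (-((L ^ 3 : ℕ) : ℤ))
      have h5 : ((R.natAbs * R'.natAbs : ℕ) : ℤ) * 1 ≤ (L : ℤ) ^ 2 := by
        rw [mul_one, sq]; exact_mod_cast Nat.mul_le_mul h3 h3'
      exact_mod_cast this.trans h5
  -- The square pairs dominate: about `L` values of `R`, at most `2√L` partners each, and `L³`
  -- values of `v`.
  have hD : ∑ R ∈ I, ∑ R' ∈ I,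
      |((∑ v ∈ Icc (-((L ^ 3 : ℕ) : ℤ)) (L ^ 3 : ℕ), J(v | R.natAbs) * J(v | R'.natAbs) : ℤ) : ℝ)| ≤
      27 * (L : ℝ) ^ (9 / 2 : ℝ) := by
    have hrow : ∀ R ∈ I, ∑ R' ∈ I,
      |((∑ v ∈ Icc (-((L ^ 3 : ℕ) : ℤ)) (L ^ 3 : ℕ), J(v | R.natAbs) * J(v | R'.natAbs) : ℤ) : ℝ)| ≤
      9 * (L : ℝ) ^ (7 / 2 : ℝ) := by
      intro R hR
      refine (Finset.sum_le_sum fun R' hR' => hinner R hR R' hR').trans ?_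
      rw [Finset.sum_add_distrib, ← Finset.sum_filter, Finset.sum_const, Finset.sum_const,
        nsmul_eq_mul, nsmul_eq_mul]
      have h1 : (#{R' ∈ I | IsSquare (R.natAbs * R'.natAbs)} : ℝ) ≤ 2 * (L : ℝ) ^ (1 / 2 : ℝ) := by
        have h2 : ((2 * Nat.sqrt L : ℕ) : ℝ) ≤ 2 * (L : ℝ) ^ (1 / 2 : ℝ) := by
          push_cast; rw [← Real.sqrt_eq_rpow]; gcongr; exact Real.nat_sqrt_le_real_sqrt
        exact le_trans (by exact_mod_cast hdeg R hR) h2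
      have h2 : (#I : ℝ) ≤ 3 * L := by exact_mod_cast hcardI
      have e1 : (L : ℝ) ^ (7 / 2 : ℝ) = (L : ℝ) ^ (1 / 2 : ℝ) * (L : ℝ) ^ 3 := by
        rw [← Real.rpow_natCast, ← Real.rpow_add (by positivity)]; norm_num
      have e2 : (L : ℝ) ^ 3 ≤ (L : ℝ) ^ (7 / 2 : ℝ) := by
        rw [← Real.rpow_natCast]; exact Real.rpow_le_rpow_of_exponent_le hL' (by norm_num)
      have h3 : (#{R' ∈ I | IsSquare (R.natAbs * R'.natAbs)} : ℝ) * (3 * (L : ℝ) ^ 3) ≤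
          6 * (L : ℝ) ^ (7 / 2 : ℝ) := by
        rw [e1]
        nlinarith [mul_le_mul_of_nonneg_right h1 (show (0 : ℝ) ≤ 3 * (L : ℝ) ^ 3 by positivity)]
      have h4 : (#I : ℝ) * (L : ℝ) ^ 2 ≤ 3 * (L : ℝ) ^ 3 := by
        nlinarith [mul_le_mul_of_nonneg_right h2 (show (0 : ℝ) ≤ (L : ℝ) ^ 2 by positivity)]
      linarith
    refine (Finset.sum_le_sum hrow).trans ?_
    rw [Finset.sum_const, nsmul_eq_mul]
    have h2 : (#I : ℝ) ≤ 3 * L := by exact_mod_cast hcardI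
    have e1 : (L : ℝ) ^ (9 / 2 : ℝ) = L * (L : ℝ) ^ (7 / 2 : ℝ) := by
      nth_rewrite 2 [← Real.rpow_one (L : ℝ)]
      rw [← Real.rpow_add (by positivity)]; norm_num
    rw [e1]
    nlinarith [mul_le_mul_of_nonneg_right h2 (show (0 : ℝ) ≤ (L : ℝ) ^ (7 / 2 : ℝ) by positivity)]
  have hT : ∀ v ∈ Icc (-((L ^ 3 : ℕ) : ℤ)) (L ^ 3 : ℕ),
      (#{f ∈ Fintype.piFinset fun _ : Fin (2 + 1) => J₀ | ∏ i, f i = v} : ℝ) ≤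
        (C * (L : ℝ) ^ (3 / 100 : ℝ)) ^ 3 := by
    -- The product `0` does not arise, because `0` was removed from `J₀`; the divisor bound would
    -- fail there.
    intro v hv
    by_cases hv0 : v = 0
    · rw [Finset.filter_eq_empty_iff.2, card_empty]
      · simp; positivity
      · intro f hf hc
        rw [hv0, Finset.prod_eq_zero_iff] at hc
        obtain ⟨i, _, hi⟩ := hc
        exact (mem_filter.1 (Fintype.mem_piFinset.1 hf i)).2 hi
    · have h1 : (#{f ∈ Fintype.piFinset fun _ : Fin (2 + 1) => J₀ | ∏ i, f i = v} : ℝ) ≤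
          (#{d ∈ J₀ | d ∣ v} : ℝ) ^ 3 := by exact_mod_cast card_piFinset_prod_eq_le J₀ 3 v
      refine h1.trans (pow_le_pow_left₀ (by positivity) ?_ 3)
      refine (hdiv v hv0 _ fun w hw => (mem_filter.1 hw).2).trans ?_
      refine mul_le_mul_of_nonneg_left ?_ (by linarith)
      have h2 : (v.natAbs : ℝ) ≤ (L : ℝ) ^ 3 := by
        have : v.natAbs ≤ L ^ 3 := by rw [mem_Icc] at hv; omega
        exact_mod_cast this
      refine (Real.rpow_le_rpow (by positivity) h2 (by norm_num)).trans_eq ?_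
      rw [← Real.rpow_natCast, ← Real.rpow_mul (by positivity)]; norm_num
  refine bilinBound_of_multiplicative I J₀ (Icc (-((L ^ 3 : ℕ) : ℤ)) (L ^ 3 : ℕ))
    (fun S R => J(S | R.natAbs)) 2 ((C * (L : ℝ) ^ (3 / 100 : ℝ)) ^ 3) (27 * (L : ℝ) ^ (9 / 2 : ℝ)) _
    (fun R _ v v' => jacobiSym.mul_left _ _ _) (fun R _ => jacobiSym.one_left _) ?_ (by positivity)
    hT hD (by positivity) ?_
  · intro f hf
    have h1 : |∏ i, f i| ≤ (L : ℤ) ^ 3 := by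
      rw [Finset.abs_prod]
      refine (Finset.prod_le_prod (fun _ _ => abs_nonneg _) (g := fun _ => (L : ℤ)) fun i _ => ?_).trans
        (by simp)
      have := (mem_Icc.1 (mem_filter.1 (hf i)).1)
      exact abs_le.2 this
    rw [mem_Icc]; push_cast; exact abs_le.1 h1
  -- Exponents: `2 + 9/100 + 15/4` is below `117/20`, which is three times `39/20`.
  · have h1 : (#(Icc (-((L ^ 3 : ℕ) : ℤ)) (L ^ 3 : ℕ)) : ℝ) ≤ 3 * (L : ℝ) ^ 3 := by
      have : #(Icc (-((L ^ 3 : ℕ) : ℤ)) (L ^ 3 : ℕ)) ≤ 3 * L ^ 3 := by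
        rw [Int.card_Icc]
        have : 1 ≤ L ^ 3 := Nat.one_le_pow _ _ hL
        omega
      exact_mod_cast this
    have h2 : (#I : ℝ) ≤ 3 * L := by exact_mod_cast hcardI
    have h3 : Real.sqrt (#(Icc (-((L ^ 3 : ℕ) : ℤ)) (L ^ 3 : ℕ)) * (27 * (L : ℝ) ^ (9 / 2 : ℝ))) ≤
        9 * (L : ℝ) ^ (15 / 4 : ℝ) := by
      refine Real.sqrt_le_iff.2 ⟨by positivity, ?_⟩
      have e1 : (9 * (L : ℝ) ^ (15 / 4 : ℝ)) ^ 2 = 3 * (L : ℝ) ^ 3 * (27 * (L : ℝ) ^ (9 / 2 : ℝ)) := by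
        have e2 : ((L : ℝ) ^ (15 / 4 : ℝ)) ^ 2 = (L : ℝ) ^ 3 * (L : ℝ) ^ (9 / 2 : ℝ) := by
          rw [← Real.rpow_natCast, ← Real.rpow_natCast, ← Real.rpow_mul (by positivity),
            ← Real.rpow_add (by positivity)]; norm_num
        rw [mul_pow, e2]; ring
      rw [e1]; gcongr
    calc (#I : ℝ) ^ 2 * ((C * (L : ℝ) ^ (3 / 100 : ℝ)) ^ 3 *
          Real.sqrt (#(Icc (-((L ^ 3 : ℕ) : ℤ)) (L ^ 3 : ℕ)) * (27 * (L : ℝ) ^ (9 / 2 : ℝ))))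
        ≤ (3 * (L : ℝ)) ^ 2 * ((C * (L : ℝ) ^ (3 / 100 : ℝ)) ^ 3 * (9 * (L : ℝ) ^ (15 / 4 : ℝ))) := by
          gcongr
      _ = 81 * C ^ 3 * ((L : ℝ) ^ (2 : ℝ) * ((L : ℝ) ^ (9 / 100 : ℝ) * (L : ℝ) ^ (15 / 4 : ℝ))) := by
          have e1 : ((L : ℝ) ^ (3 / 100 : ℝ)) ^ 3 = (L : ℝ) ^ (9 / 100 : ℝ) := by
            rw [← Real.rpow_natCast, ← Real.rpow_mul (by positivity)]; norm_num
          have e2 : (L : ℝ) ^ (2 : ℝ) = (L : ℝ) ^ 2 := by exact_mod_cast Real.rpow_natCast (L : ℝ) 2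
          rw [mul_pow, mul_pow, e1, e2]; ring
      _ ≤ 125 * C ^ 3 * (L : ℝ) ^ (117 / 20 : ℝ) := by
          rw [← Real.rpow_add (by positivity), ← Real.rpow_add (by positivity)]
          gcongr
          · norm_num
          · norm_num
      _ = (5 * C * (L : ℝ) ^ (39 / 20 : ℝ)) ^ (2 + 1) := by
          have e1 : ((L : ℝ) ^ (39 / 20 : ℝ)) ^ 3 = (L : ℝ) ^ (117 / 20 : ℝ) := by
            rw [← Real.rpow_natCast, ← Real.rpow_mul (by positivity)]; norm_num
          rw [← e1]; ring

/-! ### The quadratic symbol attached to a primitive Gaussian integer -/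

namespace GaussSum

/-- Gaussian integers `u + iv` with `u` odd, `v` even and `gcd(u, v) = 1`. -/
def IsOddPrimitive (w : GaussianInt) : Prop := Odd w.re ∧ Even w.im ∧ IsCoprime w.re w.im

noncomputable instance : DecidablePred IsOddPrimitive := Classical.decPred _

noncomputable instance : DecidablePred IsPrimary := Classical.decPred _

/-- The quadratic symbol `(Re (wz) / |w|²)`. -/
def dirichletSym (z w : GaussianInt) : ℤ := J((w * z).re | nrm w)

theorem nrm_mod_four {w : GaussianInt} (h1 : Odd w.re) (h2 : Even w.im) : nrm w % 4 = 1 := by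
  obtain ⟨a, ha⟩ := h1
  obtain ⟨b, hb⟩ := h2
  have := cast_nrm w
  rw [ha, hb] at this
  have h3 : (nrm w : ℤ) = 4 * (a ^ 2 + a + b ^ 2) + 1 := by rw [this]; ring
  omega

theorem odd_nrm {w : GaussianInt} (h1 : Odd w.re) (h2 : Even w.im) : Odd (nrm w) := by
  have := nrm_mod_four h1 h2
  rw [Nat.odd_iff]; omega

theorem jacobiSym_neg_of_mod_four {m : ℕ} (hm : m % 4 = 1) (a : ℤ) : J(-a | m) = J(a | m) := by
  rw [jacobiSym.neg _ (Nat.odd_iff.2 (by omega)), ZMod.χ₄_nat_one_mod_four hm, one_mul]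

theorem jacobiSym_natAbs_of_mod_four {m : ℕ} (hm : m % 4 = 1) (a : ℤ) :
    J((a.natAbs : ℤ) | m) = J(a | m) := by
  rcases Int.natAbs_eq a with h | h
  · rw [← h]
  · nth_rewrite 2 [h]; rw [jacobiSym_neg_of_mod_four hm]

/-- With `w = u + iv` and `|w|² ≡ 1 (mod 4)`, reciprocity turns the symbol into `(u² + v² / |u|) =
(v² / |u|)`, which is `1` because `u` and `v` are coprime. -/
theorem IsOddPrimitive.jacobiSym_re {w : GaussianInt} (h : IsOddPrimitive w) :
    J(w.re | nrm w) = 1 := by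
  obtain ⟨h1, h2, h3⟩ := h
  have hm := nrm_mod_four h1 h2
  rw [← jacobiSym_natAbs_of_mod_four hm,
    jacobiSym.quadratic_reciprocity_one_mod_four' (Int.natAbs_odd.2 h1) hm, cast_nrm,
    jacobiSym.mod_left' (a₂ := w.im ^ 2)]
  · refine jacobiSym.sq_one' ?_
    have := Int.isCoprime_iff_gcd_eq_one.1 h3.symm
    rwa [Int.gcd, Int.natAbs_natCast]
  · have : (w.re.natAbs : ℤ) ∣ w.re ^ 2 := by
      rw [Int.natAbs_dvd]; exact dvd_pow_self _ two_ne_zero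
    obtain ⟨c, hc⟩ := this
    rw [hc]; exact Int.mul_add_emod_self_left _ _ _

theorem dirichletSym_one {w : GaussianInt} (h : IsOddPrimitive w) : dirichletSym 1 w = 1 := by
  rw [dirichletSym, mul_one]; exact h.jacobiSym_re

/-- From `Re(wz) Re(wz') = Re(w) Re(wzz') + |w|² Im(z) Im(z')`: modulo `|w|²` the last term drops
out, and `(Re w / |w|²) = 1`. -/
theorem dirichletSym_mul {w : GaussianInt} (h : IsOddPrimitive w) (z z' : GaussianInt) :
    dirichletSym (z * z') w = dirichletSym z w * dirichletSym z' w := by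
  simp only [dirichletSym]
  rw [← jacobiSym.mul_left]
  have e : (w * z).re * (w * z').re = w.re * (w * (z * z')).re + nrm w * (z.im * z'.im) := by
    rw [cast_nrm]; simp only [Zsqrtd.re_mul, Zsqrtd.im_mul]; ring
  rw [e, jacobiSym.mod_left' (a₂ := w.re * (w * (z * z')).re) (Int.add_mul_emod_self_left _ _ _),
    jacobiSym.mul_left, h.jacobiSym_re, one_mul]

theorem dirichletSym_intCast_mul (c : ℤ) (z w : GaussianInt) :
    dirichletSym (c * z) w = J(c | nrm w) * dirichletSym z w := by
  simp only [dirichletSym]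
  rw [← jacobiSym.mul_left]
  congr 1
  simp; ring

theorem abs_dirichletSym_le_one (z w : GaussianInt) : |dirichletSym z w| ≤ 1 :=
  abs_jacobiSym_le_one _ _

theorem dirichletSym_congr {q : ℕ} {w : GaussianInt} (hq : nrm w ∣ q) {x y x' y' : ℤ}
    (hx : (x : ZMod q) = x') (hy : (y : ZMod q) = y') :
    dirichletSym ⟨x, y⟩ w = dirichletSym ⟨x', y'⟩ w := by
  refine jacobiSym_congr_of_cast_eq hq ?_
  simp [hx, hy]

/-- The Gaussian integers with both coordinates at most `A` in absolute value. -/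
noncomputable def box (A : ℕ) : Finset GaussianInt :=
  (Icc (-(A : ℤ)) A ×ˢ Icc (-(A : ℤ)) A).image fun p => (⟨p.1, p.2⟩ : GaussianInt)

theorem mem_box {A : ℕ} {z : GaussianInt} :
    z ∈ box A ↔ (-(A : ℤ) ≤ z.re ∧ z.re ≤ A) ∧ (-(A : ℤ) ≤ z.im ∧ z.im ≤ A) := by
  simp only [box, mem_image, mem_product, mem_Icc, Prod.exists]
  constructor
  · rintro ⟨a, b, h, rfl⟩; exact h
  · intro h; exact ⟨z.re, z.im, h, rfl⟩

theorem sum_box {β : Type*} [AddCommMonoid β] (f : GaussianInt → β) (A : ℕ) :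
    ∑ z ∈ box A, f z =
      ∑ i ∈ range (2 * A + 1), ∑ j ∈ range (2 * A + 1), f ⟨-(A : ℤ) + i, -(A : ℤ) + j⟩ := by
  rw [box, Finset.sum_image, Finset.sum_product, sum_Icc_neg_eq_sum_range]
  · exact Finset.sum_congr rfl fun i _ => sum_Icc_neg_eq_sum_range _ A
  · rintro ⟨a, b⟩ _ ⟨c, d⟩ _ h
    simpa [Zsqrtd.ext_iff] using h

theorem card_box (A : ℕ) : #(box A) = (2 * A + 1) ^ 2 := by
  rw [card_eq_sum_ones, sum_box]; simp [sq]

theorem ball_subset_box (X : ℕ) : ball X ⊆ box (Nat.sqrt X) := by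
  intro z hz
  rw [ball, mem_filter] at hz
  exact hz.1

/-- Scaling `v` by a rational integer `c` multiplies the summand by the Jacobi symbol of `c` modulo
`nrm w * nrm w'`. When this modulus is not a square some `c` gives `-1`, so complete sums over
residues vanish. -/
theorem abs_sum_box_dirichletSym_le {w w' : GaussianInt} (h : IsOddPrimitive w)
    (h' : IsOddPrimitive w') (hsq : ¬ IsSquare (nrm w * nrm w')) (A : ℕ) :
    |∑ v ∈ box A, dirichletSym v w * dirichletSym v w'| ≤ 2 * (nrm w * nrm w' * (2 * A + 1)) := by
  have ho := odd_nrm h.1 h.2.1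
  have ho' := odd_nrm h'.1 h'.2.1
  have hq0 : 0 < nrm w * nrm w' := Nat.mul_pos ho.pos ho'.pos
  have : NeZero (nrm w * nrm w') := ⟨hq0.ne'⟩
  obtain ⟨c, hc⟩ := exists_jacobiSym_eq_neg_one (ho.mul ho') hsq
  have hz := sum_range_range_eq_zero_of_antiperiodic
    (fun x y => dirichletSym ⟨x, y⟩ w * dirichletSym ⟨x, y⟩ w') (nrm w * nrm w') c
    (fun x y x' y' hx hy => by
      rw [dirichletSym_congr (dvd_mul_right _ _) hx hy, dirichletSym_congr (dvd_mul_left _ _) hx hy])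
    (isUnit_cast_of_jacobiSym_eq_neg_one hc)
    (fun x y => by
      have e : (⟨c * x, c * y⟩ : GaussianInt) = c * ⟨x, y⟩ := by
        ext <;> simp
      rw [e, dirichletSym_intCast_mul, dirichletSym_intCast_mul]
      rw [jacobiSym.mul_right' _ ho.pos.ne' ho'.pos.ne'] at hc
      linear_combination (dirichletSym ⟨x, y⟩ w * dirichletSym ⟨x, y⟩ w') * hc)
  have := abs_sum_range_range_le (fun x y => dirichletSym ⟨x, y⟩ w * dirichletSym ⟨x, y⟩ w')
    (nrm w * nrm w') hq0
    (fun x y => by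
      rw [abs_mul]
      exact mul_le_one₀ (abs_dirichletSym_le_one _ _) (abs_nonneg _) (abs_dirichletSym_le_one _ _))
    hz (2 * A + 1) (2 * A + 1) (-(A : ℤ)) (-(A : ℤ))
  rw [sum_box]
  refine this.trans (le_of_eq ?_)
  push_cast; ring

/-- The odd primitive Gaussian integers of norm at most `W`. -/
noncomputable def oddPrimBall (W : ℕ) : Finset GaussianInt := {w ∈ ball W | IsOddPrimitive w}

theorem mem_oddPrimBall {W : ℕ} {w : GaussianInt} :
    w ∈ oddPrimBall W ↔ nrm w ≤ W ∧ IsOddPrimitive w := by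
  rw [oddPrimBall, mem_filter, mem_ball]

/-- An element of norm `m` divides `m`, whose own norm is `m²`. -/
theorem exists_card_nrm_eq_le (ε : ℝ) (hε : 0 < ε) :
    ∃ C : ℝ, 1 ≤ C ∧ ∀ m : ℕ, m ≠ 0 → ∀ s : Finset GaussianInt, (∀ w ∈ s, nrm w = m) →
      (#s : ℝ) ≤ C * (m : ℝ) ^ ε := by
  obtain ⟨C, hC, h⟩ := exists_card_divisors_le (ε / 2) (by positivity)
  refine ⟨C, hC, fun m hm s hs => ?_⟩
  have := h (m : GaussianInt) (by exact_mod_cast hm) s (fun w hw => by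
    have h1 := Zsqrtd.norm_eq_mul_conj w
    have h2 : ((nrm w : ℤ) : GaussianInt) = w * star w := by
      rw [← h1, nrm, GaussianInt.abs_natCast_norm]
    rw [hs w hw] at h2
    exact ⟨star w, by exact_mod_cast h2⟩)
  rw [nrm_natCast] at this
  refine this.trans_eq ?_
  push_cast
  rw [← Real.rpow_natCast, ← Real.rpow_mul (by positivity)]
  congr 2; push_cast; ring

/-- At most `√W` values of the norm are possible, each taken at most `O(W^(1/4))` times by the
divisor bound. -/
theorem exists_card_isSquare_nrm_le : ∃ C : ℝ, 1 ≤ C ∧ ∀ W : ℕ, 1 ≤ W → ∀ m : ℕ, m ≠ 0 →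
    (#{w ∈ oddPrimBall W | IsSquare (m * nrm w)} : ℝ) ≤ C * (W : ℝ) ^ (3 / 4 : ℝ) := by
  obtain ⟨C, hC, h⟩ := exists_card_nrm_eq_le (1 / 4) (by norm_num)
  refine ⟨C, hC, fun W hW m hm => ?_⟩
  have hW' : (1 : ℝ) ≤ W := by exact_mod_cast hW
  set t := {n ∈ Icc 1 W | IsSquare (m * n)}
  have hmaps : ∀ w ∈ ({w ∈ oddPrimBall W | IsSquare (m * nrm w)} : Finset GaussianInt), nrm w ∈ t := by
    intro w hw
    obtain ⟨h1, h2⟩ := mem_filter.1 hw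
    rw [mem_oddPrimBall] at h1
    exact mem_filter.2 ⟨mem_Icc.2 ⟨(odd_nrm h1.2.1 h1.2.2.1).pos, h1.1⟩, h2⟩
  have h1 : (#{w ∈ oddPrimBall W | IsSquare (m * nrm w)} : ℝ) ≤ ∑ n ∈ t, C * (W : ℝ) ^ (1 / 4 : ℝ) := by
    rw [Finset.card_eq_sum_card_fiberwise hmaps]
    push_cast
    refine Finset.sum_le_sum fun n hn => ?_
    have hn' := mem_Icc.1 (mem_filter.1 hn).1
    refine (h n (by omega) _ fun w hw => (mem_filter.1 hw).2).trans ?_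
    gcongr
    exact hn'.2
  refine h1.trans ?_
  rw [Finset.sum_const, nsmul_eq_mul]
  have h2 : (#t : ℝ) ≤ (W : ℝ) ^ (1 / 2 : ℝ) := by
    rw [← Real.sqrt_eq_rpow]
    exact le_trans (by exact_mod_cast card_isSquare_mul_le hm W) Real.nat_sqrt_le_real_sqrt
  have e : (W : ℝ) ^ (3 / 4 : ℝ) = (W : ℝ) ^ (1 / 2 : ℝ) * (W : ℝ) ^ (1 / 4 : ℝ) := by
    rw [← Real.rpow_add (by positivity)]; norm_num
  rw [e]
  calc (#t : ℝ) * (C * (W : ℝ) ^ (1 / 4 : ℝ)) ≤ (W : ℝ) ^ (1 / 2 : ℝ) * (C * (W : ℝ) ^ (1 / 4 : ℝ)) := by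
        gcongr
    _ = _ := by ring

/-- The mean square over a large box of a linear form in Dirichlet symbols. -/
theorem exists_sum_abs_sum_box_le : ∃ C : ℝ, 1 ≤ C ∧ ∀ W A : ℕ, 1 ≤ W → W ^ 3 ≤ A →
    ∑ w ∈ oddPrimBall W, ∑ w' ∈ oddPrimBall W,
      |((∑ v ∈ box A, dirichletSym v w * dirichletSym v w' : ℤ) : ℝ)| ≤
      C * (W : ℝ) ^ (7 / 4 : ℝ) * (A : ℝ) ^ 2 := by
  obtain ⟨C, hC, h⟩ := exists_card_isSquare_nrm_le
  refine ⟨9 * (9 * C + 54), by linarith, fun W A hW hA => ?_⟩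
  have hW' : (1 : ℝ) ≤ W := by exact_mod_cast hW
  have hA1 : 1 ≤ A := (Nat.one_le_pow _ _ hW).trans hA
  have hA1' : (1 : ℝ) ≤ A := by exact_mod_cast hA1
  have hA' : (W : ℝ) ^ 3 ≤ A := by exact_mod_cast hA
  have hcard : (#(oddPrimBall W) : ℝ) ≤ 9 * W := by
    have : #(oddPrimBall W) ≤ 9 * W := (card_filter_le _ _).trans (card_ball_le W hW)
    exact_mod_cast this
  -- Square pairs are bounded by the whole box. All others give `O(W² A)`, which `W³ ≤ A` makes
  -- harmless after summation over both variables.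
  have hinner : ∀ w ∈ oddPrimBall W, ∀ w' ∈ oddPrimBall W,
      |((∑ v ∈ box A, dirichletSym v w * dirichletSym v w' : ℤ) : ℝ)| ≤
        (if IsSquare (nrm w * nrm w') then 9 * (A : ℝ) ^ 2 else 0) + 6 * (W : ℝ) ^ 2 * A := by
    intro w hw w' hw'
    rw [mem_oddPrimBall] at hw hw'
    split_ifs with hs
    · have : |∑ v ∈ box A, dirichletSym v w * dirichletSym v w'| ≤ (2 * A + 1 : ℤ) ^ 2 := by
        refine (abs_sum_le_sum_abs _ _).trans ((Finset.sum_le_sum (g := fun _ => (1 : ℤ))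
          fun v _ => ?_).trans ?_)
        · rw [abs_mul]
          exact mul_le_one₀ (abs_dirichletSym_le_one _ _) (abs_nonneg _) (abs_dirichletSym_le_one _ _)
        · rw [Finset.sum_const, card_box, nsmul_eq_mul]; push_cast; linarith
      have h5 : |((∑ v ∈ box A, dirichletSym v w * dirichletSym v w' : ℤ) : ℝ)| ≤
          (2 * A + 1 : ℝ) ^ 2 := by exact_mod_cast this
      have : 0 ≤ 6 * (W : ℝ) ^ 2 * A := by positivity
      nlinarith
    · rw [zero_add]
      have h1 : |((∑ v ∈ box A, dirichletSym v w * dirichletSym v w' : ℤ) : ℝ)| ≤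
          2 * (nrm w * nrm w' * (2 * A + 1) : ℝ) := by
        exact_mod_cast abs_sum_box_dirichletSym_le hw.2 hw'.2 hs A
      have h2 : (nrm w : ℝ) ≤ W := by exact_mod_cast hw.1
      have h3 : (nrm w' : ℝ) ≤ W := by exact_mod_cast hw'.1
      calc _ ≤ 2 * (nrm w * nrm w' * (2 * A + 1) : ℝ) := h1
        _ ≤ 2 * (W * W * (2 * A + A) : ℝ) := by gcongr
        _ = _ := by ring
  have hrow : ∀ w ∈ oddPrimBall W, ∑ w' ∈ oddPrimBall W,
      |((∑ v ∈ box A, dirichletSym v w * dirichletSym v w' : ℤ) : ℝ)| ≤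
      (9 * C + 54) * ((W : ℝ) ^ (3 / 4 : ℝ) * (A : ℝ) ^ 2) := by
    intro w hw
    refine (Finset.sum_le_sum fun w' hw' => hinner w hw w' hw').trans ?_
    rw [Finset.sum_add_distrib, ← Finset.sum_filter, Finset.sum_const, Finset.sum_const,
      nsmul_eq_mul, nsmul_eq_mul]
    have h1 := h W hW (nrm w) (by
      rw [mem_oddPrimBall] at hw
      exact (odd_nrm hw.2.1 hw.2.2.1).pos.ne')
    have h2 : (1 : ℝ) ≤ (W : ℝ) ^ (3 / 4 : ℝ) := Real.one_le_rpow hW' (by norm_num)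
    have h3 : (#(oddPrimBall W) : ℝ) * (6 * (W : ℝ) ^ 2 * A) ≤ 54 * ((W : ℝ) ^ (3 / 4 : ℝ) * (A : ℝ) ^ 2) := by
      calc (#(oddPrimBall W) : ℝ) * (6 * (W : ℝ) ^ 2 * A) ≤ 9 * W * (6 * (W : ℝ) ^ 2 * A) := by gcongr
        _ = 54 * (1 * ((W : ℝ) ^ 3 * A)) := by ring
        _ ≤ 54 * ((W : ℝ) ^ (3 / 4 : ℝ) * (A * A)) := by gcongr
        _ = _ := by ring
    have h4 : (#{w' ∈ oddPrimBall W | IsSquare (nrm w * nrm w')} : ℝ) * (9 * (A : ℝ) ^ 2) ≤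
        9 * C * ((W : ℝ) ^ (3 / 4 : ℝ) * (A : ℝ) ^ 2) := by
      calc _ ≤ C * (W : ℝ) ^ (3 / 4 : ℝ) * (9 * (A : ℝ) ^ 2) := by gcongr
        _ = _ := by ring
    linarith
  refine (Finset.sum_le_sum hrow).trans ?_
  rw [Finset.sum_const, nsmul_eq_mul]
  have e : (W : ℝ) ^ (7 / 4 : ℝ) = W * (W : ℝ) ^ (3 / 4 : ℝ) := by
    nth_rewrite 2 [← Real.rpow_one (W : ℝ)]
    rw [← Real.rpow_add (by positivity)]; norm_num
  rw [e]
  calc (#(oddPrimBall W) : ℝ) * ((9 * C + 54) * ((W : ℝ) ^ (3 / 4 : ℝ) * (A : ℝ) ^ 2))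
      ≤ (9 * W) * ((9 * C + 54) * ((W : ℝ) ^ (3 / 4 : ℝ) * (A : ℝ) ^ 2)) := by gcongr
    _ = _ := by ring

end GaussSum

namespace GaussSum

/-- Bilinear forms in Dirichlet symbols of Gaussian integers. -/
theorem exists_bilinBound_dirichletSym (η : ℝ) (hη : 0 < η) (hη1 : η ≤ 1) :
    ∃ δ C : ℝ, 0 < δ ∧ 0 < C ∧ ∀ (Z : ℝ) (W V : ℕ), 1 ≤ Z → Z ^ η ≤ W → (W : ℝ) ≤ Z → Z ^ η ≤ V →
      (V : ℝ) ≤ Z → BilinBound (oddPrimBall W) ((ball V).filter (· ≠ 0))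
        (fun w v => (dirichletSym v w : ℂ)) (C * (W * V) * Z ^ (-δ)) := by
  -- Enough copies of `v` that `V^(n+1) ≥ Z^6 ≥ W^6`; the box of side `A = √(V^(n+1))` then
  -- satisfies `W³ ≤ A`.
  obtain ⟨n, hn⟩ : ∃ n : ℕ, 6 / η ≤ ((n + 1 : ℕ) : ℝ) :=
    ⟨⌈6 / η⌉₊, (Nat.le_ceil _).trans (by push_cast; linarith)⟩
  set k : ℝ := ((n + 1 : ℕ) : ℝ) with hk
  have hk1 : 1 ≤ k := by rw [hk]; push_cast; linarith [Nat.cast_nonneg (α := ℝ) n]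
  -- The divisor losses amount to `V^(k²ε) ≤ Z^(η/16)` against the gain `W^(-1/8) ≤ Z^(-η/8)`; the
  -- `k`-th root of the net gain gives `δ = η/(16k)`.
  set ε : ℝ := η / (16 * k ^ 2) with hε
  have hε0 : 0 < ε := by positivity
  have hε1 : ε ≤ 1 := by
    rw [hε, div_le_one (by positivity)]; nlinarith
  obtain ⟨C, hC, hdiv⟩ := exists_card_divisors_le ε hε0
  obtain ⟨D, hD, hsum⟩ := exists_sum_abs_sum_box_le
  refine ⟨η / (16 * k), 54 * (C * D), by positivity, by positivity, ?_⟩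
  intro Z W V hZ hW hWZ hV hVZ
  have hZη : 1 ≤ Z ^ η := Real.one_le_rpow hZ hη.le
  have hW1 : (1 : ℝ) ≤ W := hZη.trans hW
  have hV1 : (1 : ℝ) ≤ V := hZη.trans hV
  have hW1' : 1 ≤ W := by exact_mod_cast hW1
  have hV1' : 1 ≤ V := by exact_mod_cast hV1
  set A : ℕ := Nat.sqrt (V ^ (n + 1)) with hA
  have hVk : (V : ℝ) ^ (n + 1) = (V : ℝ) ^ k := by rw [hk, Real.rpow_natCast]
  have hWA : W ^ 3 ≤ A := by
    rw [hA, Nat.le_sqrt', ← pow_mul]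
    have : (W : ℝ) ^ (3 * 2) ≤ (V : ℝ) ^ (n + 1) := by
      rw [hVk]
      calc (W : ℝ) ^ (3 * 2) ≤ Z ^ (3 * 2) := pow_le_pow_left₀ (by positivity) hWZ _
        _ = Z ^ (6 : ℝ) := by rw [← Real.rpow_natCast]; norm_num
        _ ≤ Z ^ (η * k) := by
          refine Real.rpow_le_rpow_of_exponent_le hZ ?_
          rw [div_le_iff₀ hη] at hn; linarith
        _ = (Z ^ η) ^ k := Real.rpow_mul (by linarith) _ _
        _ ≤ (V : ℝ) ^ k := Real.rpow_le_rpow (by positivity) hV (by linarith)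
    exact_mod_cast this
  have hA1 : 1 ≤ A := (Nat.one_le_pow _ _ hW1').trans hWA
  have hAV : A ^ 2 ≤ V ^ (n + 1) := Nat.sqrt_le' _
  have hAV' : (A : ℝ) ^ 2 ≤ (V : ℝ) ^ (n + 1) := by exact_mod_cast hAV
  have hT : ∀ v ∈ box A, (#{f ∈ Fintype.piFinset fun _ : Fin (n + 1) => (ball V).filter (· ≠ 0) |
      ∏ i, f i = v} : ℝ) ≤ (2 * C * (V : ℝ) ^ (k * ε)) ^ (n + 1) := by
    intro v hv
    by_cases hv0 : v = 0
    · rw [Finset.filter_eq_empty_iff.2, card_empty]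
      · simp only [Nat.cast_zero]; positivity
      · intro f hf hc
        rw [hv0, Finset.prod_eq_zero_iff] at hc
        obtain ⟨i, _, hi⟩ := hc
        exact (mem_filter.1 (Fintype.mem_piFinset.1 hf i)).2 hi
    · classical
      have h1 : (#{f ∈ Fintype.piFinset fun _ : Fin (n + 1) => (ball V).filter (· ≠ 0) |
          ∏ i, f i = v} : ℝ) ≤ (#{d ∈ (ball V).filter (· ≠ 0) | d ∣ v} : ℝ) ^ (n + 1) := by
        exact_mod_cast card_piFinset_prod_eq_le _ (n + 1) v
      refine h1.trans (pow_le_pow_left₀ (by positivity) ?_ _)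
      refine (hdiv v hv0 _ fun w hw => (mem_filter.1 hw).2).trans ?_
      have h2 : (nrm v : ℝ) ≤ 2 * (V : ℝ) ^ k := by
        rw [← hVk]
        have h3 : (nrm v : ℤ) ≤ 2 * (A : ℤ) ^ 2 := by
          rw [cast_nrm]
          obtain ⟨h4, h5⟩ := mem_box.1 hv
          nlinarith [sq_le_sq' h4.1 h4.2, sq_le_sq' h5.1 h5.2]
        have h4 : (nrm v : ℝ) ≤ 2 * (A : ℝ) ^ 2 := by exact_mod_cast h3
        linarith
      have h3 : (nrm v : ℝ) ^ ε ≤ 2 * (V : ℝ) ^ (k * ε) := by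
        refine (Real.rpow_le_rpow (by positivity) h2 hε0.le).trans ?_
        rw [Real.mul_rpow (by norm_num) (by positivity), ← Real.rpow_mul (by positivity)]
        gcongr
        calc (2 : ℝ) ^ ε ≤ 2 ^ (1 : ℝ) := Real.rpow_le_rpow_of_exponent_le (by norm_num) hε1
          _ = 2 := Real.rpow_one _
      calc C * (nrm v : ℝ) ^ ε ≤ C * (2 * (V : ℝ) ^ (k * ε)) := by gcongr
        _ = _ := by ring
  refine bilinBound_of_multiplicative (oddPrimBall W) _ (box A) dirichletSym n
    ((2 * C * (V : ℝ) ^ (k * ε)) ^ (n + 1)) (D * (W : ℝ) ^ (7 / 4 : ℝ) * (A : ℝ) ^ 2) _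
    (fun w hw v v' => dirichletSym_mul (mem_oddPrimBall.1 hw).2 v v')
    (fun w hw => dirichletSym_one (mem_oddPrimBall.1 hw).2) ?_ (by positivity) hT
    (hsum W A hW1' hWA) (by positivity) ?_
  · intro f hf
    refine ball_subset_box _ (mem_ball.2 ?_)
    have : nrm (∏ i, f i) = ∏ i, nrm (f i) :=
      map_prod (⟨⟨nrm, nrm_one⟩, nrm_mul⟩ : GaussianInt →* ℕ) f univ
    rw [this]
    refine (Finset.prod_le_prod' (g := fun _ => V) fun i _ => ?_).trans (by simp)
    exact mem_ball.1 (mem_filter.1 (hf i)).1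
  · have hcard : (#(oddPrimBall W) : ℝ) ≤ 9 * W := by
      have : #(oddPrimBall W) ≤ 9 * W := (card_filter_le _ _).trans (card_ball_le W hW1')
      exact_mod_cast this
    have hbox : (#(box A) : ℝ) ≤ 9 * (V : ℝ) ^ (n + 1) := by
      rw [card_box]
      have : (2 * A + 1) ^ 2 ≤ 9 * V ^ (n + 1) := by nlinarith
      exact_mod_cast this
    have hsqrt : Real.sqrt (#(box A) * (D * (W : ℝ) ^ (7 / 4 : ℝ) * (A : ℝ) ^ 2)) ≤
        3 * D * (W : ℝ) ^ (7 / 8 : ℝ) * (V : ℝ) ^ (n + 1) := by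
      refine Real.sqrt_le_iff.2 ⟨by positivity, ?_⟩
      have e : ((W : ℝ) ^ (7 / 8 : ℝ)) ^ 2 = (W : ℝ) ^ (7 / 4 : ℝ) := by
        rw [← Real.rpow_natCast, ← Real.rpow_mul (by positivity)]; norm_num
      calc _ ≤ 9 * (V : ℝ) ^ (n + 1) * (D * (W : ℝ) ^ (7 / 4 : ℝ) * (V : ℝ) ^ (n + 1)) := by gcongr
        _ ≤ 9 * (V : ℝ) ^ (n + 1) * (D * D * (W : ℝ) ^ (7 / 4 : ℝ) * (V : ℝ) ^ (n + 1)) := by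
            gcongr; nlinarith
        _ = _ := by rw [← e]; ring
    have h1 : (W : ℝ) ^ n * (W : ℝ) ^ (7 / 8 : ℝ) ≤ (W : ℝ) ^ (n + 1) * Z ^ (-(η / 8)) := by
      have e1 : (W : ℝ) ^ (7 / 8 : ℝ) = W * (W : ℝ) ^ (-(1 / 8) : ℝ) := by
        nth_rewrite 2 [← Real.rpow_one (W : ℝ)]
        rw [← Real.rpow_add (by positivity)]; norm_num
      have e2 : (W : ℝ) ^ (-(1 / 8) : ℝ) ≤ Z ^ (-(η / 8)) := by
        have : Z ^ (-(η / 8)) = (Z ^ η) ^ (-(1 / 8) : ℝ) := by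
          rw [← Real.rpow_mul (by linarith)]; congr 1; ring
        rw [this]
        exact Real.rpow_le_rpow_of_nonpos (by positivity) hW (by norm_num)
      rw [e1, pow_succ, mul_assoc]
      gcongr
    have h2 : ((V : ℝ) ^ (k * ε)) ^ (n + 1) ≤ Z ^ (η / 16) := by
      rw [← Real.rpow_natCast, ← hk, ← Real.rpow_mul (by positivity)]
      have : k * ε * k = η / 16 := by rw [hε]; field_simp
      rw [this]
      exact Real.rpow_le_rpow (by positivity) hVZ (by positivity)
    have h3 : Z ^ (-(η / 8)) * Z ^ (η / 16) = (Z ^ (-(η / (16 * k)))) ^ (n + 1) := by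
      rw [← Real.rpow_add (by linarith), ← Real.rpow_natCast, ← hk, ← Real.rpow_mul (by linarith)]
      congr 1; field_simp; ring
    have h4 : (9 : ℝ) ^ n * (2 * C) ^ (n + 1) * (3 * D) ≤ (54 * (C * D)) ^ (n + 1) := by
      have e : (54 * (C * D)) ^ (n + 1) = 9 ^ (n + 1) * (2 * C) ^ (n + 1) * (3 * D) ^ (n + 1) := by
        rw [← mul_pow, ← mul_pow]; ring
      rw [e]
      gcongr
      · norm_num
      · omega
      · exact le_self_pow₀ (by linarith) (by omega)
    calc (#(oddPrimBall W) : ℝ) ^ n * ((2 * C * (V : ℝ) ^ (k * ε)) ^ (n + 1) *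
          Real.sqrt (#(box A) * (D * (W : ℝ) ^ (7 / 4 : ℝ) * (A : ℝ) ^ 2)))
        ≤ (9 * (W : ℝ)) ^ n * ((2 * C * (V : ℝ) ^ (k * ε)) ^ (n + 1) *
          (3 * D * (W : ℝ) ^ (7 / 8 : ℝ) * (V : ℝ) ^ (n + 1))) := by gcongr
      _ = (9 ^ n * (2 * C) ^ (n + 1) * (3 * D)) * ((W : ℝ) ^ n * (W : ℝ) ^ (7 / 8 : ℝ)) *
          ((V : ℝ) ^ (k * ε)) ^ (n + 1) * (V : ℝ) ^ (n + 1) := by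
          rw [mul_pow, mul_pow]; ring
      _ ≤ (54 * (C * D)) ^ (n + 1) * ((W : ℝ) ^ (n + 1) * Z ^ (-(η / 8))) * Z ^ (η / 16) *
          (V : ℝ) ^ (n + 1) := by gcongr
      _ = (54 * (C * D)) ^ (n + 1) * (W : ℝ) ^ (n + 1) * (V : ℝ) ^ (n + 1) *
          (Z ^ (-(η / 8)) * Z ^ (η / 16)) := by ring
      _ = _ := by rw [h3, ← mul_pow, ← mul_pow, ← mul_pow]; ring

end GaussSum

/-! ### Reciprocity and the product law for the symbol `(s/r)` -/

theorem jacobiSym_eq_of_dvd_sub (s : ℤ) {x y : ℕ} (hx : Odd x) (hy : Odd y)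
    (h : 4 * s ∣ (x : ℤ) - y) : J(s | x) = J(s | y) := by
  rw [jacobiSym.mod_right s hx, jacobiSym.mod_right s hy]
  congr 1
  have h1 : ((4 * s.natAbs : ℕ) : ℤ) ∣ (x : ℤ) - y := by
    push_cast
    rcases abs_choice s with e | e <;> rw [e]
    · exact h
    · rw [mul_neg]; exact (neg_dvd).2 h
  have h2 : (y : ℤ) ≡ x [ZMOD (4 * s.natAbs : ℕ)] := Int.modEq_iff_dvd.2 h1
  exact (Int.natCast_modEq_iff.1 h2).symm

/-- Modulo `4n - 1` the number `4n` is `1`, and `4` is a square. -/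
theorem jacobiSym_four_mul_sub_one {n : ℕ} (hn : 0 < n) : J((n : ℤ) | 4 * n - 1) = 1 := by
  have hodd : Odd (4 * n - 1) := ⟨2 * n - 1, by omega⟩
  have h1 : J((4 * n : ℤ) | 4 * n - 1) = 1 := by
    rw [jacobiSym.mod_left' (a₂ := 1), jacobiSym.one_left]
    refine Int.ModEq.symm (Int.modEq_iff_dvd.2 ⟨1, ?_⟩)
    push_cast [show 1 ≤ 4 * n by omega]; ring
  rwa [jacobiSym.mul_left, jacobiSym.at_four hodd, one_mul] at h1

/-- Modulo `4n` one has `xy ≡ -x² ≡ (4n - 1) x²`, so the product of the two symbols is `(n / 4n - 1)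
= 1`. In the non-coprime case both symbols vanish, since the gcds agree. -/
theorem jacobiSym_eq_of_dvd_add_nat {n : ℕ} (hn : 0 < n) {x y : ℕ} (hx : Odd x) (hy : Odd y)
    (h : 4 * n ∣ x + y) : J((n : ℤ) | x) = J((n : ℤ) | y) := by
  have hx0 : x ≠ 0 := hx.pos.ne'
  have hy0 : y ≠ 0 := hy.pos.ne'
  have : NeZero x := ⟨hx0⟩
  have : NeZero y := ⟨hy0⟩
  have hgcd : (n : ℤ).gcd x = (n : ℤ).gcd y := by
    obtain ⟨c, hc⟩ := h
    have e : (y : ℤ) = -(x : ℤ) + (4 * c : ℤ) * n := by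
      have : (x : ℤ) + y = 4 * n * c := by exact_mod_cast hc
      linarith
    rw [e, Int.gcd_add_mul_right_right, Int.gcd_neg]
  by_cases hc : (n : ℤ).gcd x = 1
  · have hodd : Odd (4 * n - 1) := ⟨2 * n - 1, by omega⟩
    have h1 : J((n : ℤ) | x * y) = J((n : ℤ) | (4 * n - 1) * (x * x)) := by
      refine jacobiSym_eq_of_dvd_sub _ (hx.mul hy) (hodd.mul (hx.mul hx)) ?_
      obtain ⟨c, hc⟩ := h
      have e : (x : ℤ) + y = 4 * n * c := by exact_mod_cast hc
      refine ⟨x * c - x * x, ?_⟩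
      push_cast [show 1 ≤ 4 * n by omega]
      linear_combination (x : ℤ) * e
    rw [jacobiSym.mul_right' _ hx0 hy0, jacobiSym.mul_right' _ hodd.pos.ne' (mul_ne_zero hx0 hx0),
      jacobiSym.mul_right' _ hx0 hx0, jacobiSym_four_mul_sub_one hn, one_mul, ← sq,
      jacobiSym.sq_one hc] at h1
    rcases jacobiSym.eq_one_or_neg_one hc with h2 | h2 <;>
      rcases jacobiSym.eq_one_or_neg_one (hgcd ▸ hc) with h3 | h3 <;> rw [h2, h3] at h1 ⊢ <;>
      norm_num at h1
  · rw [jacobiSym.eq_zero_iff_not_coprime.2 hc, jacobiSym.eq_zero_iff_not_coprime.2 (hgcd ▸ hc)]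

theorem chi_four_of_dvd_add {x y : ℕ} (hx : Odd x) (h : 4 ∣ x + y) :
    ZMod.χ₄ (x : ZMod 4) = - ZMod.χ₄ (y : ZMod 4) := by
  rw [Nat.odd_iff] at hx
  have h4 : x % 4 = 1 ∨ x % 4 = 3 := by omega
  rcases h4 with h1 | h1
  · rw [ZMod.χ₄_nat_one_mod_four h1, ZMod.χ₄_nat_three_mod_four (by omega)]; norm_num
  · rw [ZMod.χ₄_nat_three_mod_four h1, ZMod.χ₄_nat_one_mod_four (by omega)]

theorem jacobiSym_eq_of_dvd_add {s : ℤ} (hs : s ≠ 0) {x y : ℕ} (hx : Odd x) (hy : Odd y)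
    (h : 4 * s ∣ (x : ℤ) + y) : J(s | x) = s.sign * J(s | y) := by
  have hn : 0 < s.natAbs := Int.natAbs_pos.2 hs
  have h' : 4 * s.natAbs ∣ x + y := by
    have := Int.natAbs_dvd_natAbs.2 h
    rwa [Int.natAbs_mul, show (((x : ℤ) + y).natAbs) = x + y by omega] at this
  have h1 := jacobiSym_eq_of_dvd_add_nat hn hx hy h'
  rcases lt_or_gt_of_ne hs with h2 | h2
  · have e : s = -(s.natAbs : ℤ) := by omega
    rw [Int.sign_eq_neg_one_of_neg h2]
    rw [e, jacobiSym.neg _ hx, jacobiSym.neg _ hy, h1,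
      chi_four_of_dvd_add hx ((dvd_mul_right _ _).trans h')]
    ring
  · have e : s = (s.natAbs : ℤ) := by omega
    rw [Int.sign_eq_one_of_pos h2, one_mul, e, h1]

/-- The denominators of interest are absolute values `|R|`; for negative `R` the congruence becomes
`|R| ≡ -y (mod 4t)` and costs the sign of `t`. -/
theorem jacobiSym_natAbs_of_dvd_sub (t : ℤ) {y : ℕ} (hy : Odd y) {R : ℤ} (hR : Odd R)
    (h : 4 * t ∣ R - y) : J(t | R.natAbs) = J(t | y) * (if R < 0 then t.sign else 1) := by
  have hR' : Odd R.natAbs := Int.natAbs_odd.2 hR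
  split_ifs with h0
  · have ht : t ≠ 0 := by
      rintro rfl
      simp only [mul_zero, zero_dvd_iff] at h
      omega
    rw [jacobiSym_eq_of_dvd_add ht hR' hy, mul_comm]
    have e : ((R.natAbs : ℤ)) = -R := by omega
    rw [e, ← dvd_neg, show -(-R + (y : ℤ)) = R - y by ring]; exact h
  · rw [mul_one]
    refine jacobiSym_eq_of_dvd_sub t hR' hy ?_
    have e : ((R.natAbs : ℤ)) = R := by omega
    rwa [e]

/-- The sign `-1` when both arguments are `≡ 2 (mod 4)`. -/
def evenSign (v s : ℤ) : ℤ := if v % 4 = 2 ∧ s % 4 = 2 then -1 else 1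

/-- The sign of quadratic reciprocity. -/
def oddSign (u r : ℕ) : ℤ := if u % 4 = 3 ∧ r % 4 = 3 then -1 else 1

theorem chi_eight_add_four {x y : ℕ} (hy : Odd y)
    (h : x % 8 = (y + 4) % 8 ∨ (x + y) % 8 = 4) :
    ZMod.χ₈ (x : ZMod 8) = - ZMod.χ₈ (y : ZMod 8) := by
  rw [ZMod.χ₈_nat_eq_if_mod_eight, ZMod.χ₈_nat_eq_if_mod_eight]
  rw [Nat.odd_iff] at hy
  have : y % 8 = 1 ∨ y % 8 = 3 ∨ y % 8 = 5 ∨ y % 8 = 7 := by omega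
  rcases this with h1 | h1 | h1 | h1 <;>
  · have hx : x % 8 = 1 ∨ x % 8 = 3 ∨ x % 8 = 5 ∨ x % 8 = 7 := by omega
    have hx2 : ¬ x % 2 = 0 := by omega
    have hy2 : ¬ y % 2 = 0 := by omega
    rw [if_neg hx2, if_neg hy2]
    have hxy : (x % 8 = 1 ∨ x % 8 = 7) ↔ ¬ (y % 8 = 1 ∨ y % 8 = 7) := by omega
    by_cases h5 : y % 8 = 1 ∨ y % 8 = 7
    · rw [if_pos h5, if_neg (fun h6 => hxy.1 h6 h5)]
    · rw [if_neg h5, if_pos (hxy.2 h5)]; norm_num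

/-- The denominator `R = ur - vs` should be congruent to `ur` modulo four times the numerator. This
holds if `4 ∣ v`, and also if `4 ∣ s` once the square `4` is removed from `s`. If both are `2`
modulo `4`, it holds for `s/2`, and the remaining factor `2` sees `R ≡ ur + 4 (mod 8)`, whence the
sign `evenSign`. -/
theorem jacobiSym_im_natAbs {u r : ℕ} (hu : Odd u) (hr : Odd r) {v s : ℤ} (hv : Even v)
    (hs : Even s) : J(s | ((u * r : ℤ) - v * s).natAbs) = J(s | u) * J(s | r) * evenSign v s *
      (if (u * r : ℤ) - v * s < 0 then s.sign else 1) := by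
  set R : ℤ := (u * r : ℤ) - v * s with hRdef
  obtain ⟨v', hv'⟩ := hv
  obtain ⟨s', hs'⟩ := hs
  have hur : Odd (u * r) := hu.mul hr
  have hR : Odd R := by
    rw [hRdef]
    refine Odd.sub_even (by exact_mod_cast hur) ?_
    exact Even.mul_left ⟨s', hs'⟩ _
  have hmul : ∀ t : ℤ, J(t | u * r) = J(t | u) * J(t | r) := fun t =>
    jacobiSym.mul_right' _ hu.pos.ne' hr.pos.ne'
  by_cases hv4 : v % 4 = 0
  · have he : evenSign v s = 1 := if_neg (by omega)
    obtain ⟨a, ha⟩ := Int.dvd_of_emod_eq_zero hv4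
    rw [jacobiSym_natAbs_of_dvd_sub s hur hR ⟨-a, by rw [hRdef, ha]; push_cast; ring⟩, hmul,
      he, mul_one]
  · by_cases hs4 : s % 4 = 0
    · have he : evenSign v s = 1 := if_neg (by omega)
      obtain ⟨a, ha⟩ := Int.dvd_of_emod_eq_zero hs4
      have key : ∀ x : ℕ, Odd x → J(s | x) = J(a | x) := by
        intro x hx
        rw [ha, jacobiSym.mul_left, jacobiSym.at_four hx, one_mul]
      have hsgn : s.sign = a.sign := by rw [ha, Int.sign_mul]; exact one_mul _
      rw [key _ (Int.natAbs_odd.2 hR), key _ hu, key _ hr,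
        jacobiSym_natAbs_of_dvd_sub a hur hR ⟨-v, by rw [hRdef, ha]; push_cast; ring⟩, hmul,
        he, mul_one, hsgn]
    · have ha : s = 2 * s' := by omega
      have hb : v = 2 * v' := by omega
      have hso : s' % 2 = 1 := by omega
      have hvo : v' % 2 = 1 := by omega
      have hsgn : s.sign = s'.sign := by rw [ha, Int.sign_mul]; exact one_mul _
      have key : ∀ x : ℕ, J(s | x) = J(2 | x) * J(s' | x) := fun x => by rw [ha, jacobiSym.mul_left]
      have hprod : (v' * s') % 2 = 1 := by rw [Int.mul_emod, hso, hvo]; norm_num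
      have hRe : R = ((u * r : ℕ) : ℤ) - 4 * (v' * s') := by
        rw [hRdef, ha, hb]; push_cast; ring
      have h8 : ZMod.χ₈ (R.natAbs : ZMod 8) = - ZMod.χ₈ ((u * r : ℕ) : ZMod 8) := by
        refine chi_eight_add_four hur ?_
        generalize v' * s' = p at hprod hRe
        generalize u * r = q at hRe
        omega
      have h2 : J(2 | R.natAbs) = -(J(2 | u) * J(2 | r)) := by
        rw [jacobiSym.at_two (Int.natAbs_odd.2 hR), h8, ← jacobiSym.at_two hur, hmul]
      have he : evenSign v s = -1 := if_pos (by omega)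
      rw [key, h2, jacobiSym_natAbs_of_dvd_sub s' hur hR ⟨-v', by rw [hRe]; ring⟩, hmul, key, key, he,
        hsgn]
      ring

/-- Reciprocity moves `u` to the denominator, where `R ≡ -vs`. The sign of reciprocity, the sign of
`R` and `χ₄(u)` combine, by `R ≡ ur (mod 4)`, into `oddSign u r`. -/
theorem jacobiSym_re_natAbs {u r : ℕ} (hu : Odd u) (hr : Odd r) {v s : ℤ} (hv : Even v)
    (hs : Even s) : J((u : ℤ) | ((u * r : ℤ) - v * s).natAbs) = J(v | u) * J(s | u) * oddSign u r := by
  set R : ℤ := (u * r : ℤ) - v * s with hRdef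
  obtain ⟨v', hv'⟩ := hv
  obtain ⟨s', hs'⟩ := hs
  have hRe : R = ((u * r : ℕ) : ℤ) - 4 * (v' * s') := by
    rw [hRdef, hv', hs']; push_cast; ring
  have hur : Odd (u * r) := hu.mul hr
  have hR : Odd R := by
    rw [hRe]; exact Odd.sub_even (by exact_mod_cast hur) ⟨2 * (v' * s'), by ring⟩
  have hRn : Odd R.natAbs := Int.natAbs_odd.2 hR
  have hneg : J(-(v * s) | u) = J(R | u) :=
    jacobiSym.mod_left' (Int.ModEq.symm (Int.modEq_iff_dvd.2 ⟨-r, by rw [hRdef]; ring⟩))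
  have h1 : J(R | u) = ZMod.χ₄ (u : ZMod 4) * (J(v | u) * J(s | u)) := by
    rw [← hneg, jacobiSym.neg _ hu, jacobiSym.mul_left]
  have hu2 : u % 2 = 1 := Nat.odd_iff.1 hu
  have hr2 : r % 2 = 1 := Nat.odd_iff.1 hr
  have hR2 : R.natAbs % 2 = 1 := Nat.odd_iff.1 hRn
  have hmod : (u * r) % 4 = ((u % 4) * (r % 4)) % 4 := Nat.mul_mod _ _ _
  rw [← jacobiSym.quadratic_reciprocity_if hu2 hR2]
  have hcase : J((R.natAbs : ℤ) | u) = if R < 0 then J(v | u) * J(s | u) else J(R | u) := by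
    split_ifs with h0
    · have e : (R.natAbs : ℤ) = -R := by omega
      have : ZMod.χ₄ (u : ZMod 4) * ZMod.χ₄ (u : ZMod 4) = 1 := by
        have h4 : u % 4 = 1 ∨ u % 4 = 3 := by omega
        rcases h4 with h | h
        · rw [ZMod.χ₄_nat_one_mod_four h]; norm_num
        · rw [ZMod.χ₄_nat_three_mod_four h]; norm_num
      rw [e, jacobiSym.neg _ hu, h1, ← mul_assoc, this, one_mul]
    · have e : (R.natAbs : ℤ) = R := by omega
      rw [e]
  rw [hcase, h1]
  generalize v' * s' = p at hRe
  generalize u * r = q at hRe hmod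
  have h4u : u % 4 = 1 ∨ u % 4 = 3 := by omega
  have h4r : r % 4 = 1 ∨ r % 4 = 3 := by omega
  rcases h4u with hu4 | hu4 <;> rcases h4r with hr4 | hr4 <;> rw [hu4, hr4] at hmod <;>
    norm_num at hmod
  · have he : oddSign u r = 1 := if_neg (by omega)
    rw [if_neg (by omega), he, ZMod.χ₄_nat_one_mod_four hu4]; split_ifs <;> ring
  · have he : oddSign u r = 1 := if_neg (by omega)
    rw [if_neg (by omega), he, ZMod.χ₄_nat_one_mod_four hu4]; split_ifs <;> ring
  · have he : oddSign u r = 1 := if_neg (by omega)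
    rw [ZMod.χ₄_nat_three_mod_four hu4, he]
    by_cases h0 : R < 0
    · rw [if_pos h0, if_neg (by omega)]; ring
    · rw [if_neg h0, if_pos (by omega)]; ring
  · have he : oddSign u r = -1 := if_pos (by omega)
    rw [ZMod.χ₄_nat_three_mod_four hu4, he]
    by_cases h0 : R < 0
    · rw [if_pos h0, if_pos (by omega)]; ring
    · rw [if_neg h0, if_neg (by omega)]; ring

theorem oddSign_mul {g u r : ℕ} (hg : Odd g) (hu : Odd u) :
    oddSign (g * u) r = oddSign g r * oddSign u r := by
  have hg2 : g % 2 = 1 := Nat.odd_iff.1 hg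
  have hu2 : u % 2 = 1 := Nat.odd_iff.1 hu
  have hmod : (g * u) % 4 = ((g % 4) * (u % 4)) % 4 := Nat.mul_mod _ _ _
  have h4g : g % 4 = 1 ∨ g % 4 = 3 := by omega
  have h4u : u % 4 = 1 ∨ u % 4 = 3 := by omega
  unfold oddSign
  by_cases hr : r % 4 = 3
  · rcases h4g with h1 | h1 <;> rcases h4u with h2 | h2 <;> rw [h1, h2] at hmod <;>
      simp [hmod, h1, h2, hr]
  · simp [hr]

theorem jacobiSym_swap_oddSign {g r : ℕ} (hg : Odd g) (hr : Odd r) :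
    J((r : ℤ) | g) = J((g : ℤ) | r) * oddSign g r := by
  rw [← jacobiSym.quadratic_reciprocity_if (Nat.odd_iff.1 hr) (Nat.odd_iff.1 hg), oddSign]
  by_cases h : r % 4 = 3 ∧ g % 4 = 3
  · rw [if_pos h, if_pos h.symm]; ring
  · rw [if_neg h, if_neg (fun h' => h h'.symm)]; ring

theorem evenSign_mul_odd {g : ℕ} (hg : Odd g) (v s : ℤ) : evenSign v (g * s) = evenSign v s := by
  have : ((g : ℤ) * s) % 4 = 2 ↔ s % 4 = 2 := by
    obtain ⟨a, rfl⟩ := hg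
    have e : ((2 * a + 1 : ℕ) : ℤ) * s = 2 * (a * s) + s := by push_cast; ring
    rw [e]
    rcases Int.even_or_odd' s with ⟨t, ht | ht⟩
    · have : (a : ℤ) * s = 2 * (a * t) := by rw [ht]; ring
      rw [this]; generalize (a : ℤ) * t = p; omega
    · generalize (a : ℤ) * s = p; omega
  simp only [evenSign, this]

/-- Twisted multiplicativity of the symbol `(s/r)`: the product law for `(u + iv)(r + is)`. -/
theorem jacobiSym_gaussian_mul {u r : ℕ} (hu : Odd u) (hr : Odd r) {v s : ℤ} (hv : Even v)
    (hs : Even s) (hcop : IsCoprime (u : ℤ) v) {m : ℕ} (hm : (m : ℤ) = u ^ 2 + v ^ 2) :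
    J(u * s + v * r | ((u * r : ℤ) - v * s).natAbs) =
      J(v | u) * J(s | r) * J((u * r : ℤ) - v * s | m) * oddSign u r * evenSign v s *
        (if (u * r : ℤ) - v * s < 0 then s.sign else 1) := by
  -- The common factor `g` of `u` and `s` divides `R = ur - vs` and has to be split off before `u`
  -- can be inverted modulo `R`; the modulus `g` is handled separately.
  set g : ℕ := (u : ℤ).gcd s with hgdef
  have hg0 : 0 < g := Int.gcd_pos_of_ne_zero_left _ (by exact_mod_cast hu.pos.ne')
  obtain ⟨u'', hu''⟩ : (g : ℤ) ∣ u := Int.gcd_dvd_left _ _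
  obtain ⟨s', hs'⟩ : (g : ℤ) ∣ s := Int.gcd_dvd_right _ _
  obtain ⟨u', rfl⟩ : ∃ u' : ℕ, u'' = u' := by
    refine Int.eq_ofNat_of_zero_le ?_
    have : (0 : ℤ) < g * u'' := by rw [← hu'']; exact_mod_cast hu.pos
    exact (pos_of_mul_pos_right this (by positivity)).le
  have huu : u = g * u' := by exact_mod_cast hu''
  have hgo : Odd g := Nat.Odd.of_mul_left (huu ▸ hu)
  have huo : Odd u' := Nat.Odd.of_mul_right (huu ▸ hu)
  have hse : Even s' := by
    rw [hs', Int.even_mul] at hs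
    exact hs.resolve_left (by simpa using hgo)
  have hco' : IsCoprime (u' : ℤ) s' := by
    rw [Int.isCoprime_iff_gcd_eq_one]
    have h1 : (g : ℕ) = g * (u' : ℤ).gcd s' := by
      conv_lhs => rw [hgdef, hu'', hs', Int.gcd_mul_left, Int.natAbs_natCast]
    exact Nat.eq_of_mul_eq_mul_left hg0 (by rw [← h1, mul_one])
  have hgv : IsCoprime (g : ℤ) v := hcop.of_isCoprime_of_dvd_left ⟨_, hu''⟩
  have huv : IsCoprime (u' : ℤ) v :=
    hcop.of_isCoprime_of_dvd_left ⟨g, by rw [hu'']; ring⟩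
  have hmmod : m % 4 = 1 := by
    obtain ⟨a, ha⟩ := hu
    obtain ⟨b, hb⟩ := hv
    rw [ha, hb] at hm
    have : (m : ℤ) = 4 * (a ^ 2 + a + b ^ 2) + 1 := by rw [hm]; push_cast; ring
    omega
  set R' : ℤ := (u' * r : ℤ) - v * s' with hR'
  have hRR : (u * r : ℤ) - v * s = g * R' := by rw [hR', hu'', hs']; ring
  have hR'o : Odd R' := by
    rw [hR']
    refine Odd.sub_even ?_ (Even.mul_left hse _)
    exact_mod_cast huo.mul hr
  have hR'n : Odd R'.natAbs := Int.natAbs_odd.2 hR'o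
  have hsign : ((g : ℤ) * R' < 0 ↔ R' < 0) := by
    constructor
    · intro h; by_contra hc; exact absurd h (not_lt.2 (mul_nonneg (by positivity) (not_lt.1 hc)))
    · intro h; exact mul_neg_of_pos_of_neg (by exact_mod_cast hg0) h
  have hsgn : s.sign = s'.sign := by
    rw [hs', Int.sign_mul, Int.sign_eq_one_of_pos (by exact_mod_cast hg0), one_mul]
  have e1 : J(u * s + v * r | g) = J(v | g) * J((r : ℤ) | g) := by
    rw [← jacobiSym.mul_left]
    exact jacobiSym.mod_left' (Int.ModEq.symm (Int.modEq_iff_dvd.2 ⟨u' * s, by rw [hu'']; ring⟩))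
  have hcoR : IsCoprime (u' : ℤ) R' := by
    have h1 : IsCoprime (u' : ℤ) (-(v * s')) := (huv.mul_right hco').neg_right
    have := h1.add_mul_left_right (r : ℤ)
    rwa [show -(v * s') + (u' : ℤ) * r = R' by rw [hR']; ring] at this
  have hsq : J((u' : ℤ) | R'.natAbs) ^ 2 = 1 := by
    refine jacobiSym.sq_one ?_
    rw [← Int.isCoprime_iff_gcd_eq_one]
    exact Int.isCoprime_iff_gcd_eq_one.2 (by
      have := Int.isCoprime_iff_gcd_eq_one.1 hcoR
      rwa [Int.gcd, Int.natAbs_natCast] at this ⊢)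
  -- The heart of the law is the congruence `u'(us + vr) ≡ s' (u² + v²)` modulo `R'`, the difference
  -- being `v R'`.
  have e2 : J((u' : ℤ) | R'.natAbs) * J(u * s + v * r | R'.natAbs) =
      J(s' | R'.natAbs) * J((m : ℤ) | R'.natAbs) := by
    rw [← jacobiSym.mul_left, ← jacobiSym.mul_left]
    refine jacobiSym.mod_left' (Int.ModEq.symm (Int.modEq_iff_dvd.2 ?_))
    rw [Int.natAbs_dvd]
    exact ⟨v, by rw [hm, hR', hu'', hs']; ring⟩
  have e3 := jacobiSym_re_natAbs huo hr hv hse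
  have e4 := jacobiSym_im_natAbs huo hr hv hse
  rw [← hR'] at e3 e4
  have hsq2 : J(s' | u') ^ 2 = 1 :=
    jacobiSym.sq_one (Int.isCoprime_iff_gcd_eq_one.1 hco'.symm)
  have e5 : J((m : ℤ) | R'.natAbs) = J(R' | m) := by
    rw [jacobiSym.quadratic_reciprocity_one_mod_four hmmod hR'n,
      GaussSum.jacobiSym_natAbs_of_mod_four hmmod]
  -- Since `m ≡ v² (mod g)` and `m ≡ 1 (mod 4)`; this allows `R'` to be replaced by `R` in the
  -- symbol modulo `m`.
  have e6 : J((g : ℤ) | m) = 1 := by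
    rw [jacobiSym.quadratic_reciprocity_one_mod_four' hgo hmmod, hm,
      jacobiSym.mod_left' (a₂ := v ^ 2)]
    · exact jacobiSym.sq_one' (Int.isCoprime_iff_gcd_eq_one.1 hgv.symm)
    · exact Int.ModEq.symm (Int.modEq_iff_dvd.2 ⟨g * u' ^ 2, by rw [hu'']; ring⟩)
  have hnat : ((g : ℤ) * R').natAbs = g * R'.natAbs := by rw [Int.natAbs_mul, Int.natAbs_natCast]
  have e7 : J(v | u) = J(v | g) * J(v | u') := by
    rw [huu, jacobiSym.mul_right' _ hg0.ne' huo.pos.ne']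
  have e8 : J(s | r) = J((g : ℤ) | r) * J(s' | r) := by rw [hs', jacobiSym.mul_left]
  have e9 : oddSign u r = oddSign g r * oddSign u' r := by rw [huu, oddSign_mul hgo huo]
  have e10 : evenSign v s = evenSign v s' := by rw [hs', evenSign_mul_odd hgo]
  have e11 : J(u * s + v * r | R'.natAbs) =
      J((u' : ℤ) | R'.natAbs) * (J(s' | R'.natAbs) * J((m : ℤ) | R'.natAbs)) := by
    rw [← e2, ← mul_assoc, ← sq, hsq, one_mul]
  rw [hRR, hnat, jacobiSym.mul_right' _ hg0.ne' hR'n.pos.ne', e1, e11, e3, e4, e5, e7, e8, e9, e10,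
    hsgn, jacobiSym.mul_left, e6, jacobiSym_swap_oddSign hgo hr]
  simp only [hsign]
  linear_combination (J(v | g) * J((g : ℤ) | r) * oddSign g r * J(v | u') * oddSign u' r * J(s' | r) *
    evenSign v s' * (if R' < 0 then s'.sign else 1) * J(R' | m)) * hsq2

/-! ### Multiplication law of the Jacobi–Kubota symbol in separable form -/

theorem separable_of_class {ι κ P Q : Type*} [Fintype P] [Fintype Q] {I : Finset ι} {J : Finset κ}
    (p : ι → P) (q : κ → Q) (F : ι → κ → ℂ) (hF : ∀ i ∈ I, ∀ j ∈ J, ‖F i j‖ ≤ 1)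
    (h : ∀ i ∈ I, ∀ i' ∈ I, ∀ j ∈ J, ∀ j' ∈ J, p i = p i' → q j = q j' → F i j = F i' j') :
    Separable I J F (Fintype.card P) := by
  classical
  set f : P → Q → ℂ := fun a b =>
    -- Pairs of classes that are not represented get the harmless value `0`.
    if hx : ∃ x : ι × κ, x.1 ∈ I ∧ x.2 ∈ J ∧ p x.1 = a ∧ q x.2 = b then F hx.choose.1 hx.choose.2 else 0
  refine (separable_finite_class p q f fun a b => ?_).congr fun i hi j hj => ?_
  · simp only [f]
    split_ifs with hx
    · exact hF _ hx.choose_spec.1 _ hx.choose_spec.2.1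
    · simp
  · have hx : ∃ x : ι × κ, x.1 ∈ I ∧ x.2 ∈ J ∧ p x.1 = p i ∧ q x.2 = q j := ⟨(i, j), hi, hj, rfl, rfl⟩
    simp only [f, hx, dif_pos]
    have hs := hx.choose_spec
    exact h _ hs.1 _ hi _ hs.2.1 _ hj hs.2.2.1 hs.2.2.2

theorem abs_chi_four_le_one (x : ZMod 4) : |ZMod.χ₄ x| ≤ 1 := by
  revert x; decide

theorem abs_sign_le_one (x : ℤ) : |x.sign| ≤ 1 := by
  rcases lt_trichotomy x 0 with h | rfl | h
  · rw [Int.sign_eq_neg_one_of_neg h]; norm_num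
  · simp
  · rw [Int.sign_eq_one_of_pos h]; norm_num

namespace GaussSum

/-- Gaussian integers with odd real and even imaginary part. -/
def IsOddEven (z : GaussianInt) : Prop := Odd z.re ∧ Even z.im

theorem IsOddEven.re_ne_zero {z : GaussianInt} (h : IsOddEven z) : z.re ≠ 0 := by
  intro h0; have := h.1; rw [h0] at this; simp at this

/-- The symbol `(s/r)` of the associate `±z = r + is` with `r > 0`. -/
def kubotaCoeff (z : GaussianInt) : ℤ := J(z.re.sign * z.im | z.re.natAbs)

/-- The sign and root of unity in the multiplication law of the Jacobi–Kubota symbol; the flag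
records whether the normalized factors have a product with negative real part. -/
noncomputable def kubotaTwist (b : Bool) (w z : GaussianInt) : ℂ :=
  Complex.I ^ (((w * z).re - 1) / 2) *
    (((if w.re.sign * z.re.sign = 1 then 1 else
        ZMod.χ₄ (((if b then -1 else 1) * (w.re.sign * z.re.sign * (w * z).re) : ℤ) : ZMod 4)) *
      oddSign w.re.natAbs z.re.natAbs * evenSign (w.re.sign * w.im) (z.re.sign * z.im) *
      (if b then (z.re.sign * z.im).sign else 1) : ℤ) : ℂ)

theorem abs_oddSign (u r : ℕ) : |oddSign u r| = 1 := by unfold oddSign; split_ifs <;> norm_num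

theorem abs_evenSign (u r : ℤ) : |evenSign u r| = 1 := by unfold evenSign; split_ifs <;> norm_num

theorem norm_kubotaTwist_le_one (b : Bool) (w z : GaussianInt) : ‖kubotaTwist b w z‖ ≤ 1 := by
  rw [kubotaTwist, norm_mul, norm_zpow, Complex.norm_I, one_zpow, one_mul, Complex.norm_intCast]
  have key : |(if w.re.sign * z.re.sign = 1 then 1 else
        ZMod.χ₄ (((if b then -1 else 1) * (w.re.sign * z.re.sign * (w * z).re) : ℤ) : ZMod 4)) *
      oddSign w.re.natAbs z.re.natAbs * evenSign (w.re.sign * w.im) (z.re.sign * z.im) *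
      (if b then (z.re.sign * z.im).sign else 1)| ≤ 1 := by
    rw [abs_mul, abs_mul, abs_mul, abs_oddSign, abs_evenSign, mul_one, mul_one]
    refine mul_le_one₀ ?_ (abs_nonneg _) ?_
    · split_ifs
      · norm_num
      · exact abs_chi_four_le_one _
      · exact abs_chi_four_le_one _
    · split_ifs
      · exact abs_sign_le_one _
      · norm_num
  exact_mod_cast key

/-- Both factors are first multiplied by signs that make their real parts positive, where
`jacobiSym_gaussian_mul` applies. The signs do not affect the symbol modulo `nrm w`, since `nrm w ≡
1 (mod 4)`. When they differ, `(-1 / |Re(wz)|)` appears, which is the `χ₄` factor of the twist. -/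
theorem jacobiKubota_mul {w z : GaussianInt} (hw : IsOddPrimitive w) (hz : IsOddEven z) :
    jacobiKubota (w * z) = (kubotaCoeff w * kubotaCoeff z : ℤ) * dirichletSym z w *
      kubotaTwist (decide (w.re.sign * z.re.sign * (w * z).re < 0)) w z := by
  obtain ⟨hu, hv, hco⟩ := hw
  have hw0 : w.re ≠ 0 := IsOddEven.re_ne_zero ⟨hu, hv⟩
  have hz0 : z.re ≠ 0 := hz.re_ne_zero
  obtain ⟨hr, hs⟩ := hz
  set σ := w.re.sign with hσ
  set τ := z.re.sign with hτ
  have hσ2 : σ = 1 ∨ σ = -1 := by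
    rcases lt_or_gt_of_ne hw0 with h | h
    · right; exact Int.sign_eq_neg_one_of_neg h
    · left; exact Int.sign_eq_one_of_pos h
  have hτ2 : τ = 1 ∨ τ = -1 := by
    rcases lt_or_gt_of_ne hz0 with h | h
    · right; exact Int.sign_eq_neg_one_of_neg h
    · left; exact Int.sign_eq_one_of_pos h
  have hσσ : σ * σ = 1 := by rcases hσ2 with h | h <;> rw [h] <;> norm_num
  have hττ : τ * τ = 1 := by rcases hτ2 with h | h <;> rw [h] <;> norm_num
  have hre : (w.re.natAbs : ℤ) = σ * w.re := by rw [hσ, Int.sign_mul_self_eq_natAbs]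
  have hre' : (z.re.natAbs : ℤ) = τ * z.re := by rw [hτ, Int.sign_mul_self_eq_natAbs]
  have hm : ((nrm w : ℕ) : ℤ) = (w.re.natAbs : ℤ) ^ 2 + (σ * w.im) ^ 2 := by
    rw [cast_nrm, hre]; linear_combination (-(w.re ^ 2) - w.im ^ 2) * hσσ
  have hcop : IsCoprime (w.re.natAbs : ℤ) (σ * w.im) := by
    rw [hre]
    rcases hσ2 with h | h <;> rw [h]
    · simpa using hco
    · simpa using hco.neg_left.neg_right
  have main := jacobiSym_gaussian_mul (Int.natAbs_odd.2 hu) (Int.natAbs_odd.2 hr)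
    (Even.mul_left hv σ) (Even.mul_left hs τ) hcop hm
  have hR : (w.re.natAbs * z.re.natAbs : ℤ) - σ * w.im * (τ * z.im) = σ * τ * (w * z).re := by
    rw [hre, hre']; simp; ring
  have hS : (w.re.natAbs : ℤ) * (τ * z.im) + σ * w.im * z.re.natAbs = σ * τ * (w * z).im := by
    rw [hre, hre']; simp; ring
  rw [hR, hS] at main
  have hR0 : Odd (w * z).re := by
    have : (w * z).re = w.re * z.re - w.im * z.im := by simp; ring
    rw [this]; exact (hu.mul hr).sub_even (Even.mul_left hs _)
  have hστ : (σ * τ = 1) ∨ (σ * τ = -1) := by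
    rcases hσ2 with h | h <;> rcases hτ2 with h' | h' <;> rw [h, h'] <;> norm_num
  have hnat : (σ * τ * (w * z).re).natAbs = (w * z).re.natAbs := by
    rcases hστ with h | h <;> rw [h]
    · rw [one_mul]
    · rw [neg_one_mul, Int.natAbs_neg]
  have hJm : J(σ * τ * (w * z).re | nrm w) = dirichletSym z w := by
    rw [dirichletSym]
    rcases hστ with h | h <;> rw [h]
    · rw [one_mul]
    · rw [neg_one_mul, jacobiSym_neg_of_mod_four (nrm_mod_four hu hv)]
  rw [hnat, hJm] at main
  have hchi : ∀ b : Bool, b = decide (σ * τ * (w * z).re < 0) →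
      (((w * z).re.natAbs : ℕ) : ZMod 4) =
      (((if b then -1 else 1) * (σ * τ * (w * z).re) : ℤ) : ZMod 4) := by
    intro b hb
    have : (((w * z).re.natAbs : ℕ) : ℤ) = (if b then -1 else 1) * (σ * τ * (w * z).re) := by
      rw [← hnat]
      by_cases h : σ * τ * (w * z).re < 0
      · rw [hb]; simp only [h, decide_true, if_true]; omega
      · rw [hb]; simp only [h, decide_false]; simp only [Bool.false_eq_true, if_false]; omega
    rw [← this, Int.cast_natCast]
  have hfin : J((w * z).im | (w * z).re.natAbs) = kubotaCoeff w * kubotaCoeff z * dirichletSym z w *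
      ((if σ * τ = 1 then 1 else
        ZMod.χ₄ (((if decide (σ * τ * (w * z).re < 0) then -1 else 1) * (σ * τ * (w * z).re) : ℤ) : ZMod 4)) *
      oddSign w.re.natAbs z.re.natAbs * evenSign (σ * w.im) (τ * z.im) *
      (if decide (σ * τ * (w * z).re < 0) then (τ * z.im).sign else 1)) := by
    rw [← hchi _ rfl]
    have hk : J(σ * w.im | w.re.natAbs) * J(τ * z.im | z.re.natAbs) = kubotaCoeff w * kubotaCoeff z := rfl
    rw [hk] at main
    simp only [decide_eq_true_eq]
    rcases hστ with h | h
    · rw [h, one_mul] at main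
      rw [if_pos h, main, h, one_mul]; ring
    · rw [h, neg_one_mul, jacobiSym.neg _ (Int.natAbs_odd.2 hR0)] at main
      have hne : ¬ σ * τ = 1 := by rw [h]; norm_num
      rw [if_neg hne, h, neg_one_mul]
      have hsq : ZMod.χ₄ (((w * z).re.natAbs : ℕ) : ZMod 4) * ZMod.χ₄ (((w * z).re.natAbs : ℕ) : ZMod 4) = 1 := by
        have ho := Nat.odd_iff.1 (Int.natAbs_odd.2 hR0)
        have h4 : (w * z).re.natAbs % 4 = 1 ∨ (w * z).re.natAbs % 4 = 3 := by omega
        rcases h4 with h | h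
        · rw [ZMod.χ₄_nat_one_mod_four h]; norm_num
        · rw [ZMod.χ₄_nat_three_mod_four h]; norm_num
      have := congrArg (fun t => ZMod.χ₄ (((w * z).re.natAbs : ℕ) : ZMod 4) * t) main
      simp only [← mul_assoc, hsq, one_mul] at this
      rw [this]; ring_nf
  rw [jacobiKubota, hfin, kubotaTwist]
  push_cast
  ring

/-- Residues modulo 8 and signs of the coordinates. -/
def gaussClass (w : GaussianInt) : ZMod 8 × ZMod 8 × Bool × Bool × Bool :=
  ((w.re : ZMod 8), (w.im : ZMod 8), decide (0 < w.re), decide (0 < w.im), decide (w.im < 0))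

theorem gaussClass_eq {w w' : GaussianInt} (hw : IsOddEven w) (hw' : IsOddEven w')
    (h : gaussClass w = gaussClass w') : w.re % 8 = w'.re % 8 ∧ w.im % 8 = w'.im % 8 ∧
      w.re.sign = w'.re.sign ∧ w.im.sign = w'.im.sign := by
  simp only [gaussClass, Prod.mk.injEq] at h
  obtain ⟨h1, h2, h3, h4, h5⟩ := h
  have hr := hw.re_ne_zero
  have hr' := hw'.re_ne_zero
  rw [decide_eq_decide] at h3 h4 h5
  refine ⟨(ZMod.intCast_eq_intCast_iff _ _ _).1 h1, (ZMod.intCast_eq_intCast_iff _ _ _).1 h2, ?_, ?_⟩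
  · rcases lt_or_gt_of_ne hr with h | h
    · rw [Int.sign_eq_neg_one_of_neg h, Int.sign_eq_neg_one_of_neg (by omega)]
    · rw [Int.sign_eq_one_of_pos h, Int.sign_eq_one_of_pos (by omega)]
  · rcases lt_trichotomy w.im 0 with h | h | h
    · rw [Int.sign_eq_neg_one_of_neg h, Int.sign_eq_neg_one_of_neg (by omega)]
    · rw [h, show w'.im = 0 by omega]
    · rw [Int.sign_eq_one_of_pos h, Int.sign_eq_one_of_pos (by omega)]

/-- Only `(a - 1)/2` modulo `4` matters; this is why classes modulo 8 are needed. -/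
theorem I_zpow_eq_of_mod_eight {a b : ℤ} (ha : Odd a) (h : a % 8 = b % 8) :
    Complex.I ^ ((a - 1) / 2) = Complex.I ^ ((b - 1) / 2) := by
  obtain ⟨t, ht⟩ := ha
  obtain ⟨c, hc⟩ : ∃ c : ℤ, (a - 1) / 2 = (b - 1) / 2 + 4 * c := ⟨(a - b) / 8, by omega⟩
  rw [hc, zpow_add₀ Complex.I_ne_zero, zpow_mul]
  have : Complex.I ^ (4 : ℤ) = 1 := by exact_mod_cast Complex.I_pow_four
  rw [this, one_zpow, mul_one]

theorem kubotaTwist_congr (b : Bool) {w w' z z' : GaussianInt} (hw : IsOddEven w)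
    (hw' : IsOddEven w') (hz : IsOddEven z) (hz' : IsOddEven z')
    (h1 : gaussClass w = gaussClass w') (h2 : gaussClass z = gaussClass z') :
    kubotaTwist b w z = kubotaTwist b w' z' := by
  obtain ⟨a1, a2, a3, a4⟩ := gaussClass_eq hw hw' h1
  obtain ⟨b1, b2, b3, b4⟩ := gaussClass_eq hz hz' h2
  have hR : (w * z).re % 8 = (w' * z').re % 8 := by
    have e : ∀ x y : GaussianInt, (x * y).re = x.re * y.re - x.im * y.im := fun x y => by simp; ring
    rw [e, e]
    exact Int.ModEq.sub (Int.ModEq.mul a1 b1) (Int.ModEq.mul a2 b2)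
  have hodd : Odd (w * z).re := by
    have : (w * z).re = w.re * z.re - w.im * z.im := by simp; ring
    rw [this]; exact (hw.1.mul hz.1).sub_even (Even.mul_left hz.2 _)
  have hmod4 : ∀ (c x y : ℤ), x % 8 = y % 8 → (c * x) % 4 = (c * y) % 4 := by
    intro c x y h
    have : x % 4 = y % 4 := by omega
    exact Int.ModEq.mul_left c this
  have hnat : ∀ x y : ℤ, x.sign = y.sign → x % 8 = y % 8 → x.natAbs % 4 = y.natAbs % 4 := by
    intro x y h h'
    have e1 := Int.sign_mul_self_eq_natAbs x
    have e2 := Int.sign_mul_self_eq_natAbs y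
    have := hmod4 x.sign x y h'
    nth_rewrite 2 [h] at this
    rw [e1, e2] at this
    omega
  have hodd' : oddSign w.re.natAbs z.re.natAbs = oddSign w'.re.natAbs z'.re.natAbs := by
    simp only [oddSign, hnat _ _ a3 a1, hnat _ _ b3 b1]
  have heven : evenSign (w.re.sign * w.im) (z.re.sign * z.im) =
      evenSign (w'.re.sign * w'.im) (z'.re.sign * z'.im) := by
    simp only [evenSign, a3, b3, hmod4 _ _ _ a2, hmod4 _ _ _ b2]
  have hchi : (((if b then -1 else 1) * (w.re.sign * z.re.sign * (w * z).re) : ℤ) : ZMod 4) =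
      (((if b then -1 else 1) * (w'.re.sign * z'.re.sign * (w' * z').re) : ℤ) : ZMod 4) := by
    rw [ZMod.intCast_eq_intCast_iff]
    rw [a3, b3]
    exact Int.ModEq.mul_left _ (hmod4 _ _ _ hR)
  rw [kubotaTwist, kubotaTwist, I_zpow_eq_of_mod_eight hodd hR, hodd', heven, hchi, a3, b3,
    Int.sign_mul, Int.sign_mul, b4]

/-- In terms of the slopes `x = im/re` the condition reads `1 < x_w x_z`. For a given sign of `x_z`
this is a comparison between `x_w` and `1/x_z`. -/
theorem separable_re_neg {I J : Finset GaussianInt} (hI : ∀ w ∈ I, w.re ≠ 0)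
    (hJ : ∀ z ∈ J, z.re ≠ 0) : Separable I J
      (fun w z => if w.re.sign * z.re.sign * (w * z).re < 0 then 1 else 0) (2 * Nat.size #I) := by
  set x : GaussianInt → ℝ := fun w => (w.im : ℝ) / w.re
  have h1 := (separable_lt (I := I) (J := J) (fun w => - x w) (fun z => -(1 / x z))).mul
    (separable_mul_mul (I := I) (J := J) (g := fun _ => 1) (h := fun z => if 0 < x z then 1 else 0)
      (by simp) (fun z => by split_ifs <;> simp))
  have h2 := (separable_lt (I := I) (J := J) (fun w => x w) (fun z => 1 / x z)).mul
    (separable_mul_mul (I := I) (J := J) (g := fun _ => 1) (h := fun z => if x z < 0 then 1 else 0)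
      (by simp) (fun z => by split_ifs <;> simp))
  refine ((h1.add h2).congr fun w hw z hz => ?_).mono (by linarith)
  have hkey : w.re.sign * z.re.sign * (w * z).re < 0 ↔ 1 < x w * x z := by
    have hw0 : (w.re : ℝ) ≠ 0 := by exact_mod_cast hI w hw
    have hz0 : (z.re : ℝ) ≠ 0 := by exact_mod_cast hJ z hz
    have e1 : w.re.sign * z.re.sign * (w * z).re =
        |w.re| * |z.re| - w.re.sign * z.re.sign * (w.im * z.im) := by
      rw [← Int.sign_mul_self_eq_abs w.re, ← Int.sign_mul_self_eq_abs z.re]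
      simp only [Zsqrtd.re_mul]; ring
    have e2 : ∀ a : ℤ, a ≠ 0 → (a.sign : ℝ) = |(a : ℝ)| / a := by
      intro a ha
      have ha' : (a : ℝ) ≠ 0 := by exact_mod_cast ha
      rw [eq_div_iff ha']
      have := Int.sign_mul_self_eq_abs a
      exact_mod_cast this
    rw [e1, sub_neg]
    have hpos : 0 < |(w.re : ℝ)| * |(z.re : ℝ)| := by positivity
    have : (|w.re| * |z.re| < w.re.sign * z.re.sign * (w.im * z.im)) ↔
        (|(w.re : ℝ)| * |(z.re : ℝ)| < (w.re.sign : ℝ) * z.re.sign * (w.im * z.im)) := by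
      exact_mod_cast Iff.rfl
    rw [this, e2 _ (hI w hw), e2 _ (hJ z hz)]
    have e3 : |(w.re : ℝ)| / w.re * (|(z.re : ℝ)| / z.re) * (w.im * z.im) =
        |(w.re : ℝ)| * |(z.re : ℝ)| * (x w * x z) := by
      simp only [x]; field_simp
    rw [e3]
    exact lt_mul_iff_one_lt_right hpos
  simp only [hkey, one_mul]
  rcases lt_trichotomy (x z) 0 with h | h | h
  · have : (1 < x w * x z) ↔ x w < 1 / x z := by rw [lt_div_iff_of_neg h]
    simp [h, not_lt.2 h.le, this]
  · simp [h]
  · have : (1 < x w * x z) ↔ -x w < -(1 / x z) := by rw [neg_lt_neg_iff, div_lt_iff₀ h]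
    simp [h, not_lt.2 h.le, this]

/-- A bilinear bound for Dirichlet symbols gives one for Jacobi–Kubota symbols. -/
theorem BilinBound.jacobiKubota {I J : Finset GaussianInt} (hI : ∀ w ∈ I, IsOddPrimitive w)
    (hJ : ∀ z ∈ J, IsOddEven z) {M : ℝ}
    (h : BilinBound I J (fun w z => (dirichletSym z w : ℂ)) M) :
    BilinBound I J (fun w z => jacobiKubota (w * z)) (512 * (1 + 4 * Nat.size #I) * M) := by
  have hI' : ∀ w ∈ I, IsOddEven w := fun w hw => ⟨(hI w hw).1, (hI w hw).2.1⟩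
  have hneg := separable_re_neg (I := I) (J := J) (fun w hw => (hI' w hw).re_ne_zero)
    (fun z hz => (hJ z hz).re_ne_zero)
  -- `512 = 8 · 8 · 2 · 2 · 2` is the number of values of `gaussClass`.
  have htw : ∀ b, Separable I J (kubotaTwist b) 512 := fun b =>
    (separable_of_class gaussClass gaussClass (kubotaTwist b)
      (fun w _ z _ => norm_kubotaTwist_le_one b w z)
      (fun w hw w' hw' z hz z' hz' h1 h2 =>
        kubotaTwist_congr b (hI' w hw) (hI' w' hw') (hJ z hz) (hJ z' hz') h1 h2)).mono (by
          simp [ZMod.card])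
  have hcoef : Separable I J (fun w z => (kubotaCoeff w : ℂ) * (kubotaCoeff z : ℂ)) 1 :=
    separable_mul_mul (fun w => norm_jacobiSym_le_one _ _) (fun z => norm_jacobiSym_le_one _ _)
  -- The case of a nonnegative real part is `1` minus the indicator of the negative case.
  have hpos := (htw false).mul (separable_one.add (hneg.const_mul (-1)))
  have hall := hcoef.mul (((htw true).mul hneg).add hpos)
  refine ((hall _ _ h).congr fun w hw z hz => ?_).mono (le_of_eq ?_)
  · rw [jacobiKubota_mul (hI w hw) (hJ z hz)]
    by_cases hc : w.re.sign * z.re.sign * (w * z).re < 0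
    · simp only [hc, if_true, decide_true]; push_cast; ring
    · simp only [hc, if_false, decide_false]; push_cast; ring
  · rw [norm_neg, norm_one]; ring

end GaussSum

/-! ### Logarithmic losses and the variation of unit vectors -/

theorem exists_size_le_rpow (ε : ℝ) (hε : 0 < ε) : ∃ C : ℝ, 1 ≤ C ∧ ∀ (n : ℕ) (X : ℝ), 1 ≤ X →
    (n : ℝ) ≤ X → (Nat.size n : ℝ) ≤ C * X ^ ε := by
  have hlog2 : 0 < Real.log 2 := Real.log_pos (by norm_num)
  refine ⟨1 + 1 / (ε * Real.log 2), by linarith [show (0 : ℝ) ≤ 1 / (ε * Real.log 2) by positivity],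
    fun n X hX hn => ?_⟩
  have hX1 : 1 ≤ X ^ ε := Real.one_le_rpow hX hε.le
  rcases Nat.eq_zero_or_pos n with rfl | hn0
  · simp; positivity
  obtain ⟨m, hm⟩ : ∃ m, Nat.size n = m + 1 :=
    ⟨Nat.size n - 1, by have := Nat.size_pos.2 hn0; omega⟩
  have h1 : 2 ^ m ≤ n := Nat.lt_size.1 (by omega)
  have h2 : (m : ℝ) * Real.log 2 ≤ X ^ ε / ε := by
    calc (m : ℝ) * Real.log 2 = Real.log (2 ^ m) := by rw [Real.log_pow]
      _ ≤ Real.log X := by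
        refine Real.log_le_log (by positivity) (le_trans ?_ hn)
        exact_mod_cast h1
      _ ≤ X ^ ε / ε := Real.log_le_rpow_div (by linarith) hε
  have h3 : (m : ℝ) ≤ X ^ ε / ε / Real.log 2 := by rw [le_div_iff₀ hlog2]; exact h2
  rw [hm]; push_cast
  calc (m : ℝ) + 1 ≤ X ^ ε / ε / Real.log 2 + X ^ ε := by linarith
    _ = _ := by field_simp; ring

theorem norm_pow_sub_pow_le {a b : ℂ} (ha : ‖a‖ = 1) (hb : ‖b‖ = 1) (n : ℕ) :
    ‖a ^ n - b ^ n‖ ≤ n * ‖a - b‖ := by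
  induction n with
  | zero => simp
  | succ n ih =>
    have e : a ^ (n + 1) - b ^ (n + 1) = a ^ n * (a - b) + (a ^ n - b ^ n) * b := by ring
    rw [e]
    refine (norm_add_le _ _).trans ?_
    rw [norm_mul, norm_mul, norm_pow, ha, hb, one_pow, one_mul, mul_one]
    push_cast; linarith

theorem norm_zpow_sub_zpow_le {a b : ℂ} (ha : ‖a‖ = 1) (hb : ‖b‖ = 1) (k : ℤ) :
    ‖a ^ k - b ^ k‖ ≤ |(k : ℝ)| * ‖a - b‖ := by
  have ha0 : a ≠ 0 := by rintro rfl; simp at ha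
  have hb0 : b ≠ 0 := by rintro rfl; simp at hb
  rcases Int.eq_nat_or_neg k with ⟨n, rfl | rfl⟩
  · simpa using norm_pow_sub_pow_le ha hb n
  · have e : a ^ (-(n : ℤ)) - b ^ (-(n : ℤ)) = (b ^ n - a ^ n) / (a ^ n * b ^ n) := by
      rw [zpow_neg, zpow_neg, zpow_natCast, zpow_natCast]
      field_simp
    rw [e, norm_div, norm_mul, norm_pow, norm_pow, ha, hb]
    have := norm_pow_sub_pow_le hb ha n
    rw [norm_sub_rev b a] at this
    simpa using this

theorem norm_div_norm_sub_le {a b : ℂ} (ha : a ≠ 0) (hb : b ≠ 0) :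
    ‖a / (‖a‖ : ℂ) - b / (‖b‖ : ℂ)‖ ≤ 2 * ‖a - b‖ / ‖a‖ := by
  have ha0 : (‖a‖ : ℂ) ≠ 0 := by exact_mod_cast norm_ne_zero_iff.2 ha
  have hb0 : (‖b‖ : ℂ) ≠ 0 := by exact_mod_cast norm_ne_zero_iff.2 hb
  have e : a / (‖a‖ : ℂ) - b / (‖b‖ : ℂ) = ((a - b) + b / (‖b‖ : ℂ) * ((‖b‖ - ‖a‖ : ℝ) : ℂ)) / (‖a‖ : ℂ) := by
    push_cast
    field_simp
    ring
  rw [e, norm_div, Complex.norm_real, norm_norm]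
  gcongr
  refine (norm_add_le _ _).trans ?_
  rw [norm_mul, norm_div, Complex.norm_real, norm_norm, div_self (norm_ne_zero_iff.2 hb), one_mul,
    Complex.norm_real, Real.norm_eq_abs]
  have := abs_norm_sub_norm_le b a
  rw [norm_sub_rev b a] at this
  linarith

theorem sum_Ico_inv_le (L : ℕ) : ∑ t ∈ Ico (-(L : ℤ)) L, (1 / (1 + |(t : ℝ)|)) ≤
    2 * ∑ j ∈ range L, (1 / (1 + (j : ℝ))) := by
  induction L with
  | zero => simp
  | succ L ih =>
    have e : Ico (-((L + 1 : ℕ) : ℤ)) (L + 1 : ℕ) = insert (-((L : ℤ) + 1)) (insert (L : ℤ) (Ico (-(L : ℤ)) L)) := by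
      ext t; simp only [mem_insert, mem_Ico]; push_cast; omega
    rw [e, sum_insert (by simp only [mem_insert, mem_Ico]; omega), sum_insert (by simp),
      sum_range_succ, mul_add]
    have h1 : (1 : ℝ) / (1 + |((-((L : ℤ) + 1) : ℤ) : ℝ)|) ≤ 1 / (1 + (L : ℝ)) := by
      refine one_div_le_one_div_of_le (by positivity) ?_
      push_cast
      rw [abs_neg, abs_of_nonneg (by positivity)]; linarith
    have h2 : (1 : ℝ) / (1 + |((L : ℤ) : ℝ)|) = 1 / (1 + (L : ℝ)) := by simp
    rw [h2]; linarith

theorem sum_Ico_inv_le_log (L : ℕ) :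
    ∑ t ∈ Ico (-(L : ℤ)) L, (1 / (1 + |(t : ℝ)|)) ≤ 2 * (1 + Real.log L) := by
  refine (sum_Ico_inv_le L).trans ?_
  have h := harmonic_le_one_add_log L
  rw [harmonic] at h
  push_cast at h
  have : ∑ j ∈ range L, (1 / (1 + (j : ℝ))) = ∑ j ∈ range L, ((j : ℝ) + 1)⁻¹ :=
    sum_congr rfl fun j _ => by rw [one_div, add_comm]
  rw [this]; linarith

/-! ### Primary numbers and Grössencharacters -/

namespace GaussSum

theorem isPrimary_iff {z : GaussianInt} : IsPrimary z ↔ Even z.im ∧ (z.re + z.im) % 4 = 1 := by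
  constructor
  · rintro ⟨c, hc⟩
    have h1 := congrArg Zsqrtd.re hc
    have h2 := congrArg Zsqrtd.im hc
    simp only [Zsqrtd.re_sub, Zsqrtd.im_sub, Zsqrtd.re_one, Zsqrtd.im_one, Zsqrtd.re_mul,
      Zsqrtd.im_mul] at h1 h2
    refine ⟨⟨c.re + c.im, by linarith⟩, ?_⟩
    omega
  · rintro ⟨⟨b, hb⟩, h⟩
    obtain ⟨a, ha⟩ : ∃ a, z.re + z.im = 1 + 4 * a := ⟨(z.re + z.im) / 4, by omega⟩
    refine ⟨⟨a, b - a⟩, ?_⟩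
    ext <;> simp <;> omega

theorem IsPrimary.isOddEven {z : GaussianInt} (h : IsPrimary z) : IsOddEven z := by
  obtain ⟨h1, h2⟩ := isPrimary_iff.1 h
  refine ⟨?_, h1⟩
  obtain ⟨b, hb⟩ := h1
  rw [Int.odd_iff]; omega

theorem IsPrimary.ne_zero {z : GaussianInt} (h : IsPrimary z) : z ≠ 0 := by
  rintro rfl
  exact h.isOddEven.re_ne_zero rfl

theorem IsPrimary.mul {z w : GaussianInt} (hz : IsPrimary z) (hw : IsPrimary w) :
    IsPrimary (z * w) := by
  have : z * w - 1 = z * (w - 1) + (z - 1) := by ring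
  rw [IsPrimary, this]
  exact dvd_add (Dvd.dvd.mul_left hw _) hz

theorem IsPrimary.of_mul_left {z w : GaussianInt} (hz : IsPrimary z) (hzw : IsPrimary (z * w)) :
    IsPrimary w := by
  have : w - 1 = (z * w - 1) - (z - 1) * w := by ring
  rw [IsPrimary, this]
  exact dvd_sub hzw (Dvd.dvd.mul_right hz _)

theorem norm_jacobiKubota_le_one (z : GaussianInt) : ‖jacobiKubota z‖ ≤ 1 := by
  rw [jacobiKubota, norm_mul, norm_zpow, Complex.norm_I, one_zpow, one_mul]
  exact norm_jacobiSym_le_one _ _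

/-- The unit vector `z/|z|`. -/
noncomputable def angle (z : GaussianInt) : ℂ := (z : ℂ) / ((‖(z : ℂ)‖ : ℝ) : ℂ)

theorem norm_angle {z : GaussianInt} (hz : z ≠ 0) : ‖angle z‖ = 1 := by
  have : (z : ℂ) ≠ 0 := by rwa [Ne, GaussianInt.toComplex_eq_zero]
  rw [angle, norm_div, Complex.norm_real, norm_norm, div_self (norm_ne_zero_iff.2 this)]

theorem norm_angle_zpow_le_one (z : GaussianInt) (k : ℤ) : ‖angle z ^ k‖ ≤ 1 := by
  by_cases hz : z = 0
  · subst hz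
    simp only [angle, GaussianInt.toComplex_zero, zero_div]
    rcases eq_or_ne k 0 with rfl | hk
    · simp
    · simp [zero_zpow k hk]
  · rw [norm_zpow, norm_angle hz, one_zpow]

theorem angle_mul (z w : GaussianInt) : angle (z * w) = angle z * angle w := by
  simp only [angle, GaussianInt.toComplex_mul, norm_mul]
  push_cast
  rw [mul_div_mul_comm]

theorem finite_residueRing {d : ℕ} (hd : 1 ≤ d) : Finite (ResidueRing d) := by
  classical
  have hd' : ((4 * d : ℕ) : ℤ) ≠ 0 := by positivity
  refine Set.finite_univ_iff.1 (Set.Finite.subset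
    (Set.toFinite ((box (4 * d)).image (Ideal.Quotient.mk _) : Finset (ResidueRing d))) ?_)
  intro a _
  obtain ⟨z, rfl⟩ := Ideal.Quotient.mk_surjective a
  rw [coe_image]
  refine ⟨⟨z.re % (4 * d : ℕ), z.im % (4 * d : ℕ)⟩, ?_, ?_⟩
  · rw [mem_coe, mem_box]
    have h1 := Int.emod_nonneg z.re hd'
    have h2 := Int.emod_nonneg z.im hd'
    have h3 := Int.emod_lt_of_pos z.re (by positivity : (0 : ℤ) < (4 * d : ℕ))
    have h4 := Int.emod_lt_of_pos z.im (by positivity : (0 : ℤ) < (4 * d : ℕ))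
    refine ⟨⟨?_, ?_⟩, ?_, ?_⟩ <;> dsimp only <;> omega
  · rw [Ideal.Quotient.mk_eq_mk_iff_sub_mem, Ideal.mem_span_singleton]
    refine ⟨⟨-(z.re / (4 * d : ℕ)), -(z.im / (4 * d : ℕ))⟩, ?_⟩
    have e1 := Int.emod_add_mul_ediv z.re (4 * d : ℕ)
    have e2 := Int.emod_add_mul_ediv z.im (4 * d : ℕ)
    ext
    · simp only [Zsqrtd.re_sub, Zsqrtd.re_mul, Zsqrtd.re_natCast, Zsqrtd.im_natCast]
      linear_combination e1
    · simp only [Zsqrtd.im_sub, Zsqrtd.im_mul, Zsqrtd.re_natCast, Zsqrtd.im_natCast]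
      linear_combination e2

/-- The unit group of the residue ring is finite, so `χ` takes roots of unity as values on it. -/
theorem norm_mulChar_le_one {d : ℕ} (hd : 1 ≤ d) (χ : MulChar (ResidueRing d) ℂ)
    (a : ResidueRing d) : ‖χ a‖ ≤ 1 := by
  have := finite_residueRing hd
  by_cases ha : IsUnit a
  · obtain ⟨u, rfl⟩ := ha
    have h1 : (χ u) ^ Nat.card (ResidueRing d)ˣ = 1 := by
      rw [← map_pow, ← Units.val_pow_eq_pow_val, pow_card_eq_one', Units.val_one, map_one]
    have h2 : ‖χ u‖ ^ Nat.card (ResidueRing d)ˣ = 1 := by rw [← norm_pow, h1, norm_one]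
    exact (pow_le_one_iff_of_nonneg (norm_nonneg _) Nat.card_pos.ne').1 h2.le
  · rw [χ.map_nonunit ha]; simp

theorem grossencharacter_mul {d : ℕ} (χ : MulChar (ResidueRing d) ℂ) (k : ℤ) (z w : GaussianInt) :
    grossencharacter χ k (z * w) = grossencharacter χ k z * grossencharacter χ k w := by
  have h := angle_mul z w
  simp only [angle] at h
  rw [grossencharacter, grossencharacter, grossencharacter, h, map_mul, map_mul, mul_zpow]
  ring

theorem norm_grossencharacter_le_one {d : ℕ} (hd : 1 ≤ d) (χ : MulChar (ResidueRing d) ℂ) (k : ℤ)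
    {z : GaussianInt} (hz : z ≠ 0) : ‖grossencharacter χ k z‖ ≤ 1 := by
  have h := norm_angle hz
  rw [angle] at h
  rw [grossencharacter, norm_mul, norm_zpow, h, one_zpow, mul_one]
  exact norm_mulChar_le_one hd χ _

end GaussSum

/-! ### Linear sums of the Jacobi–Kubota symbol -/

namespace GaussSum

/-- A unit step in the imaginary direction turns the unit vector by `O(1/|z|)`, and `1 + |s| ≤ 2|z|`
because `R ≠ 0`. Summed over `s`, the variation is `O(|k| log)`. -/
theorem norm_angle_zpow_sub_le {R : ℤ} (hR : R ≠ 0) (k s : ℤ) :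
    ‖angle ⟨R, s + 1⟩ ^ k - angle ⟨R, s⟩ ^ k‖ ≤ 4 * |(k : ℝ)| * (1 / (1 + |(s : ℝ)|)) := by
  have hne : ∀ t : ℤ, (⟨R, t⟩ : GaussianInt) ≠ 0 := fun t h => hR (congrArg Zsqrtd.re h)
  have hne' : ∀ t : ℤ, ((⟨R, t⟩ : GaussianInt) : ℂ) ≠ 0 := fun t h =>
    hne t (GaussianInt.toComplex_eq_zero.1 h)
  refine (norm_zpow_sub_zpow_le (norm_angle (hne _)) (norm_angle (hne _)) k).trans ?_
  have h1 := norm_div_norm_sub_le (hne' s) (hne' (s + 1))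
  rw [norm_sub_rev] at h1
  have e : ((⟨R, s⟩ : GaussianInt) : ℂ) - ((⟨R, s + 1⟩ : GaussianInt) : ℂ) = -Complex.I := by
    rw [GaussianInt.toComplex_def, GaussianInt.toComplex_def]; push_cast; ring
  rw [e, norm_neg, Complex.norm_I] at h1
  have h2 : |(R : ℝ)| ≤ ‖((⟨R, s⟩ : GaussianInt) : ℂ)‖ := by
    have := Complex.abs_re_le_norm ((⟨R, s⟩ : GaussianInt) : ℂ)
    simpa [GaussianInt.toComplex_def] using this
  have h3 : |(s : ℝ)| ≤ ‖((⟨R, s⟩ : GaussianInt) : ℂ)‖ := by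
    have := Complex.abs_im_le_norm ((⟨R, s⟩ : GaussianInt) : ℂ)
    simpa [GaussianInt.toComplex_def] using this
  have h4 : (1 : ℝ) ≤ |(R : ℝ)| := by exact_mod_cast Int.one_le_abs hR
  have h5 : 2 * 1 / ‖((⟨R, s⟩ : GaussianInt) : ℂ)‖ ≤ 4 * (1 / (1 + |(s : ℝ)|)) := by
    rw [mul_one_div, div_le_div_iff₀ (by linarith) (by positivity)]
    linarith
  calc |(k : ℝ)| * ‖angle ⟨R, s + 1⟩ - angle ⟨R, s⟩‖ ≤ |(k : ℝ)| * (4 * (1 / (1 + |(s : ℝ)|))) := by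
        gcongr; exact h1.trans h5
    _ = _ := by ring

open Classical in
/-- The value of `χ` at the quotient `z/x`, if this quotient is an integer and `z` is primary. -/
noncomputable def quotientChar {d : ℕ} (χ : MulChar (ResidueRing d) ℂ) (x z : GaussianInt) : ℂ :=
  if x ∣ z ∧ IsPrimary z then χ (Ideal.Quotient.mk _ (z / x)) else 0

theorem norm_quotientChar_le_one {d : ℕ} (hd : 1 ≤ d) (χ : MulChar (ResidueRing d) ℂ)
    (x z : GaussianInt) : ‖quotientChar χ x z‖ ≤ 1 := by
  rw [quotientChar]
  split_ifs
  · exact norm_mulChar_le_one hd χ _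
  · simp

theorem quotientChar_mul {d : ℕ} (χ : MulChar (ResidueRing d) ℂ) {x v : GaussianInt}
    (hx : IsPrimary x) (hv : IsPrimary v) :
    quotientChar χ x (x * v) = χ (Ideal.Quotient.mk _ v) := by
  rw [quotientChar, if_pos ⟨dvd_mul_right _ _, hx.mul hv⟩, mul_div_cancel_left₀ _ hx.ne_zero]

/-- The shift `4d |x|² y` is `x` times a multiple of `4d`, so divisibility by `x`, primarity and the
class of the quotient modulo `4d` are all preserved. -/
theorem quotientChar_add {d : ℕ} (χ : MulChar (ResidueRing d) ℂ) {x : GaussianInt}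
    (hx : x ≠ 0) (z y : GaussianInt) :
    quotientChar χ x (z + ((4 * d * nrm x : ℕ) : GaussianInt) * y) = quotientChar χ x z := by
  have e : ((4 * d * nrm x : ℕ) : GaussianInt) * y = x * ((4 * d : ℕ) * (star x * y)) := by
    have h1 : ((nrm x : ℕ) : GaussianInt) = x * star x := by
      rw [← Zsqrtd.norm_eq_mul_conj, ← GaussianInt.abs_natCast_norm]; rfl
    rw [Nat.cast_mul, h1]; ring
  have hp : IsPrimary (z + ((4 * d * nrm x : ℕ) : GaussianInt) * y) ↔ IsPrimary z := by
    have h4 : (⟨2, 2⟩ : GaussianInt) ∣ ((4 * d * nrm x : ℕ) : GaussianInt) * y := by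
      have h5 : (⟨2, 2⟩ : GaussianInt) ∣ 4 := ⟨⟨1, -1⟩, by ext <;> simp⟩
      push_cast
      exact Dvd.dvd.mul_right (Dvd.dvd.mul_right (Dvd.dvd.mul_right h5 _) _) _
    rw [IsPrimary, IsPrimary, add_sub_right_comm]
    exact dvd_add_left h4
  have hdv : x ∣ z + ((4 * d * nrm x : ℕ) : GaussianInt) * y ↔ x ∣ z := by
    rw [e]; exact dvd_add_left (dvd_mul_right _ _)
  rw [quotientChar, quotientChar]
  by_cases h : x ∣ z ∧ IsPrimary z
  · rw [if_pos h, if_pos ⟨hdv.2 h.1, hp.2 h.2⟩, e]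
    obtain ⟨v, rfl⟩ := h.1
    rw [← mul_add, mul_div_cancel_left₀ _ hx, mul_div_cancel_left₀ _ hx]
    congr 1
    rw [Ideal.Quotient.mk_eq_mk_iff_sub_mem, Ideal.mem_span_singleton, add_sub_cancel_left]
    exact dvd_mul_right _ _
  · rw [if_neg h, if_neg fun h' => h ⟨hdv.1 h'.1, hp.1 h'.2⟩]

theorem separable_quotientChar {d : ℕ} (hd : 1 ≤ d) (χ : MulChar (ResidueRing d) ℂ)
    {x : GaussianInt} (hx : x ≠ 0) (I J : Finset ℤ) :
    Separable I J (fun R S => quotientChar χ x ⟨R, S⟩) (4 * d * nrm x : ℕ) := by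
  have hq : 0 < 4 * d * nrm x := by have := nrm_pos.2 hx; positivity
  have : NeZero (4 * d * nrm x) := ⟨hq.ne'⟩
  have h := separable_of_class (I := I) (J := J) (fun R : ℤ => (R : ZMod (4 * d * nrm x)))
    (fun S : ℤ => (S : ZMod (4 * d * nrm x))) (fun R S => quotientChar χ x ⟨R, S⟩)
    (fun _ _ _ _ => norm_quotientChar_le_one hd χ _ _) ?_
  · rwa [ZMod.card] at h
  · intro R _ R' _ S _ S' _ h1 h2
    rw [ZMod.intCast_eq_intCast_iff_dvd_sub] at h1 h2
    obtain ⟨a, ha⟩ := h1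
    obtain ⟨b, hb⟩ := h2
    have e : (⟨R', S'⟩ : GaussianInt) = ⟨R, S⟩ + ((4 * d * nrm x : ℕ) : GaussianInt) * ⟨a, b⟩ := by
      ext
      · simp only [Zsqrtd.re_add, Zsqrtd.re_mul, Zsqrtd.re_natCast, Zsqrtd.im_natCast]
        linear_combination ha
      · simp only [Zsqrtd.im_add, Zsqrtd.im_mul, Zsqrtd.re_natCast, Zsqrtd.im_natCast]
        linear_combination hb
    rw [e, quotientChar_add χ hx]

/-- Linear sums of the Jacobi–Kubota symbol over the multiples of a fixed primary number. -/
theorem exists_norm_sum_jacobiKubota_mul_le : ∃ C : ℝ, 0 < C ∧ ∀ (x : GaussianInt) (d : ℕ)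
    (χ : MulChar (ResidueRing d) ℂ) (k : ℤ) (T X : ℕ), IsPrimary x → 1 ≤ d → 1 ≤ X →
    nrm x * T ≤ X →
    ‖∑ v ∈ ball T with IsPrimary v, jacobiKubota (x * v) * grossencharacter χ k v‖ ≤
      C * (d * nrm x) * (|(k : ℝ)| + 1) * (X : ℝ) ^ (49 / 50 : ℝ) := by
  obtain ⟨C₀, hC₀, hB⟩ := exists_bilinBound_jacobi
  obtain ⟨C₁, hC₁, hsize⟩ := exists_size_le_rpow (1 / 400) (by norm_num)
  refine ⟨4 * (C₁ * 3) * (8 * 401) * C₀ + 3, by positivity, ?_⟩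
  intro x d χ k T X hx hd hX hT
  set Y := nrm x * T with hY
  set L := Nat.sqrt X with hL
  have hx0 := hx.ne_zero
  have hnx : 1 ≤ nrm x := nrm_pos.2 hx0
  have hL1 : 1 ≤ L := Nat.le_sqrt.2 (by simpa using hX)
  have hX' : (1 : ℝ) ≤ X := by exact_mod_cast hX
  set I : Finset ℤ := {R ∈ Icc (-(L : ℤ)) L | Odd R} with hI
  set J : Finset ℤ := {S ∈ Icc (-(L : ℤ)) L | S ≠ 0} with hJ
  have hIodd : ∀ R ∈ I, R ≠ 0 := by
    intro R hR h0
    rw [hI, mem_filter, h0] at hR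
    simp at hR
  have hcardI : #I ≤ 3 * X := by
    refine (card_filter_le _ _).trans ?_
    rw [Int.card_Icc]
    have : L ≤ X := Nat.sqrt_le_self X
    omega
  have hLX : (L : ℝ) ^ 2 ≤ X := by exact_mod_cast Nat.sqrt_le' X
  have hLX' : (L : ℝ) ≤ X := by exact_mod_cast Nat.sqrt_le_self X
  -- With `z = xv` as variable, everything becomes a function of the coordinates `R, S` of `z`; the
  -- quotient `v` survives only through `χ`, and the constant `angle x ^ k` is divided out.
  set f : GaussianInt → ℂ := fun z => quotientChar χ x z * (if (nrm z : ℕ) ≤ Y then 1 else 0) *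
    angle z ^ k * jacobiKubota z with hf
  have hf1 : ∀ z, ‖f z‖ ≤ 1 := by
    intro z
    simp only [hf, norm_mul]
    have h1 := norm_quotientChar_le_one hd χ x z
    have h2 := norm_angle_zpow_le_one z k
    have h3 := norm_jacobiKubota_le_one z
    have h4 : ‖(if nrm z ≤ Y then 1 else 0 : ℂ)‖ ≤ 1 := by split_ifs <;> simp
    exact mul_le_one₀ (mul_le_one₀ (mul_le_one₀ h1 (norm_nonneg _) h4) (norm_nonneg _) h2)
      (norm_nonneg _) h3
  have hkey : ∑ v ∈ ball T with IsPrimary v, jacobiKubota (x * v) * grossencharacter χ k v =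
      (angle x ^ k)⁻¹ * ∑ y ∈ I ×ˢ Icc (-(L : ℤ)) L, f ⟨y.1, y.2⟩ := by
    rw [mul_sum]
    refine sum_of_injOn (fun v => ((x * v).re, (x * v).im)) ?_ ?_ ?_ ?_
    · intro v _ v' _ h
      simp only [Prod.mk.injEq] at h
      exact mul_left_cancel₀ hx0 (Zsqrtd.ext h.1 h.2)
    · intro v hv
      rw [mem_coe, mem_filter, mem_ball] at hv
      have h1 : x * v ∈ ball X := by
        rw [mem_ball, nrm_mul]
        exact (Nat.mul_le_mul_left _ hv.1).trans hT
      have h2 := mem_box.1 (ball_subset_box X h1)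
      rw [mem_coe, mem_product, hI, mem_filter, mem_Icc, mem_Icc]
      exact ⟨⟨h2.1, (hx.mul hv.2).isOddEven.1⟩, h2.2⟩
    · intro y hy hy'
      by_contra h0
      have h1 := right_ne_zero_of_mul h0
      simp only [hf] at h1
      have h2 := left_ne_zero_of_mul (left_ne_zero_of_mul (left_ne_zero_of_mul h1))
      have h3 := right_ne_zero_of_mul (left_ne_zero_of_mul (left_ne_zero_of_mul h1))
      rw [quotientChar] at h2
      have h4 : nrm (⟨y.1, y.2⟩ : GaussianInt) ≤ Y := by
        by_contra h; rw [if_neg h] at h3; exact h3 rfl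
      have h5 : x ∣ (⟨y.1, y.2⟩ : GaussianInt) ∧ IsPrimary ⟨y.1, y.2⟩ := by
        by_contra h; rw [if_neg h] at h2; exact h2 rfl
      obtain ⟨⟨v, hv⟩, hp⟩ := h5
      rw [hv] at hp h4
      refine hy' ⟨v, ?_, ?_⟩
      · rw [mem_coe, mem_filter, mem_ball]
        refine ⟨?_, hx.of_mul_left hp⟩
        rw [nrm_mul, hY] at h4
        exact Nat.le_of_mul_le_mul_left h4 hnx
      · dsimp only; rw [← hv]
    · intro v hv
      rw [mem_filter, mem_ball] at hv
      dsimp only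
      have e : (⟨(x * v).re, (x * v).im⟩ : GaussianInt) = x * v := rfl
      rw [e]
      simp only [hf]
      rw [quotientChar_mul χ hx hv.2, if_pos, angle_mul, mul_zpow]
      · have ha : angle x ^ k ≠ 0 := by
          refine zpow_ne_zero _ fun h => ?_
          have := norm_angle hx0
          rw [h] at this; simp at this
        rw [grossencharacter, ← angle]
        field_simp
      · rw [nrm_mul]; exact Nat.mul_le_mul_left _ hv.1
  -- The terms `S = 0` are outside `exists_bilinBound_jacobi` and are bounded trivially by `O(√X)`.
  have hsplit : ∑ y ∈ I ×ˢ Icc (-(L : ℤ)) L, f ⟨y.1, y.2⟩ =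
      ∑ R ∈ I, f ⟨R, 0⟩ + ∑ R ∈ I, ∑ S ∈ J, f ⟨R, S⟩ := by
    rw [sum_product, ← sum_add_distrib]
    refine sum_congr rfl fun R _ => ?_
    have e : Icc (-(L : ℤ)) L = insert 0 J := by
      ext t; simp only [hJ, mem_insert, mem_filter, mem_Icc]
      omega
    rw [e, sum_insert]
    simp [hJ]
  have hzero : ‖∑ R ∈ I, f ⟨R, 0⟩‖ ≤ 3 * (X : ℝ) ^ (49 / 50 : ℝ) := by
    have h1 : ‖∑ R ∈ I, f ⟨R, 0⟩‖ ≤ #I := by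
      refine (norm_sum_le _ _).trans ((sum_le_card_nsmul _ _ 1 fun R _ => hf1 _).trans ?_)
      simp
    have h2 : (#I : ℝ) ≤ 3 * L := by
      have : #I ≤ 3 * L := by
        refine (card_filter_le _ _).trans ?_
        rw [Int.card_Icc]; omega
      exact_mod_cast this
    have h3 : (L : ℝ) ≤ (X : ℝ) ^ (49 / 50 : ℝ) := by
      calc (L : ℝ) ≤ Real.sqrt X := Real.le_sqrt_of_sq_le hLX
        _ = (X : ℝ) ^ (1 / 2 : ℝ) := Real.sqrt_eq_rpow _
        _ ≤ _ := Real.rpow_le_rpow_of_exponent_le hX' (by norm_num)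
    linarith
  have hsep1 := separable_quotientChar hd χ hx0 I J
  have hsep2 : Separable I J (fun R S => if nrm (⟨R, S⟩ : GaussianInt) ≤ Y then 1 else 0)
      (Nat.size #I) := by
    refine (separable_le (I := I) (J := J) (fun R => (R : ℝ) ^ 2) (fun S => (Y : ℝ) - (S : ℝ) ^ 2)).congr
      fun R _ S _ => ?_
    have : (R : ℝ) ^ 2 ≤ (Y : ℝ) - (S : ℝ) ^ 2 ↔ nrm (⟨R, S⟩ : GaussianInt) ≤ Y := by
      rw [le_sub_iff_add_le]
      have := cast_nrm (⟨R, S⟩ : GaussianInt)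
      dsimp only at this
      rw [← Int.ofNat_le, this]
      norm_cast
    simp only [this]
  have hsep3 := separable_of_variation (I := I) (J := J) (fun R S => angle ⟨R, S⟩ ^ k) L
    (fun s => 4 * |(k : ℝ)| * (1 / (1 + |(s : ℝ)|)))
    (fun s hs => by rw [hJ, mem_filter, mem_Icc] at hs; exact hs.1)
    (fun R => norm_angle_zpow_le_one _ _) (fun R hR s => norm_angle_zpow_sub_le (hIodd R hR) k s)
    (fun s => by positivity)
  rw [← mul_sum] at hsep3
  have hbil := (hsep1.mul (hsep2.mul hsep3)) _ _ (hB L hL1)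
  have hmain : ‖∑ R ∈ I, ∑ S ∈ J, f ⟨R, S⟩‖ ≤ _ :=
    le_of_eq_of_le (congrArg _ (sum_congr rfl fun R _ => sum_congr rfl fun S _ => ?_))
      (hbil (fun R => Complex.I ^ ((R - 1) / 2)) (fun _ => 1)
        (fun R => by rw [norm_zpow, Complex.norm_I, one_zpow]) (by simp))
  swap
  · simp only [hf, jacobiKubota]; ring
  -- Exponents: `L^(39/20) ≤ X^(39/40)`, and two logarithmic losses of `X^(1/400)` lead to `49/50`.
  have hXp : (1 : ℝ) ≤ (X : ℝ) ^ (1 / 400 : ℝ) := Real.one_le_rpow hX' (by norm_num)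
  have hlog : 1 + Real.log L ≤ 401 * (X : ℝ) ^ (1 / 400 : ℝ) := by
    have h1 : Real.log L ≤ Real.log X := Real.log_le_log (by exact_mod_cast hL1) hLX'
    have h2 : Real.log X ≤ (X : ℝ) ^ (1 / 400 : ℝ) / (1 / 400) :=
      Real.log_le_rpow_div (by linarith) (by norm_num)
    linarith
  have hvar : 1 + 4 * |(k : ℝ)| * ∑ t ∈ Ico (-(L : ℤ)) L, (1 / (1 + |(t : ℝ)|)) ≤
      (|(k : ℝ)| + 1) * (8 * 401 * (X : ℝ) ^ (1 / 400 : ℝ)) := by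
    have h1 := sum_Ico_inv_le_log L
    calc 1 + 4 * |(k : ℝ)| * ∑ t ∈ Ico (-(L : ℤ)) L, (1 / (1 + |(t : ℝ)|))
        ≤ 8 * 401 * (X : ℝ) ^ (1 / 400 : ℝ) + 4 * |(k : ℝ)| * (2 * (401 * (X : ℝ) ^ (1 / 400 : ℝ))) := by
          gcongr
          · linarith
          · exact h1.trans (by gcongr)
      _ = _ := by ring
  have hs : (Nat.size #I : ℝ) ≤ C₁ * 3 * (X : ℝ) ^ (1 / 400 : ℝ) := by
    refine (hsize #I (3 * X) (by linarith) (by exact_mod_cast hcardI)).trans ?_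
    rw [Real.mul_rpow (by norm_num) (by positivity)]
    have : (3 : ℝ) ^ (1 / 400 : ℝ) ≤ 3 := by
      calc (3 : ℝ) ^ (1 / 400 : ℝ) ≤ 3 ^ (1 : ℝ) :=
            Real.rpow_le_rpow_of_exponent_le (by norm_num) (by norm_num)
        _ = 3 := Real.rpow_one 3
    rw [← mul_assoc]
    gcongr
  have hLp : (L : ℝ) ^ (39 / 20 : ℝ) ≤ (X : ℝ) ^ (39 / 40 : ℝ) := by
    calc (L : ℝ) ^ (39 / 20 : ℝ) = ((L : ℝ) ^ 2) ^ (39 / 40 : ℝ) := by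
          rw [← Real.rpow_natCast, ← Real.rpow_mul (by positivity)]; norm_num
      _ ≤ _ := Real.rpow_le_rpow (by positivity) hLX (by norm_num)
  have hbound : ‖∑ R ∈ I, ∑ S ∈ J, f ⟨R, S⟩‖ ≤
      4 * (C₁ * 3) * (8 * 401) * C₀ * (d * nrm x) * (|(k : ℝ)| + 1) * (X : ℝ) ^ (49 / 50 : ℝ) := by
    refine hmain.trans ?_
    calc _ ≤ ((4 * d * nrm x : ℕ) : ℝ) * (C₁ * 3 * (X : ℝ) ^ (1 / 400 : ℝ) *
          ((|(k : ℝ)| + 1) * (8 * 401 * (X : ℝ) ^ (1 / 400 : ℝ)))) *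
          (C₀ * (X : ℝ) ^ (39 / 40 : ℝ)) := by gcongr
      _ = 4 * (C₁ * 3) * (8 * 401) * C₀ * (d * nrm x) * (|(k : ℝ)| + 1) *
          ((X : ℝ) ^ (1 / 400 : ℝ) * (X : ℝ) ^ (1 / 400 : ℝ) * (X : ℝ) ^ (39 / 40 : ℝ)) := by
        push_cast; ring
      _ = 4 * (C₁ * 3) * (8 * 401) * C₀ * (d * nrm x) * (|(k : ℝ)| + 1) *
          (X : ℝ) ^ (49 / 50 : ℝ) := by
        rw [← Real.rpow_add (by linarith), ← Real.rpow_add (by linarith)]; norm_num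
  have hd' : (1 : ℝ) ≤ d * nrm x := by exact_mod_cast Nat.mul_pos hd hnx
  have hk' : (1 : ℝ) ≤ |(k : ℝ)| + 1 := by linarith [abs_nonneg (k : ℝ)]
  have hdk : (1 : ℝ) ≤ (d * nrm x) * (|(k : ℝ)| + 1) := by nlinarith
  rw [hkey, norm_mul, norm_inv, norm_zpow, norm_angle hx0, one_zpow, inv_one, one_mul, hsplit]
  refine (norm_add_le _ _).trans ((add_le_add hzero hbound).trans ?_)
  have hXX : 0 ≤ (X : ℝ) ^ (49 / 50 : ℝ) := by positivity
  have : 3 * (X : ℝ) ^ (49 / 50 : ℝ) ≤ 3 * ((d * nrm x) * (|(k : ℝ)| + 1)) * (X : ℝ) ^ (49 / 50 : ℝ) := by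
    gcongr; linarith
  linarith [this]

end GaussSum

/-! ### Bilinear sums of the Jacobi–Kubota symbol -/

theorem BilinBound.indicator {ι κ : Type*} {I : Finset ι} {J : Finset κ} {K : ι → κ → ℂ} {M : ℝ}
    (p : ι → Prop) (q : κ → Prop) [DecidablePred p] [DecidablePred q]
    (h : BilinBound (I.filter p) (J.filter q) K M) :
    BilinBound I J (fun i j => (if p i then 1 else 0) * (if q j then 1 else 0) * K i j) M := by
  intro α β hα hβ
  refine le_of_eq_of_le (congrArg _ ?_) (h α β hα hβ)
  simp only [sum_filter]
  refine sum_congr rfl fun i _ => ?_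
  by_cases hp : p i
  · simp only [hp, if_true]
    refine sum_congr rfl fun j _ => ?_
    split_ifs <;> simp
  · simp [hp]

theorem card_le_mul_of_fiber_le {ι κ : Type*} {I : Finset ι} {T : Finset κ} (f : ι → κ) {F : ℝ}
    (hf : ∀ i ∈ I, f i ∈ T) (hF : ∀ t, ∀ s ⊆ I, (∀ i ∈ s, f i = t) → (#s : ℝ) ≤ F) :
    (#I : ℝ) ≤ F * #T := by
  classical
  rw [card_eq_sum_card_fiberwise (t := T) (f := f) fun i hi => hf i hi, Nat.cast_sum]
  refine (sum_le_card_nsmul _ _ F fun t _ => hF t _ (filter_subset _ _) (by simp)).trans ?_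
  rw [nsmul_eq_mul, mul_comm]

namespace GaussSum

/-- A common factor of the coordinates makes the Jacobi symbol vanish. Hence primitivity comes for
free wherever the symbol matters. -/
theorem isCoprime_of_jacobiKubota_ne_zero {z : GaussianInt} (hz : IsOddEven z)
    (h : jacobiKubota z ≠ 0) : IsCoprime z.re z.im := by
  have h1 : J(z.im | z.re.natAbs) ≠ 0 := by
    intro h0; rw [jacobiKubota, h0] at h; simp at h
  have : NeZero z.re.natAbs := ⟨Int.natAbs_ne_zero.2 hz.re_ne_zero⟩
  rw [Ne, jacobiSym.eq_zero_iff_not_coprime, not_not] at h1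
  rw [isCoprime_comm, Int.isCoprime_iff_gcd_eq_one]
  rwa [Int.gcd, Int.natAbs_natCast] at h1

theorem isCoprime_of_mul {w v : GaussianInt} (h : IsCoprime (w * v).re (w * v).im) :
    IsCoprime w.re w.im := by
  obtain ⟨a, b, h⟩ := h
  simp only [Zsqrtd.re_mul, Zsqrtd.im_mul] at h
  exact ⟨a * v.re + b * v.im, -a * v.im + b * v.re, by linear_combination h⟩

theorem isOddPrimitive_of_jacobiKubota_mul_ne_zero {w v : GaussianInt} (hw : IsPrimary w)
    (hv : IsPrimary v) (h : jacobiKubota (w * v) ≠ 0) : IsOddPrimitive w :=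
  ⟨hw.isOddEven.1, hw.isOddEven.2,
    isCoprime_of_mul (isCoprime_of_jacobiKubota_ne_zero (hw.mul hv).isOddEven h)⟩

/-- Bilinear sums of the Jacobi–Kubota symbol, with the indices carrying extra data and
subject to three inequalities that link both indices. -/
theorem exists_bilinBound_jacobiKubota (η : ℝ) (hη : 0 < η) (hη1 : η ≤ 1 / 2) :
    ∃ δ C : ℝ, 0 < δ ∧ 0 < C ∧ ∀ {ι κ : Type} (I : Finset ι) (J : Finset κ)
      (ω : ι → GaussianInt) (υ : κ → GaussianInt) (x x' : ι → ℝ) (y y' : κ → ℝ) (Z X F : ℝ),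
      1 ≤ Z → X ≤ Z → 1 ≤ F →
      (∀ i ∈ I, IsPrimary (ω i) ∧ Z ^ η ≤ nrm (ω i) ∧ (nrm (ω i) : ℝ) ≤ Z ^ (1 - η)) →
      (∀ j ∈ J, IsPrimary (υ j)) →
      (∀ w, ∀ s ⊆ I, (∀ i ∈ s, ω i = w) → (#s : ℝ) ≤ F) →
      (∀ v, ∀ s ⊆ J, (∀ j ∈ s, υ j = v) → (#s : ℝ) ≤ F) →
      BilinBound I J (fun i j => (if (nrm (ω i) * nrm (υ j) : ℝ) ≤ X then 1 else 0) *
        (if x i < y j then 1 else 0) * (if x' i ≤ y' j then 1 else 0) * jacobiKubota (ω i * υ j))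
        (C * F ^ 7 * Z ^ (1 - δ)) := by
  obtain ⟨δ, C, hδ, hC, hbil⟩ := exists_bilinBound_dirichletSym η hη (by linarith)
  -- Five logarithmic factors will each cost `Z^ε`, which uses up half of `δ`.
  set ε : ℝ := min (δ / 10) (1 / 10) with hε
  have hε0 : 0 < ε := by positivity
  have hεδ : ε ≤ δ / 10 := min_le_left _ _
  have hε1 : ε ≤ 1 := (min_le_right _ _).trans (by norm_num)
  obtain ⟨C₁, hC₁, hsize⟩ := exists_size_le_rpow ε hε0
  refine ⟨δ / 2, 512 * 5 * 16 * C * (36 * C₁) ^ 5, by positivity, by positivity, ?_⟩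
  intro ι κ I J ω υ x x' y y' Z X F hZ hXZ hF hω hυ hFI hFJ
  classical
  have hZ0 : 0 < Z := by linarith
  have hωZ : ∀ i ∈ I, (nrm (ω i) : ℝ) ≤ Z := fun i hi => (hω i hi).2.2.trans <| by
    calc Z ^ (1 - η) ≤ Z ^ (1 : ℝ) := Real.rpow_le_rpow_of_exponent_le hZ (by linarith)
      _ = Z := Real.rpow_one Z
  -- A common bound for all the logarithms that occur. Five powers of `S` and two fibre
  -- multiplicities produce `F ^ 7`.
  set S : ℝ := 36 * C₁ * F * Z ^ ε with hS
  have hZp : 1 ≤ Z ^ ε := Real.one_le_rpow hZ hε0.le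
  have hS1 : 1 ≤ S := by
    have : 1 ≤ 36 * C₁ * F := by nlinarith
    rw [hS]; nlinarith
  have hsz : ∀ n : ℕ, (n : ℝ) ≤ 36 * F * Z → (Nat.size n : ℝ) ≤ S := by
    intro n hn
    refine (hsize n (36 * F * Z) (by nlinarith) hn).trans ?_
    rw [Real.mul_rpow (by positivity) hZ0.le, hS]
    have : (36 * F) ^ ε ≤ 36 * F := by
      calc (36 * F) ^ ε ≤ (36 * F) ^ (1 : ℝ) :=
            Real.rpow_le_rpow_of_exponent_le (by linarith) hε1
        _ = _ := Real.rpow_one _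
    calc C₁ * ((36 * F) ^ ε * Z ^ ε) ≤ C₁ * (36 * F * Z ^ ε) := by gcongr
      _ = _ := by ring
  have hfl : 1 ≤ ⌊Z⌋₊ := Nat.one_le_floor_iff _ |>.2 hZ
  have hIcard : (#I : ℝ) ≤ 36 * F * Z := by
    have h1 := card_le_mul_of_fiber_le (T := ball ⌊Z⌋₊) ω
      (fun i hi => mem_ball.2 (Nat.le_floor (hωZ i hi))) hFI
    have h2 : (#(ball ⌊Z⌋₊) : ℝ) ≤ 9 * ⌊Z⌋₊ := by exact_mod_cast card_ball_le _ hfl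
    have h3 := Nat.floor_le hZ0.le
    calc (#I : ℝ) ≤ F * #(ball ⌊Z⌋₊) := h1
      _ ≤ F * (9 * Z) := by gcongr; linarith
      _ ≤ _ := by nlinarith
  -- Dyadic ranges `nrm w ∈ [2^r, 2^(r+1))`: the bound `C · W · V` for the Dirichlet symbols is of
  -- order `Z` only if `v` is cut at about `Z/2^r` for each size of `w`.
  have hpiece : ∀ r ∈ range (Nat.size ⌊Z⌋₊), BilinBound I J
      (fun i j => (if Nat.log 2 (nrm (ω i)) = r ∧ IsOddPrimitive (ω i) then 1 else 0) *
        (if nrm (υ j) ≤ ⌊4 * Z / 2 ^ r⌋₊ then 1 else 0) * jacobiKubota (ω i * υ j))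
      (F * F * (512 * (5 * S) * (16 * C * Z ^ (1 - δ)))) := by
    intro r _
    refine BilinBound.indicator (fun i => Nat.log 2 (nrm (ω i)) = r ∧ IsOddPrimitive (ω i))
      (fun j => nrm (υ j) ≤ ⌊4 * Z / 2 ^ r⌋₊) ?_
    rcases Finset.eq_empty_or_nonempty
      (I.filter fun i => Nat.log 2 (nrm (ω i)) = r ∧ IsOddPrimitive (ω i)) with he | ⟨i₀, hi₀⟩
    · rw [he]
      intro α β _ _
      rw [sum_empty, norm_zero]
      positivity
    rw [mem_filter] at hi₀
    obtain ⟨hi₀, hr, -⟩ := hi₀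
    obtain ⟨hp₀, hl₀, hu₀⟩ := hω i₀ hi₀
    have hn0 : nrm (ω i₀) ≠ 0 := (nrm_pos.2 hp₀.ne_zero).ne'
    have hr1 : ((2 : ℝ) ^ r) ≤ nrm (ω i₀) := by
      rw [← hr]; exact_mod_cast Nat.pow_log_le_self 2 hn0
    have hr2 : (nrm (ω i₀) : ℝ) ≤ 2 * 2 ^ r := by
      rw [← hr, ← pow_succ']; exact_mod_cast (Nat.lt_pow_succ_log_self (by norm_num) _).le
    have h4η : (4 * Z) ^ η ≤ 2 * Z ^ η := by
      rw [Real.mul_rpow (by norm_num) hZ0.le]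
      gcongr
      calc (4 : ℝ) ^ η ≤ 4 ^ (1 / 2 : ℝ) := Real.rpow_le_rpow_of_exponent_le (by norm_num) hη1
        _ = 2 := by rw [← Real.sqrt_eq_rpow]; rw [show (4 : ℝ) = 2 ^ 2 by norm_num]; simp
    have hZr : Z ^ η ≤ Z / 2 ^ r := by
      rw [le_div_iff₀ (by positivity)]
      calc Z ^ η * 2 ^ r ≤ Z ^ η * Z ^ (1 - η) := by gcongr; exact hr1.trans hu₀
        _ = Z := by rw [← Real.rpow_add hZ0]; simp
    have hZη : 1 ≤ Z ^ η := Real.one_le_rpow hZ hη.le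
    have hV1 : (⌊4 * Z / 2 ^ r⌋₊ : ℝ) ≤ 4 * Z / 2 ^ r := Nat.floor_le (by positivity)
    have hV2 : 4 * Z / 2 ^ r - 1 < ⌊4 * Z / 2 ^ r⌋₊ := Nat.sub_one_lt_floor _
    have e4 : 4 * Z / 2 ^ r = 4 * (Z / 2 ^ r) := by ring
    have h2r : (1 : ℝ) ≤ 2 ^ r := one_le_pow₀ (by norm_num)
    have hW : ((4 * 2 ^ r : ℕ) : ℝ) = 4 * 2 ^ r := by push_cast; ring
    have hWZ : ((4 * 2 ^ r : ℕ) : ℝ) ≤ 4 * Z := by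
      rw [hW]; linarith [hr1.trans (hωZ i₀ hi₀)]
    -- The factors `4` leave room for the floor and for `(4Z)^η ≤ 2 Z^η` in the size conditions.
    have b1 := hbil (4 * Z) (4 * 2 ^ r) ⌊4 * Z / 2 ^ r⌋₊ (by linarith)
      (by rw [hW]; linarith) hWZ (by linarith)
      (hV1.trans (div_le_self (by positivity) h2r))
    have b2 : BilinBound (oddPrimBall (4 * 2 ^ r))
        ((ball ⌊4 * Z / 2 ^ r⌋₊).filter IsPrimary)
        (fun w v => (dirichletSym v w : ℂ)) (16 * C * Z ^ (1 - δ)) := by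
      refine (b1.comp (I' := oddPrimBall (4 * 2 ^ r))
        (J' := (ball ⌊4 * Z / 2 ^ r⌋₊).filter IsPrimary) id id 1 1 (fun _ h => h)
        (fun v hv => ?_) (fun w _ s _ hs => ?_) (fun w _ s _ hs => ?_)).mono ?_
      · rw [mem_filter] at hv ⊢
        exact ⟨hv.1, hv.2.ne_zero⟩
      · exact card_le_one.2 fun a ha b hb => (hs a ha).trans (hs b hb).symm
      · exact card_le_one.2 fun a ha b hb => (hs a ha).trans (hs b hb).symm
      · rw [hW, Nat.cast_one, one_mul, one_mul]
        have h1 : (4 * Z) ^ (-δ) ≤ Z ^ (-δ) :=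
          Real.rpow_le_rpow_of_nonpos hZ0 (by linarith) (by linarith)
        calc C * (4 * 2 ^ r * (⌊4 * Z / 2 ^ r⌋₊ : ℝ)) * (4 * Z) ^ (-δ)
            ≤ C * (4 * 2 ^ r * (4 * Z / 2 ^ r)) * Z ^ (-δ) := by gcongr
          _ = 16 * C * (Z ^ (1 : ℝ) * Z ^ (-δ)) := by
            rw [Real.rpow_one]; field_simp; norm_num
          _ = _ := by rw [← Real.rpow_add hZ0, sub_eq_add_neg]
    have b3 := GaussSum.BilinBound.jacobiKubota (fun w hw => (mem_oddPrimBall.1 hw).2)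
      (fun v hv => (mem_filter.1 hv).2.isOddEven) b2
    have hcardO : (#(oddPrimBall (4 * 2 ^ r)) : ℝ) ≤ 36 * F * Z := by
      have h1 : #(oddPrimBall (4 * 2 ^ r)) ≤ 9 * (4 * 2 ^ r) :=
        (card_filter_le _ _).trans (card_ball_le _ (by have := Nat.one_le_two_pow (n := r); omega))
      have h2 : (#(oddPrimBall (4 * 2 ^ r)) : ℝ) ≤ 9 * ((4 * 2 ^ r : ℕ) : ℝ) := by exact_mod_cast h1
      nlinarith
    have b4 := b3.mono (M' := 512 * (5 * S) * (16 * C * Z ^ (1 - δ))) (by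
      gcongr
      linarith [hsz _ hcardO])
    have hfF : ((⌊F⌋₊ : ℕ) : ℝ) ≤ F := Nat.floor_le (by linarith)
    refine (b4.comp ω υ ⌊F⌋₊ ⌊F⌋₊ ?_ ?_ ?_ ?_).mono (by gcongr)
    · intro i hi
      rw [mem_filter] at hi
      obtain ⟨hi, hri, hpi⟩ := hi
      rw [mem_oddPrimBall]
      refine ⟨?_, hpi⟩
      have := Nat.lt_pow_succ_log_self (b := 2) (by norm_num) (nrm (ω i))
      rw [hri, pow_succ] at this
      omega
    · intro j hj
      rw [mem_filter] at hj
      rw [mem_filter, mem_ball]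
      exact ⟨hj.2, hυ j hj.1⟩
    · intro w _ s hs hsw
      exact Nat.le_floor (hFI w s (hs.trans (filter_subset _ _)) hsw)
    · intro w _ s hs hsw
      exact Nat.le_floor (hFJ w s (hs.trans (filter_subset _ _)) hsw)
  have hsum := BilinBound.sum _ hpiece
  rw [sum_const, card_range, nsmul_eq_mul] at hsum
  have hsep1 : Separable I J (fun i j => if (nrm (ω i) * nrm (υ j) : ℝ) ≤ X then 1 else 0)
      (Nat.size #I) := by
    refine (separable_le (I := I) (J := J) (fun i => (nrm (ω i) : ℝ))
      (fun j => X / nrm (υ j))).congr fun i _ j hj => ?_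
    have h0 : (0 : ℝ) < nrm (υ j) := by exact_mod_cast nrm_pos.2 (hυ j hj).ne_zero
    simp only [le_div_iff₀ h0]
  have hsep := (hsep1.mul (separable_lt (I := I) (J := J) x y)).mul
    (separable_le (I := I) (J := J) x' y')
  refine ((hsep _ _ hsum).mono ?_).congr ?_
  · have h1 := hsz _ hIcard
    have h2 := hsz ⌊Z⌋₊ ((Nat.floor_le hZ0.le).trans (by nlinarith))
    calc _ ≤ S * S * S * (S * (F * F * (512 * (5 * S) * (16 * C * Z ^ (1 - δ))))) := by gcongr
      _ = 512 * 5 * 16 * C * (36 * C₁) ^ 5 * F ^ 7 * ((Z ^ ε) ^ 5 * Z ^ (1 - δ)) := by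
        rw [hS]; ring
      _ ≤ 512 * 5 * 16 * C * (36 * C₁) ^ 5 * F ^ 7 * Z ^ (1 - δ / 2) := by
        gcongr
        rw [← Real.rpow_natCast, ← Real.rpow_mul hZ0.le, ← Real.rpow_add hZ0]
        refine Real.rpow_le_rpow_of_exponent_le hZ ?_
        push_cast; linarith
  · intro i hi j hj
    by_cases hcut : (nrm (ω i) * nrm (υ j) : ℝ) ≤ X
    swap
    · simp [hcut]
    congr 1
    by_cases hj0 : jacobiKubota (ω i * υ j) = 0
    · simp [hj0]
    -- Where the symbol is nonzero, exactly one dyadic range contains `w`, and the cutoff on the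
    -- product implies the cutoff on `v` in that range.
    have hprim := isOddPrimitive_of_jacobiKubota_mul_ne_zero (hω i hi).1 (hυ j hj) hj0
    have hn0 : nrm (ω i) ≠ 0 := (nrm_pos.2 (hω i hi).1.ne_zero).ne'
    have hlog : Nat.log 2 (nrm (ω i)) ∈ range (Nat.size ⌊Z⌋₊) := by
      rw [mem_range, Nat.lt_size]
      exact (Nat.pow_log_le_self 2 hn0).trans (Nat.le_floor (hωZ i hi))
    rw [sum_eq_single_of_mem _ hlog]
    · have : nrm (υ j) ≤ ⌊4 * Z / 2 ^ Nat.log 2 (nrm (ω i))⌋₊ := by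
        refine Nat.le_floor ?_
        rw [le_div_iff₀ (by positivity)]
        have h1 : ((2 : ℝ) ^ Nat.log 2 (nrm (ω i))) ≤ nrm (ω i) := by
          exact_mod_cast Nat.pow_log_le_self 2 hn0
        calc (nrm (υ j) : ℝ) * 2 ^ Nat.log 2 (nrm (ω i)) ≤ nrm (υ j) * nrm (ω i) := by gcongr
          _ = nrm (ω i) * nrm (υ j) := mul_comm _ _
          _ ≤ 4 * Z := by linarith
      simp [hprim, this]
    · intro r _ hr
      rw [if_neg fun h => hr h.1.symm]; simp

end GaussSum

/-! ### Factorizations of a primary number and of its norm -/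

namespace GaussSum

theorem natCast_nrm (z : GaussianInt) : ((nrm z : ℕ) : GaussianInt) = z * star z := by
  rw [← Zsqrtd.norm_eq_mul_conj, ← GaussianInt.abs_natCast_norm]; rfl

theorem eq_one_of_isPrimary_of_nrm_eq_one {c : GaussianInt} (hc : IsPrimary c) (h : nrm c = 1) :
    c = 1 := by
  obtain ⟨⟨b, hb⟩, h4⟩ := isPrimary_iff.1 hc
  have h1 := cast_nrm c
  rw [h] at h1
  have hb0 : b = 0 := by
    by_contra h0
    have : 1 ≤ b ^ 2 := by have := sq_pos_of_ne_zero h0; omega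
    rw [hb] at h1
    push_cast at h1
    nlinarith [sq_nonneg c.re]
  have him : c.im = 0 := by omega
  rw [him] at h1 h4
  have : c.re = 1 ∨ c.re = -1 := by
    have h2 : (c.re - 1) * (c.re + 1) = 0 := by push_cast at h1; linarith
    rcases mul_eq_zero.1 h2 with h3 | h3 <;> omega
  ext
  · rw [Zsqrtd.re_one]; omega
  · rw [Zsqrtd.im_one]; exact him

theorem exists_unit_mul_isPrimary {w : GaussianInt} (hw : Odd (nrm w)) :
    ∃ u : GaussianInt, IsUnit u ∧ IsPrimary (u * w) := by
  have h := cast_nrm w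
  have hpar : (Even w.im ∧ Odd w.re) ∨ (Odd w.im ∧ Even w.re) := by
    have h1 : Odd (w.re ^ 2 + w.im ^ 2) := by rw [← h]; exact_mod_cast hw
    rw [Int.odd_add] at h1
    rcases Int.even_or_odd w.im with h2 | h2
    · exact Or.inl ⟨h2, by
        have : Even (w.im ^ 2) := by rw [sq]; exact h2.mul_right _
        have := h1.2 this
        exact (Int.odd_pow' two_ne_zero).1 this⟩
    · refine Or.inr ⟨h2, ?_⟩
      by_contra h3
      rw [Int.not_even_iff_odd] at h3
      have := h1.1 h3.pow
      rw [Int.even_pow' two_ne_zero] at this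
      rw [← Int.not_even_iff_odd] at h2
      exact h2 this
  have hI : IsUnit (⟨0, 1⟩ : GaussianInt) := isUnit_iff_nrm.2 (by
    have := cast_nrm (⟨0, 1⟩ : GaussianInt); norm_num at this; exact_mod_cast this)
  rcases hpar with ⟨h1, h2⟩ | ⟨h1, h2⟩
  · by_cases h4 : (w.re + w.im) % 4 = 1
    · exact ⟨1, isUnit_one, by rw [one_mul]; exact isPrimary_iff.2 ⟨h1, h4⟩⟩
    · refine ⟨-1, isUnit_one.neg, isPrimary_iff.2 ?_⟩
      rw [neg_one_mul, Zsqrtd.re_neg, Zsqrtd.im_neg]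
      refine ⟨h1.neg, ?_⟩
      obtain ⟨a, ha⟩ := h1
      obtain ⟨b, hb⟩ := h2
      omega
  · by_cases h4 : (w.re - w.im) % 4 = 1
    · refine ⟨⟨0, 1⟩, hI, isPrimary_iff.2 ?_⟩
      simp only [Zsqrtd.re_mul, Zsqrtd.im_mul]
      refine ⟨by simpa using h2, ?_⟩
      omega
    · refine ⟨-⟨0, 1⟩, hI.neg, isPrimary_iff.2 ?_⟩
      simp only [neg_mul, Zsqrtd.re_neg, Zsqrtd.im_neg, Zsqrtd.re_mul, Zsqrtd.im_mul]
      refine ⟨by simpa using h2, ?_⟩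
      obtain ⟨a, ha⟩ := h1
      obtain ⟨b, hb⟩ := h2
      omega

/-- The ideal generated by `z` and its conjugate contains `2 Re z` and `2 Im z`, hence `2`, and also
the odd norm. -/
theorem isCoprime_star {z : GaussianInt} (hz : IsOddEven z) (hco : IsCoprime z.re z.im) :
    IsCoprime z (star z) := by
  obtain ⟨a, b, h⟩ := hco
  obtain ⟨t, ht⟩ := odd_nrm hz.1 hz.2
  have e1 : (a : GaussianInt) * (z + star z) + (b : GaussianInt) * (⟨0, -1⟩ * (z - star z)) = 2 := by
    ext
    · simp; linear_combination 2 * h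
    · simp
  have e2 : z * star z - t * 2 = 1 := by rw [← natCast_nrm, ht]; push_cast; ring
  refine ⟨star z - t * (a + b * ⟨0, -1⟩), -t * (a - b * ⟨0, -1⟩), ?_⟩
  linear_combination e2 - t * e1

/-- The divisor of norm `a` is `gcd(z, a)`, made primary by a unit. Coprimality of `z` with its
conjugate gives that the norm of this gcd divides `a`, and Bézout gives the converse. -/
theorem exists_isPrimary_mul_eq {z : GaussianInt} (hz : IsPrimary z) (hco : IsCoprime z.re z.im)
    {a b : ℕ} (hab : a * b = nrm z) :
    ∃ w v, IsPrimary w ∧ IsPrimary v ∧ w * v = z ∧ nrm w = a ∧ nrm v = b := by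
  obtain ⟨p, q, hpq⟩ := isCoprime_star hz.isOddEven hco
  set w := EuclideanDomain.gcd z (a : GaussianInt) with hw
  have hwz : w ∣ z := EuclideanDomain.gcd_dvd_left _ _
  have hwa : w ∣ (a : GaussianInt) := EuclideanDomain.gcd_dvd_right _ _
  have hstar : ∀ {x y : GaussianInt}, x ∣ y → star x ∣ star y := by
    rintro x _ ⟨c, rfl⟩; exact ⟨star c, by rw [star_mul, mul_comm]⟩
  have ha0 : star (a : GaussianInt) = a := by ext <;> simp
  have hzn := natCast_nrm z
  rw [← hab, Nat.cast_mul] at hzn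
  have h1 : ((nrm w : ℕ) : GaussianInt) ∣ a := by
    have h2 : w * star w ∣ z * a := mul_dvd_mul hwz (ha0 ▸ hstar hwa)
    have h3 : w * star w ∣ a * star z := mul_dvd_mul hwa (hstar hwz)
    have e : (a : GaussianInt) = p * (z * a) + q * (a * star z) := by linear_combination -a * hpq
    rw [natCast_nrm, e]
    exact dvd_add (h2.mul_left _) (h3.mul_left _)
  have h4 : (a : GaussianInt) ∣ (nrm w : ℕ) := by
    have e := EuclideanDomain.gcd_eq_gcd_ab z (a : GaussianInt)
    rw [← hw] at e
    set r := EuclideanDomain.gcdA z (a : GaussianInt)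
    set s := EuclideanDomain.gcdB z (a : GaussianInt)
    have e' : star w = star r * star z + star s * a := by
      rw [e, star_add, star_mul, star_mul, ha0]
    rw [natCast_nrm, e', e]
    refine ⟨b * (r * star r) + z * r * star s + s * star r * star z + a * s * star s, ?_⟩
    linear_combination -(r * star r) * hzn
  have hnat : ∀ {m n : ℕ}, (m : GaussianInt) ∣ n → m ∣ n := by
    rintro m n ⟨c, hc⟩
    have := congrArg Zsqrtd.re hc
    simp only [Zsqrtd.re_natCast, Zsqrtd.re_mul, Zsqrtd.im_natCast] at this
    exact Int.natCast_dvd_natCast.1 ⟨c.re, by linarith⟩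
  have hwn : nrm w = a := Nat.dvd_antisymm (hnat h1) (hnat h4)
  have hodd : Odd (nrm w) :=
    Odd.of_dvd_nat (odd_nrm hz.isOddEven.1 hz.isOddEven.2) (nrm_dvd_nrm hwz)
  obtain ⟨u, hu, huw⟩ := exists_unit_mul_isPrimary hodd
  obtain ⟨v, hv⟩ : u * w ∣ z := (hu.mul_left_dvd).2 hwz
  have hn : nrm (u * w) = a := by rw [nrm_mul, isUnit_iff_nrm.1 hu, one_mul, hwn]
  refine ⟨u * w, v, huw, huw.of_mul_left (hv ▸ hz), hv.symm, hn, ?_⟩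
  have h5 := nrm_mul (u * w) v
  rw [← hv, ← hab, hn] at h5
  have ha : 0 < a := by rw [← hwn]; exact hodd.pos
  exact (Nat.eq_of_mul_eq_mul_left ha h5).symm

/-- From `1 = p z + q z̄`, multiplied by `w'`, each term is divisible by `w`: the first as `w ∣ z`,
the second because `w' z̄` is a multiple of `nrm w' = nrm w`. The quotient `w'/w` is primary of norm
`1`, hence `1`. -/
theorem eq_of_dvd_of_nrm_eq {z w w' : GaussianInt} (hz : IsPrimary z) (hco : IsCoprime z.re z.im)
    (hw : IsPrimary w) (hw' : IsPrimary w') (h : w ∣ z) (h' : w' ∣ z) (hn : nrm w = nrm w') :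
    w = w' := by
  obtain ⟨p, q, hpq⟩ := isCoprime_star hz.isOddEven hco
  have hdvd : w ∣ w' := by
    obtain ⟨v, hv⟩ := h'
    have e : w' = p * w' * z + q * star v * (w * star w) := by
      rw [← natCast_nrm, hn, natCast_nrm]
      have : star z = star v * star w' := by rw [hv, star_mul]
      linear_combination (-w') * hpq + q * w' * this
    rw [e]
    exact dvd_add (h.mul_left _) ((dvd_mul_right _ _).mul_left _)
  obtain ⟨c, rfl⟩ := hdvd
  have hc := hw.of_mul_left hw'
  rw [nrm_mul] at hn
  have hpos : 0 < nrm w := nrm_pos.2 hw.ne_zero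
  have : nrm c = 1 := by
    have : nrm w * nrm c = nrm w * 1 := by omega
    exact Nat.eq_of_mul_eq_mul_left hpos this
  rw [eq_one_of_isPrimary_of_nrm_eq_one hc this, mul_one]

/-- The primary Gaussian integers of norm at most `X`. -/
noncomputable def primaryBall (X : ℕ) : Finset GaussianInt := {z ∈ ball X | IsPrimary z}

theorem mem_primaryBall {X : ℕ} {z : GaussianInt} :
    z ∈ primaryBall X ↔ nrm z ≤ X ∧ IsPrimary z := by rw [primaryBall, mem_filter, mem_ball]

theorem sum_divisorsAntidiagonal_nrm {z : GaussianInt} (hz : IsPrimary z)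
    (hco : IsCoprime z.re z.im) {X : ℕ} (hX : nrm z ≤ X) (g : ℕ → ℕ → ℂ) :
    ∑ p ∈ (nrm z).divisorsAntidiagonal, g p.1 p.2 =
      ∑ y ∈ primaryBall X ×ˢ primaryBall X with y.1 * y.2 = z, g (nrm y.1) (nrm y.2) := by
  symm
  refine sum_bij (fun y _ => (nrm y.1, nrm y.2)) ?_ ?_ ?_ ?_
  · rintro ⟨w, v⟩ h
    simp only [mem_filter, mem_product, mem_primaryBall] at h
    rw [Nat.mem_divisorsAntidiagonal]
    exact ⟨by rw [← h.2, nrm_mul], (nrm_pos.2 hz.ne_zero).ne'⟩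
  · rintro ⟨w, v⟩ h ⟨w', v'⟩ h' e
    simp only [mem_filter, mem_product, mem_primaryBall, Prod.mk.injEq] at h h' e ⊢
    obtain ⟨⟨hw, hv⟩, hwv⟩ := h
    obtain ⟨⟨hw', hv'⟩, hwv'⟩ := h'
    have e1 := eq_of_dvd_of_nrm_eq hz hco hw.2 hw'.2 ⟨v, hwv.symm⟩ ⟨v', hwv'.symm⟩ e.1
    refine ⟨e1, ?_⟩
    subst e1
    exact mul_left_cancel₀ hw.2.ne_zero (hwv.trans hwv'.symm)
  · rintro ⟨a, b⟩ h
    rw [Nat.mem_divisorsAntidiagonal] at h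
    obtain ⟨w, v, hw, hv, hwv, rfl, rfl⟩ := exists_isPrimary_mul_eq hz hco h.1
    have hle : nrm w ≤ nrm z ∧ nrm v ≤ nrm z :=
      ⟨Nat.le_of_dvd (nrm_pos.2 hz.ne_zero) ⟨_, h.1.symm⟩,
        Nat.le_of_dvd (nrm_pos.2 hz.ne_zero) ⟨_, (mul_comm _ _).trans h.1 |>.symm⟩⟩
    refine ⟨(w, v), ?_, rfl⟩
    simp only [mem_filter, mem_product, mem_primaryBall]
    exact ⟨⟨⟨hle.1.trans hX, hw⟩, hle.2.trans hX, hv⟩, hwv⟩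
  · intro _ _; rfl

/-- The bridge from arithmetic in `ℕ` to bilinear forms: any function of the factorizations of the
norm, weighted by an `h` supported on primitive numbers, becomes a double sum over primary numbers.
-/
theorem sum_mul_sum_divisorsAntidiagonal_nrm {h : GaussianInt → ℂ}
    (hh : ∀ z, IsPrimary z → h z ≠ 0 → IsCoprime z.re z.im) (X : ℕ) (g : ℕ → ℕ → ℂ) :
    ∑ z ∈ primaryBall X, h z * ∑ p ∈ (nrm z).divisorsAntidiagonal, g p.1 p.2 =
      ∑ w ∈ primaryBall X, ∑ v ∈ primaryBall X,
        if nrm w * nrm v ≤ X then h (w * v) * g (nrm w) (nrm v) else 0 := by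
  classical
  have e : ∑ w ∈ primaryBall X, ∑ v ∈ primaryBall X,
      (if nrm w * nrm v ≤ X then h (w * v) * g (nrm w) (nrm v) else 0) =
      ∑ y ∈ primaryBall X ×ˢ primaryBall X with nrm y.1 * nrm y.2 ≤ X,
        h (y.1 * y.2) * g (nrm y.1) (nrm y.2) := by
    rw [sum_filter, sum_product]
  rw [e, ← sum_fiberwise_of_maps_to (t := primaryBall X)
    (g := fun y : GaussianInt × GaussianInt => y.1 * y.2)]
  · refine sum_congr rfl fun z hz => ?_
    rw [mem_primaryBall] at hz
    by_cases h0 : h z = 0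
    · rw [h0, zero_mul]
      refine (sum_eq_zero fun y hy => ?_).symm
      rw [(mem_filter.1 hy).2, h0, zero_mul]
    · rw [sum_divisorsAntidiagonal_nrm hz.2 (hh z hz.2 h0) hz.1, mul_sum, filter_filter]
      refine sum_congr ?_ ?_
      · ext y
        simp only [mem_filter]
        refine and_congr_right fun _ => ⟨fun e => ⟨?_, e⟩, fun e => e.2⟩
        rw [← nrm_mul, e]; exact hz.1
      · intro y hy
        rw [(mem_filter.1 hy).2.2]
  · intro y hy
    rw [mem_filter, mem_product, mem_primaryBall, mem_primaryBall] at hy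
    rw [mem_primaryBall, nrm_mul]
    exact ⟨hy.2, hy.1.1.2.mul hy.1.2.2⟩

end GaussSum

/-! ### Splitting a squarefree number at a prefix of its primes -/

/-- The greatest prime factor of `n`, with value `0` at `0` and `1`. -/
def greatestPrimeFactor (n : ℕ) : ℕ := n.primeFactors.sup id

theorem le_greatestPrimeFactor {n p : ℕ} (hp : p ∈ n.primeFactors) : p ≤ greatestPrimeFactor n :=
  le_sup (f := id) hp

theorem greatestPrimeFactor_mem {n : ℕ} (hn : 2 ≤ n) : greatestPrimeFactor n ∈ n.primeFactors := by
  have hne : n.primeFactors.Nonempty := Nat.nonempty_primeFactors.2 hn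
  obtain ⟨p, hp, h⟩ := exists_mem_eq_sup _ hne id
  rw [greatestPrimeFactor, h]; exact hp

theorem greatestPrimeFactor_le {n : ℕ} : greatestPrimeFactor n ≤ n :=
  Finset.sup_le fun _ hp => Nat.le_of_mem_primeFactors hp

/-- The pair `(a, b)` splits the prime factors of `ab` into small and large ones, at the first place
where the product of the small ones exceeds `Y`. -/
def IsPrefixSplit (Y : ℝ) (a b : ℕ) : Prop :=
  (Y < a ∧ (a : ℝ) ≤ Y * greatestPrimeFactor a) ∧ ∀ q ∈ b.primeFactors, greatestPrimeFactor a < q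

theorem prod_primeFactors_filter_le {n a b : ℕ} (hn : Squarefree n) (hab : a * b = n)
    (h : ∀ q ∈ b.primeFactors, greatestPrimeFactor a < q) :
    ∏ p ∈ n.primeFactors with p ≤ greatestPrimeFactor a, p = a := by
  subst hab
  have ha : a ≠ 0 := left_ne_zero_of_mul hn.ne_zero
  have hb : b ≠ 0 := right_ne_zero_of_mul hn.ne_zero
  have : {p ∈ (a * b).primeFactors | p ≤ greatestPrimeFactor a} = a.primeFactors := by
    ext p
    rw [mem_filter, Nat.primeFactors_mul ha hb, mem_union]
    constructor
    · rintro ⟨hp | hp, hle⟩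
      · exact hp
      · exact absurd (h p hp) (by omega)
    · exact fun hp => ⟨Or.inl hp, le_greatestPrimeFactor hp⟩
  rw [this]
  exact Nat.prod_primeFactors_of_squarefree (hn.squarefree_of_dvd (dvd_mul_right _ _))

theorem prod_primeFactors_filter_succ {n p : ℕ} (hp : p + 1 ∈ n.primeFactors) :
    ∏ q ∈ n.primeFactors with q ≤ p + 1, q = (p + 1) * ∏ q ∈ n.primeFactors with q ≤ p, q := by
  have : {q ∈ n.primeFactors | q ≤ p + 1} = insert (p + 1) {q ∈ n.primeFactors | q ≤ p} := by
    ext q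
    simp only [mem_filter, mem_insert]
    constructor
    · rintro ⟨h1, h2⟩
      rcases Nat.lt_or_ge p q with h | h
      · left; omega
      · exact Or.inr ⟨h1, h⟩
    · rintro (rfl | ⟨h1, h2⟩)
      · exact ⟨hp, le_rfl⟩
      · exact ⟨h1, by omega⟩
  rw [this, prod_insert]
  simp

theorem prod_primeFactors_filter_mono {n s t : ℕ} (hst : s ≤ t) :
    ∏ q ∈ n.primeFactors with q ≤ s, q ≤ ∏ q ∈ n.primeFactors with q ≤ t, q := by
  refine prod_le_prod_of_subset_of_one_le' (fun q hq => ?_) fun q hq _ => ?_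
  · rw [mem_filter] at hq ⊢; exact ⟨hq.1, hq.2.trans hst⟩
  · exact (Nat.prime_of_mem_primeFactors (mem_filter.1 hq).1).one_le

/-- The condition `a ≤ Y · P(a)` says that removing the greatest prime of `a` brings the product
back to at most `Y`. So `P(a)` is the first place where the partial products pass `Y`, which makes
the split unique. -/
theorem IsPrefixSplit.lt_iff {Y : ℝ} (hY : 1 ≤ Y) {n a b : ℕ} (hn : Squarefree n) (hab : a * b = n)
    (h : IsPrefixSplit Y a b) (t : ℕ) :
    Y < (∏ p ∈ n.primeFactors with p ≤ t, p : ℕ) ↔ greatestPrimeFactor a ≤ t := by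
  obtain ⟨⟨h1, h2⟩, h3⟩ := h
  have e := prod_primeFactors_filter_le hn hab h3
  constructor
  · intro ht
    by_contra hlt
    push Not at hlt
    have ha2 : 2 ≤ a := by
      have : (1 : ℝ) < a := hY.trans_lt h1
      exact_mod_cast this
    have hmem := greatestPrimeFactor_mem ha2
    obtain ⟨p, hp⟩ : ∃ p, greatestPrimeFactor a = p + 1 := ⟨greatestPrimeFactor a - 1, by omega⟩
    have hmem' : p + 1 ∈ n.primeFactors := by
      rw [← hp, ← hab]
      exact Nat.primeFactors_mono (dvd_mul_right _ _) (hab ▸ hn.ne_zero) hmem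
    rw [hp, prod_primeFactors_filter_succ hmem'] at e
    have h4 : ∏ q ∈ n.primeFactors with q ≤ t, q ≤ ∏ q ∈ n.primeFactors with q ≤ p, q :=
      prod_primeFactors_filter_mono (by omega)
    have h5 : (∏ q ∈ n.primeFactors with q ≤ t, q : ℕ) ≤ (∏ q ∈ n.primeFactors with q ≤ p, q : ℕ) := h4
    have h6 : ((p + 1 : ℕ) : ℝ) * (∏ q ∈ n.primeFactors with q ≤ p, q : ℕ) ≤ Y * (p + 1 : ℕ) := by
      rw [← hp]
      refine le_trans (le_of_eq ?_) h2
      rw [hp]; exact_mod_cast e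
    have h7 : ((∏ q ∈ n.primeFactors with q ≤ p, q : ℕ) : ℝ) ≤ Y := by
      have hpos : (0 : ℝ) < (p + 1 : ℕ) := by positivity
      rw [mul_comm] at h6
      exact le_of_mul_le_mul_right h6 hpos
    have h8 : ((∏ q ∈ n.primeFactors with q ≤ t, q : ℕ) : ℝ) ≤
        (∏ q ∈ n.primeFactors with q ≤ p, q : ℕ) := by exact_mod_cast h5
    linarith
  · intro ht
    have h4 := prod_primeFactors_filter_mono (n := n) ht
    rw [e] at h4
    exact h1.trans_le (by exact_mod_cast h4)

theorem IsPrefixSplit.unique {Y : ℝ} (hY : 1 ≤ Y) {n a b a' b' : ℕ} (hn : Squarefree n)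
    (hab : a * b = n) (hab' : a' * b' = n) (h : IsPrefixSplit Y a b) (h' : IsPrefixSplit Y a' b') :
    a = a' ∧ b = b' := by
  have hg : greatestPrimeFactor a = greatestPrimeFactor a' :=
    le_antisymm ((h.lt_iff hY hn hab _).1 ((h'.lt_iff hY hn hab' _).2 le_rfl))
      ((h'.lt_iff hY hn hab' _).1 ((h.lt_iff hY hn hab _).2 le_rfl))
  have e := prod_primeFactors_filter_le hn hab h.2
  have e' := prod_primeFactors_filter_le hn hab' h'.2
  rw [hg, e'] at e
  refine ⟨e.symm, ?_⟩
  subst e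
  have h0 : 0 < a' := Nat.pos_of_ne_zero (left_ne_zero_of_mul (hab ▸ hn.ne_zero))
  exact Nat.eq_of_mul_eq_mul_left h0 (hab.trans hab'.symm)

theorem exists_isPrefixSplit {Y : ℝ} (hY : 1 ≤ Y) {n : ℕ} (hn : Squarefree n) (hYn : Y < n) :
    ∃ a b, a * b = n ∧ IsPrefixSplit Y a b := by
  classical
  have hex : ∃ t : ℕ, Y < (∏ p ∈ n.primeFactors with p ≤ t, p : ℕ) := by
    refine ⟨n, ?_⟩
    rw [filter_true_of_mem fun p hp => Nat.le_of_mem_primeFactors hp,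
      Nat.prod_primeFactors_of_squarefree hn]
    exact hYn
  -- The least `t` at which the product passes `Y` must be a prime factor of `n`, since the product
  -- changes there.
  set t := Nat.find hex with ht
  have h1 := Nat.find_spec hex
  rw [← ht] at h1
  have ht0 : t ≠ 0 := by
    intro h0
    rw [h0, prod_eq_one] at h1
    · norm_num at h1; linarith
    · intro p hp
      have := (Nat.prime_of_mem_primeFactors (mem_filter.1 hp).1).pos
      have := (mem_filter.1 hp).2
      omega
  obtain ⟨s, hs⟩ := Nat.exists_eq_succ_of_ne_zero ht0
  have h2 : ((∏ p ∈ n.primeFactors with p ≤ s, p : ℕ) : ℝ) ≤ Y :=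
    not_lt.1 (Nat.find_min hex (m := s) (by omega))
  have hmem : s + 1 ∈ n.primeFactors := by
    by_contra hno
    have : {q ∈ n.primeFactors | q ≤ s + 1} = {q ∈ n.primeFactors | q ≤ s} := by
      ext q
      simp only [mem_filter, and_congr_right_iff]
      intro hq
      have : q ≠ s + 1 := fun h => hno (h ▸ hq)
      omega
    rw [hs, Nat.succ_eq_add_one, this] at h1
    linarith
  set a := ∏ p ∈ n.primeFactors with p ≤ t, p with ha
  set b := ∏ p ∈ n.primeFactors with ¬ p ≤ t, p with hb
  have hab : a * b = n := by
    rw [ha, hb, prod_filter_mul_prod_filter_not, Nat.prod_primeFactors_of_squarefree hn]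
  have hpf : a.primeFactors = {p ∈ n.primeFactors | p ≤ t} :=
    Nat.primeFactors_prod fun p hp => Nat.prime_of_mem_primeFactors (mem_filter.1 hp).1
  have hpf' : b.primeFactors = {p ∈ n.primeFactors | ¬ p ≤ t} :=
    Nat.primeFactors_prod fun p hp => Nat.prime_of_mem_primeFactors (mem_filter.1 hp).1
  have hg : greatestPrimeFactor a = t := by
    refine le_antisymm (Finset.sup_le fun p hp => ?_) (le_greatestPrimeFactor ?_)
    · rw [hpf, mem_filter] at hp; exact hp.2
    · rw [hpf, mem_filter, hs]; exact ⟨hmem, le_rfl⟩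
  refine ⟨a, b, hab, ⟨h1, ?_⟩, ?_⟩
  · rw [hg, ha, hs, Nat.succ_eq_add_one, prod_primeFactors_filter_succ hmem, mul_comm Y]
    push_cast at h2 ⊢
    gcongr
  · intro q hq
    rw [hpf', mem_filter] at hq
    omega

open Classical in
theorem sum_isPrefixSplit {Y : ℝ} (hY : 1 ≤ Y) {n : ℕ} (hn : Squarefree n) :
    ∑ p ∈ n.divisorsAntidiagonal, (if IsPrefixSplit Y p.1 p.2 then 1 else 0 : ℂ) =
      if Y < n then 1 else 0 := by
  split_ifs with hYn
  · obtain ⟨a, b, hab, h⟩ := exists_isPrefixSplit hY hn hYn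
    rw [sum_eq_single_of_mem (a, b) (Nat.mem_divisorsAntidiagonal.2 ⟨hab, hn.ne_zero⟩), if_pos h]
    rintro ⟨a', b'⟩ hp hne
    rw [if_neg]
    intro h'
    obtain ⟨rfl, rfl⟩ := h.unique hY hn hab (Nat.mem_divisorsAntidiagonal.1 hp).1 h'
    exact hne rfl
  · refine sum_eq_zero ?_
    rintro ⟨a, b⟩ hp
    rw [if_neg]
    intro h
    have h1 := (Nat.mem_divisorsAntidiagonal.1 hp).1
    have h2 : a ≤ n := Nat.le_of_dvd (Nat.pos_of_ne_zero hn.ne_zero) ⟨b, h1.symm⟩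
    have h3 : (a : ℝ) ≤ n := by exact_mod_cast h2
    exact hYn (h.1.1.trans_le h3)

theorem coprime_of_forall_greatestPrimeFactor_lt {a b : ℕ} (ha : a ≠ 0) (hb : b ≠ 0)
    (h : ∀ q ∈ b.primeFactors, greatestPrimeFactor a < q) : Nat.Coprime a b := by
  rw [← Nat.disjoint_primeFactors ha hb, disjoint_left]
  intro p hp hp'
  have := h p hp'
  have := le_greatestPrimeFactor hp
  omega

/-- The least prime factor of `b`, replaced by `B` if `b = 1`. -/
def leastPrimeFactor (B b : ℕ) : ℕ := if b = 1 then B else b.minFac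

/-- This rewrites the coupling between `a` and `b` in `IsPrefixSplit` as one comparison of a
function of `a` with a function of `b`, the form that `separable_lt` accepts. For `b = 1` the
condition is empty, so the default `B` has to exceed every `P(a)`. -/
theorem lt_leastPrimeFactor_iff {B a b : ℕ} (ha : greatestPrimeFactor a < B) (hb : b ≠ 0) :
    greatestPrimeFactor a < leastPrimeFactor B b ↔
      ∀ q ∈ b.primeFactors, greatestPrimeFactor a < q := by
  rw [leastPrimeFactor]
  split_ifs with h
  · subst h; simpa using ha
  · constructor
    · intro h1 q hq
      exact h1.trans_le (Nat.minFac_le_of_dvd (Nat.prime_of_mem_primeFactors hq).two_le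
        (Nat.dvd_of_mem_primeFactors hq))
    · exact fun h1 => h1 _ (Nat.mem_primeFactors.2 ⟨Nat.minFac_prime h, Nat.minFac_dvd b, hb⟩)

open Classical in
/-- Combinatorial decomposition of the Möbius function on the divisors of a squarefree number. -/
theorem sum_moebius_isPrefixSplit {Y : ℝ} (hY : 1 ≤ Y) {M : ℕ} (hM : Squarefree M) {e : ℕ}
    (he : e ≠ 0) :
    ∑ p ∈ e.divisorsAntidiagonal, (if IsPrefixSplit Y p.1 p.2 then
        (if p.1 ∣ M then (μ p.1 : ℂ) else 0) * (if p.2 ∣ M then (μ p.2 : ℂ) else 0) else 0) =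
      if e ∣ M ∧ Y < e then (μ e : ℂ) else 0 := by
  by_cases heM : e ∣ M
  · have hsq := hM.squarefree_of_dvd heM
    have h1 : ∀ p ∈ e.divisorsAntidiagonal, (if IsPrefixSplit Y p.1 p.2 then
        (if p.1 ∣ M then (μ p.1 : ℂ) else 0) * (if p.2 ∣ M then (μ p.2 : ℂ) else 0) else 0) =
        (μ e : ℂ) * (if IsPrefixSplit Y p.1 p.2 then 1 else 0) := by
      rintro ⟨a, b⟩ hp
      have hab := (Nat.mem_divisorsAntidiagonal.1 hp).1
      dsimp only at hab ⊢
      split_ifs with h2 h3 h4 h4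
      · rw [mul_one, ← hab, ArithmeticFunction.isMultiplicative_moebius.map_mul_of_coprime]
        · push_cast; ring
        · exact Nat.coprime_of_squarefree_mul (hab ▸ hsq)
      · exact absurd ((Dvd.intro_left _ hab).trans heM) h4
      · exact absurd ((Dvd.intro _ hab).trans heM) h3
      · exact absurd ((Dvd.intro _ hab).trans heM) h3
      · simp
    rw [sum_congr rfl h1, ← mul_sum, sum_isPrefixSplit hY hsq]
    simp [heM]
  · rw [if_neg fun h => heM h.1]
    refine sum_eq_zero ?_
    rintro ⟨a, b⟩ hp
    have hab := (Nat.mem_divisorsAntidiagonal.1 hp).1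
    dsimp only at hab ⊢
    split_ifs with h2 h3 h4 h4
    · refine absurd ?_ heM
      rw [← hab]
      -- If both parts divide `M`, so does their product, since a prefix split is automatically
      -- coprime; hence no terms with `e ∤ M` survive, even for `e` with square factors.
      refine Nat.Coprime.mul_dvd_of_dvd_of_dvd (coprime_of_forall_greatestPrimeFactor_lt ?_ ?_ h2.2) h3 h4
      · exact left_ne_zero_of_mul (hab ▸ he)
      · exact right_ne_zero_of_mul (hab ▸ he)
    all_goals simp

/-- A number `n ≤ T` without prime factor up to `√T` is `1` or a prime above `√T`. -/
theorem sum_moebius_dvd_primorial {T n : ℕ} (hn : n ≠ 0) (hnT : n ≤ T) :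
    ∑ e ∈ n.divisors, (if e ∣ primorial (Nat.sqrt T) then (μ e : ℂ) else 0) =
      (if n = 1 then 1 else 0) + (if n.Prime ∧ Nat.sqrt T < n then 1 else 0) := by
  set M := primorial (Nat.sqrt T) with hM
  have hM0 : M ≠ 0 := (squarefree_primorial _).ne_zero
  have h1 : ∑ e ∈ n.divisors, (if e ∣ M then (μ e : ℂ) else 0) = if Nat.gcd n M = 1 then 1 else 0 := by
    rw [← sum_filter]
    have : {e ∈ n.divisors | e ∣ M} = (Nat.gcd n M).divisors := by
      ext e
      rw [mem_filter, Nat.mem_divisors, Nat.mem_divisors, Nat.dvd_gcd_iff]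
      have := Nat.gcd_ne_zero_left (n := M) hn
      tauto
    rw [this]
    have h2 : ((μ * ArithmeticFunction.zeta : ArithmeticFunction ℤ) (Nat.gcd n M)) =
        (1 : ArithmeticFunction ℤ) (Nat.gcd n M) := by
      rw [ArithmeticFunction.moebius_mul_coe_zeta]
    rw [ArithmeticFunction.coe_mul_zeta_apply, ArithmeticFunction.one_apply] at h2
    exact_mod_cast h2
  rw [h1]
  by_cases hn1 : n = 1
  · subst hn1
    simp [Nat.not_prime_one]
  · rw [if_neg hn1, zero_add]
    have : Nat.gcd n M = 1 ↔ n.Prime ∧ Nat.sqrt T < n := by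
      constructor
      · intro hg
        have hp := Nat.minFac_prime hn1
        have h3 : Nat.sqrt T < n.minFac := by
          by_contra hle
          have h4 : n.minFac ∣ M := (hp.dvd_primorial_iff).2 (not_lt.1 hle)
          have h5 := Nat.dvd_gcd (Nat.minFac_dvd n) h4
          rw [hg] at h5
          exact hp.one_lt.ne' (Nat.dvd_one.1 h5)
        refine ⟨?_, h3.trans_le (Nat.minFac_le (Nat.pos_of_ne_zero hn))⟩
        by_contra hnp
        have h4 := Nat.minFac_sq_le_self (Nat.pos_of_ne_zero hn) hnp
        have h5 : n.minFac ≤ Nat.sqrt T := Nat.le_sqrt'.2 (h4.trans hnT)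
        omega
      · rintro ⟨hp, hlt⟩
        exact (hp.coprime_iff_not_dvd).2 fun h => by
          have := (hp.dvd_primorial_iff).1 h
          omega
    simp only [this]

theorem norm_moebius_le_one (n : ℕ) : ‖(μ n : ℂ)‖ ≤ 1 := by
  rw [Complex.norm_intCast]
  exact_mod_cast ArithmeticFunction.abs_moebius_le_one

theorem norm_sum_le_card_mul {ι : Type*} (s : Finset ι) (f : ι → ℂ) {A : ℝ}
    (h : ∀ i ∈ s, ‖f i‖ ≤ A) : ‖∑ i ∈ s, f i‖ ≤ #s * A :=
  (norm_sum_le _ _).trans ((sum_le_card_nsmul _ _ _ h).trans_eq (nsmul_eq_mul _ _))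

/-! ### Sums over Gaussian integers of prime norm -/

namespace GaussSum

theorem isCoprime_of_jacobiKubota_mul_ne_zero {w v : GaussianInt} (hw : IsPrimary w)
    (hv : IsPrimary v) (h : jacobiKubota (w * v) ≠ 0) : IsCoprime v.re v.im := by
  rw [mul_comm] at h
  exact (isOddPrimitive_of_jacobiKubota_mul_ne_zero hv hw h).2.2

theorem norm_twist_le_one {d : ℕ} (hd : 1 ≤ d) (χ : MulChar (ResidueRing d) ℂ) (k : ℤ)
    (w : GaussianInt) {v : GaussianInt} (hv : v ≠ 0) :
    ‖jacobiKubota (w * v) * grossencharacter χ k v‖ ≤ 1 := by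
  rw [norm_mul]
  exact mul_le_one₀ (norm_jacobiKubota_le_one _) (norm_nonneg _)
    (norm_grossencharacter_le_one hd χ k hv)

theorem card_primaryBall_le (X : ℕ) : #(primaryBall X) ≤ 9 * X := by
  rcases Nat.eq_zero_or_pos X with rfl | hX
  · rw [Nat.mul_zero, Nat.le_zero, card_eq_zero, eq_empty_iff_forall_notMem]
    intro z hz
    rw [mem_primaryBall] at hz
    exact hz.2.ne_zero (nrm_eq_zero.1 (by omega))
  · exact (card_filter_le _ _).trans (card_ball_le X hX)

/-- Detecting primes by the sieve of Eratosthenes–Legendre. -/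
theorem norm_sum_prime_sub_le {d : ℕ} (hd : 1 ≤ d) (χ : MulChar (ResidueRing d) ℂ) (k : ℤ)
    {w : GaussianInt} (hw : IsPrimary w) (T : ℕ) :
    ‖∑ v ∈ primaryBall T with (nrm v).Prime, jacobiKubota (w * v) * grossencharacter χ k v -
      ∑ u ∈ primaryBall T, ∑ v ∈ primaryBall T, (if nrm u * nrm v ≤ T then
        jacobiKubota (w * (u * v)) * grossencharacter χ k (u * v) *
          (if nrm u ∣ primorial (Nat.sqrt T) then (μ (nrm u) : ℂ) else 0) else 0)‖ ≤
      9 * Nat.sqrt T := by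
  have h1 := sum_mul_sum_divisorsAntidiagonal_nrm
    (h := fun v => jacobiKubota (w * v) * grossencharacter χ k v)
    (fun v hv h0 => isCoprime_of_jacobiKubota_mul_ne_zero hw hv (left_ne_zero_of_mul h0)) T
    (fun e _ => if e ∣ primorial (Nat.sqrt T) then (μ e : ℂ) else 0)
  rw [← h1, sum_filter, ← sum_sub_distrib]
  have h2 : ∑ v ∈ primaryBall T, ((if (nrm v).Prime then
      jacobiKubota (w * v) * grossencharacter χ k v else 0) -
      jacobiKubota (w * v) * grossencharacter χ k v *
        ∑ p ∈ (nrm v).divisorsAntidiagonal,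
          if p.1 ∣ primorial (Nat.sqrt T) then (μ p.1 : ℂ) else 0) =
      ∑ v ∈ primaryBall (Nat.sqrt T), jacobiKubota (w * v) * grossencharacter χ k v *
        ((if (nrm v).Prime then 1 else 0) - (if nrm v = 1 then 1 else 0)) := by
    symm
    refine sum_subset_zero_on_sdiff ?_ ?_ ?_
    · intro v hv
      rw [mem_primaryBall] at hv ⊢
      exact ⟨hv.1.trans (Nat.sqrt_le_self T), hv.2⟩
    · intro v hv
      rw [mem_sdiff, mem_primaryBall, mem_primaryBall] at hv
      obtain ⟨⟨h3, h4⟩, h5⟩ := hv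
      have h6 : Nat.sqrt T < nrm v := by
        by_contra h; exact h5 ⟨not_lt.1 h, h4⟩
      have hn0 := (nrm_pos.2 h4.ne_zero).ne'
      have hn1 : nrm v ≠ 1 := by
        have : 1 ≤ Nat.sqrt T := Nat.le_sqrt'.2 (by have := nrm_pos.2 h4.ne_zero; omega)
        omega
      rw [Nat.sum_divisorsAntidiagonal
        (f := fun e _ => if e ∣ primorial (Nat.sqrt T) then (μ e : ℂ) else 0),
        sum_moebius_dvd_primorial hn0 h3, if_neg hn1]
      by_cases hp : (nrm v).Prime
      · simp [hp, h6]
      · simp [hp]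
    · intro v hv
      rw [mem_primaryBall] at hv
      have hn0 := (nrm_pos.2 hv.2.ne_zero).ne'
      rw [Nat.sum_divisorsAntidiagonal
        (f := fun e _ => if e ∣ primorial (Nat.sqrt T) then (μ e : ℂ) else 0),
        sum_moebius_dvd_primorial hn0 (hv.1.trans (Nat.sqrt_le_self T))]
      have h7 : ¬ Nat.sqrt T < nrm v := not_lt.2 hv.1
      simp only [h7, and_false, if_false, add_zero]
      split_ifs <;> ring
  rw [h2]
  refine (norm_sum_le_card_mul _ _ (A := 1) fun v hv => ?_).trans ?_
  · rw [mem_primaryBall] at hv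
    rw [norm_mul]
    refine mul_le_one₀ (norm_twist_le_one hd χ k w hv.2.ne_zero) (norm_nonneg _) ?_
    by_cases h1 : nrm v = 1
    · simp [h1, Nat.not_prime_one]
    · split_ifs <;> simp
  · rw [mul_one]; exact_mod_cast card_primaryBall_le _

/-- The part of the sieve with small divisors. -/
theorem exists_norm_sum_small_divisor_le : ∃ C : ℝ, 0 < C ∧ ∀ (w : GaussianInt) (d : ℕ)
    (χ : MulChar (ResidueRing d) ℂ) (k : ℤ) (T : ℕ) (Z Y : ℝ) (g : ℕ → ℂ), IsPrimary w → 1 ≤ d →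
    1 ≤ Z → 1 ≤ Y → (nrm w * T : ℝ) ≤ Z → (∀ n, ‖g n‖ ≤ 1) →
    ‖∑ u ∈ primaryBall T, ∑ v ∈ primaryBall T, (if nrm u * nrm v ≤ T then
        jacobiKubota (w * (u * v)) * grossencharacter χ k (u * v) *
          (if (nrm u : ℝ) ≤ Y then g (nrm u) else 0) else 0)‖ ≤
      C * (d * nrm w) * (|(k : ℝ)| + 1) * (Y ^ 2 * Z ^ (49 / 50 : ℝ)) := by
  obtain ⟨C, hC, hI⟩ := exists_norm_sum_jacobiKubota_mul_le
  refine ⟨9 * C, by positivity, ?_⟩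
  intro w d χ k T Z Y g hw hd hZ hY hTZ hg
  have hterm : ∀ u ∈ primaryBall T, ‖∑ v ∈ primaryBall T, (if nrm u * nrm v ≤ T then
        jacobiKubota (w * (u * v)) * grossencharacter χ k (u * v) *
          (if (nrm u : ℝ) ≤ Y then g (nrm u) else 0) else 0)‖ ≤
      if (nrm u : ℝ) ≤ Y then C * (d * nrm w) * (|(k : ℝ)| + 1) * (Y * Z ^ (49 / 50 : ℝ)) else 0 := by
    intro u hu
    rw [mem_primaryBall] at hu
    split_ifs with huY
    swap
    · simp
    have hu0 : 0 < nrm u := nrm_pos.2 hu.2.ne_zero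
    have e : ∑ v ∈ primaryBall T, (if nrm u * nrm v ≤ T then
        jacobiKubota (w * (u * v)) * grossencharacter χ k (u * v) * g (nrm u) else 0) =
        g (nrm u) * grossencharacter χ k u * ∑ v ∈ ball (T / nrm u) with IsPrimary v,
          jacobiKubota (w * u * v) * grossencharacter χ k v := by
      rw [← sum_filter, mul_sum]
      refine sum_congr ?_ fun v _ => ?_
      · ext v
        rw [mem_filter, mem_primaryBall, mem_filter, mem_ball, Nat.le_div_iff_mul_le hu0,
          mul_comm (nrm v)]
        constructor
        · rintro ⟨⟨_, h2⟩, h3⟩; exact ⟨h3, h2⟩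
        · rintro ⟨h2, h3⟩; exact ⟨⟨(Nat.le_mul_of_pos_left _ hu0).trans h2, h3⟩, h2⟩
      · rw [grossencharacter_mul, ← mul_assoc w]; ring
    rw [e, norm_mul, norm_mul]
    have hfl : 1 ≤ ⌊Z⌋₊ := Nat.one_le_floor_iff _ |>.2 hZ
    -- For fixed `u` the sum over `v` is a linear sum along the multiples of `wu`. The factor `nrm u
    -- ≤ Y` in its bound and the `O(Y)` values of `u` give `Y²`.
    have h1 := hI (w * u) d χ k (T / nrm u) ⌊Z⌋₊ (hw.mul hu.2) hd hfl (by
      rw [nrm_mul, mul_assoc]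
      refine (Nat.mul_le_mul_left _ (Nat.mul_div_le _ _)).trans (Nat.le_floor ?_)
      push_cast; exact hTZ)
    have h2 : (⌊Z⌋₊ : ℝ) ^ (49 / 50 : ℝ) ≤ Z ^ (49 / 50 : ℝ) :=
      Real.rpow_le_rpow (by positivity) (Nat.floor_le (by linarith)) (by norm_num)
    calc ‖g (nrm u)‖ * ‖grossencharacter χ k u‖ * ‖∑ v ∈ ball (T / nrm u) with IsPrimary v,
          jacobiKubota (w * u * v) * grossencharacter χ k v‖
        ≤ 1 * 1 * (C * (d * nrm (w * u)) * (|(k : ℝ)| + 1) * (⌊Z⌋₊ : ℝ) ^ (49 / 50 : ℝ)) := by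
          gcongr
          · exact hg _
          · exact norm_grossencharacter_le_one hd χ k hu.2.ne_zero
      _ ≤ 1 * 1 * (C * (d * (nrm w * Y)) * (|(k : ℝ)| + 1) * Z ^ (49 / 50 : ℝ)) := by
          rw [nrm_mul]; push_cast; gcongr
      _ = _ := by ring
  refine (norm_sum_le _ _).trans ((sum_le_sum hterm).trans ?_)
  rw [← sum_filter, sum_const, nsmul_eq_mul]
  have hcard : (#{u ∈ primaryBall T | (nrm u : ℝ) ≤ Y} : ℝ) ≤ 9 * Y := by
    have h1 : #{u ∈ primaryBall T | (nrm u : ℝ) ≤ Y} ≤ #(primaryBall ⌊Y⌋₊) := by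
      refine card_le_card fun u hu => ?_
      rw [mem_filter, mem_primaryBall] at hu
      rw [mem_primaryBall]
      exact ⟨Nat.le_floor hu.2, hu.1.2⟩
    have h2 := card_primaryBall_le ⌊Y⌋₊
    have h3 : (#{u ∈ primaryBall T | (nrm u : ℝ) ≤ Y} : ℝ) ≤ 9 * ⌊Y⌋₊ := by exact_mod_cast h1.trans h2
    linarith [Nat.floor_le (show 0 ≤ Y by linarith)]
  calc _ ≤ (9 * Y) * (C * (d * nrm w) * (|(k : ℝ)| + 1) * (Y * Z ^ (49 / 50 : ℝ))) := by gcongr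
    _ = _ := by ring

/-- Pairs with a given product are at most as many as the divisors of the product. -/
theorem exists_card_factorizations_le (ε : ℝ) (hε : 0 < ε) :
    ∃ C : ℝ, 1 ≤ C ∧ ∀ (Z : ℝ) (s : Finset (GaussianInt × GaussianInt)) (y : GaussianInt), 1 ≤ Z →
      (∀ x ∈ s, IsPrimary x.1 ∧ IsPrimary x.2 ∧ (nrm x.1 : ℝ) ≤ Z ∧ (nrm x.2 : ℝ) ≤ Z) →
      (∀ x ∈ s, x.1 * x.2 = y) → (#s : ℝ) ≤ C * Z ^ ε := by
  classical
  obtain ⟨C, hC, h⟩ := exists_card_divisors_le (ε / 2) (by positivity)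
  refine ⟨C, hC, fun Z s y hZ hs hsy => ?_⟩
  rcases s.eq_empty_or_nonempty with rfl | ⟨x₀, hx₀⟩
  · simp; positivity
  have hy0 : y ≠ 0 := by
    rw [← hsy x₀ hx₀]; exact ((hs x₀ hx₀).1.mul (hs x₀ hx₀).2.1).ne_zero
  have hy : (nrm y : ℝ) ≤ Z ^ 2 := by
    rw [← hsy x₀ hx₀, nrm_mul, sq]; push_cast
    have := hs x₀ hx₀
    gcongr
    · exact this.2.2.1
    · exact this.2.2.2
  have h1 := h y hy0 (s.image Prod.fst) (by
    intro w hw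
    obtain ⟨x, hx, rfl⟩ := mem_image.1 hw
    exact ⟨x.2, (hsy x hx).symm⟩)
  rw [card_image_of_injOn] at h1
  · refine h1.trans ?_
    gcongr
    calc (nrm y : ℝ) ^ (ε / 2) ≤ (Z ^ 2) ^ (ε / 2) := by gcongr
      _ = Z ^ ε := by
        rw [← Real.rpow_natCast, ← Real.rpow_mul (by linarith)]; congr 1; push_cast; ring
  · intro x hx x' hx' hxx
    refine Prod.ext hxx ?_
    have h2 := hsy x hx
    rw [← hsy x' hx', ← hxx] at h2
    exact mul_left_cancel₀ (hs x hx).1.ne_zero h2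

end GaussSum

namespace GaussSum

theorem greatestPrimeFactor_le_of_dvd_primorial {a n : ℕ} (h : a ∣ primorial n) :
    greatestPrimeFactor a ≤ n :=
  Finset.sup_le fun _ hp => (Nat.prime_of_mem_primeFactors hp).dvd_primorial_iff.1
    ((Nat.dvd_of_mem_primeFactors hp).trans h)

/-- The part of the sieve with large divisors. -/
theorem exists_norm_sum_large_divisor_le : ∃ δ C : ℝ, 0 < δ ∧ 0 < C ∧ ∀ (w : GaussianInt) (d : ℕ)
    (χ : MulChar (ResidueRing d) ℂ) (k : ℤ) (T : ℕ) (Z : ℝ), IsPrimary w → 1 ≤ d →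
    1 ≤ Z → (nrm w : ℝ) ≤ Z ^ (1 / 10 : ℝ) → (nrm w * T : ℝ) ≤ Z →
    ‖∑ u ∈ primaryBall T, ∑ v ∈ primaryBall T, (if nrm u * nrm v ≤ T then
        jacobiKubota (w * (u * v)) * grossencharacter χ k (u * v) *
          (if nrm u ∣ primorial (Nat.sqrt T) ∧ Z ^ (1 / 400 : ℝ) < nrm u then
            (μ (nrm u) : ℂ) else 0) else 0)‖ ≤
      C * Z ^ (1 - δ) := by
  classical
  obtain ⟨δ, C, hδ, hC, hII⟩ := exists_bilinBound_jacobiKubota (1 / 400) (by norm_num) (by norm_num)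
  obtain ⟨C', hC', hdiv⟩ := exists_card_factorizations_le (δ / 14) (by positivity)
  refine ⟨δ / 2, C * C' ^ 7, by positivity, by positivity, ?_⟩
  intro w d χ k T Z hw hd hZ hwZ hTZ
  have hZ0 : 0 < Z := by linarith
  set M := primorial (Nat.sqrt T) with hM
  set Y := Z ^ (1 / 400 : ℝ) with hY
  have hY1 : 1 ≤ Y := Real.one_le_rpow hZ (by norm_num)
  have hw1 : 1 ≤ nrm w := nrm_pos.2 hw.ne_zero
  have hw1' : (1 : ℝ) ≤ nrm w := by exact_mod_cast hw1
  have hT : (T : ℝ) ≤ Z := by nlinarith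
  -- The Möbius function of the large sieving divisor is written through its unique prefix split,
  -- with coefficients that depend on `a` and on `b` alone.
  set G : ℕ → ℕ → ℂ := fun a b => if IsPrefixSplit Y a b then
        (if a ∣ M then (μ a : ℂ) else 0) * (if b ∣ M then (μ b : ℂ) else 0) else 0 with hG
  set H : GaussianInt → ℂ := fun z => jacobiKubota (w * z) * grossencharacter χ k z with hH
  have hstep : ∀ v ∈ primaryBall T, ∑ u ∈ primaryBall T, (if nrm u * nrm v ≤ T then
        H (u * v) * (if nrm u ∣ M ∧ Y < nrm u then (μ (nrm u) : ℂ) else 0) else 0) =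
      ∑ u₁ ∈ primaryBall T, ∑ u₂ ∈ primaryBall T,
        (if nrm u₁ * nrm u₂ * nrm v ≤ T then H (u₁ * u₂ * v) * G (nrm u₁) (nrm u₂) else 0) := by
    intro v hv
    rw [mem_primaryBall] at hv
    have hv0 : 0 < nrm v := nrm_pos.2 hv.2.ne_zero
    have h1 := sum_mul_sum_divisorsAntidiagonal_nrm
      (h := fun u => if nrm u * nrm v ≤ T then H (u * v) else 0)
      (fun u hu h0 => by
        have h2 : H (u * v) ≠ 0 := fun h => h0 (by simp [h])
        have h3 := isCoprime_of_jacobiKubota_mul_ne_zero hw (hu.mul hv.2) (left_ne_zero_of_mul h2)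
        exact isCoprime_of_mul h3) T G
    refine Eq.trans (sum_congr rfl fun u hu => ?_) (h1.trans ?_)
    · rw [mem_primaryBall] at hu
      rw [hG]
      dsimp only
      rw [sum_moebius_isPrefixSplit hY1 (squarefree_primorial _) (nrm_pos.2 hu.2.ne_zero).ne']
      split_ifs <;> simp
    · refine sum_congr rfl fun u₁ _ => sum_congr rfl fun u₂ _ => ?_
      rw [nrm_mul]
      by_cases h2 : nrm u₁ * nrm u₂ * nrm v ≤ T
      · rw [if_pos ((Nat.le_mul_of_pos_right _ hv0).trans h2), if_pos h2, if_pos h2]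
      · rw [if_neg h2, if_neg h2]; simp
  have hswap : ∑ u ∈ primaryBall T, ∑ v ∈ primaryBall T, (if nrm u * nrm v ≤ T then
        jacobiKubota (w * (u * v)) * grossencharacter χ k (u * v) *
          (if nrm u ∣ M ∧ Y < nrm u then (μ (nrm u) : ℂ) else 0) else 0) =
      ∑ u₁ ∈ primaryBall T, ∑ j ∈ primaryBall T ×ˢ primaryBall T,
        (if nrm u₁ * nrm j.1 * nrm j.2 ≤ T then
          H (u₁ * j.1 * j.2) * G (nrm u₁) (nrm j.1) else 0) := by
    rw [sum_comm, sum_congr rfl hstep, sum_comm]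
    refine sum_congr rfl fun u₁ _ => ?_
    rw [sum_product, sum_comm]
  rw [hswap]
  set I := {u ∈ primaryBall T | (Y < nrm u ∧ (nrm u : ℝ) ≤ Y * greatestPrimeFactor (nrm u)) ∧
    nrm u ∣ M} with hI
  set J := primaryBall T ×ˢ primaryBall T with hJ
  have hJp : ∀ j ∈ J, (IsPrimary j.1 ∧ nrm j.1 ≤ T) ∧ (IsPrimary j.2 ∧ nrm j.2 ≤ T) := by
    intro j hj
    rw [hJ, mem_product, mem_primaryBall, mem_primaryBall] at hj
    exact ⟨hj.1.symm, hj.2.symm⟩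
  have hIp : ∀ u ∈ I, IsPrimary u ∧ nrm u ≤ T := by
    intro u hu
    rw [hI, mem_filter, mem_primaryBall] at hu
    exact hu.1.symm
  -- The primes of the divisor are at most `√T`, so the prefix satisfies `a ≤ Y √T`, and `nrm w * a`
  -- stays well below `Z`. Thus both variables are long.
  have hsqrt : (nrm w * Nat.sqrt T : ℝ) ≤ Z ^ (11 / 20 : ℝ) := by
    have h1 : (nrm w * Nat.sqrt T : ℝ) ^ 2 ≤ (Z ^ (11 / 20 : ℝ)) ^ 2 := by
      have h2 : ((Nat.sqrt T : ℝ)) ^ 2 ≤ T := by exact_mod_cast Nat.sqrt_le' T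
      calc (nrm w * Nat.sqrt T : ℝ) ^ 2 = (nrm w : ℝ) * ((nrm w : ℝ) * (Nat.sqrt T : ℝ) ^ 2) := by ring
        _ ≤ (nrm w : ℝ) * ((nrm w : ℝ) * (T : ℝ)) := by gcongr
        _ ≤ Z ^ (1 / 10 : ℝ) * Z ^ (1 : ℝ) := by
          rw [Real.rpow_one]
          gcongr
        _ = (Z ^ (11 / 20 : ℝ)) ^ 2 := by
          rw [← Real.rpow_add hZ0, ← Real.rpow_natCast, ← Real.rpow_mul hZ0.le]; norm_num
    exact (pow_le_pow_iff_left₀ (by positivity) (by positivity) two_ne_zero).1 h1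
  -- The strict inequality encodes the prefix condition; the second linking inequality is the
  -- trivial `0 ≤ 0`. The multiplicity `F` counts factorizations of the product `j.1 * j.2`.
  have hbil := hII I J (fun u => w * u) (fun j => j.1 * j.2)
    (fun u => greatestPrimeFactor (nrm u)) (fun _ => 0)
    (fun j => leastPrimeFactor (T + 1) (nrm j.1)) (fun _ => 0) Z (nrm w * T) (C' * Z ^ (δ / 14))
    hZ hTZ (one_le_mul_of_one_le_of_one_le hC' (Real.one_le_rpow hZ (by positivity)))
    (by
      intro u hu
      refine ⟨hw.mul (hIp u hu).1, ?_, ?_⟩ <;> rw [nrm_mul] <;> push_cast <;>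
        rw [hI, mem_filter] at hu
      · nlinarith [hu.2.1.1]
      · have h1 : (greatestPrimeFactor (nrm u) : ℝ) ≤ Nat.sqrt T := by
          exact_mod_cast greatestPrimeFactor_le_of_dvd_primorial hu.2.2
        calc (nrm w * nrm u : ℝ) ≤ nrm w * (Y * Nat.sqrt T) := by
              gcongr; exact hu.2.1.2.trans (by gcongr)
          _ = Y * (nrm w * Nat.sqrt T) := by ring
          _ ≤ Y * Z ^ (11 / 20 : ℝ) := by gcongr
          _ = Z ^ (1 / 400 + 11 / 20 : ℝ) := by rw [hY, ← Real.rpow_add hZ0]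
          _ ≤ _ := Real.rpow_le_rpow_of_exponent_le hZ (by norm_num))
    (fun j hj => (hJp j hj).1.1.mul (hJp j hj).2.1)
    (by
      intro y s _ hs
      have : #s ≤ 1 := card_le_one.2 fun a ha b hb =>
        mul_left_cancel₀ hw.ne_zero ((hs a ha).trans (hs b hb).symm)
      calc (#s : ℝ) ≤ 1 := by exact_mod_cast this
        _ ≤ _ := one_le_mul_of_one_le_of_one_le hC' (Real.one_le_rpow hZ (by positivity)))
    (by
      intro y s hsJ hs
      refine hdiv Z s y hZ (fun x hx => ?_) hs
      have := hJp x (hsJ hx)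
      refine ⟨this.1.1, this.2.1, le_trans ?_ hT, le_trans ?_ hT⟩
      · exact_mod_cast this.1.2
      · exact_mod_cast this.2.2)
  have happ := hbil.apply_of_bounds (A := 1) (B := 1) zero_le_one zero_le_one
    (α := fun u => (μ (nrm u) : ℂ) * grossencharacter χ k u)
    (β := fun j => (if nrm j.1 ∣ M then (μ (nrm j.1) : ℂ) else 0) *
      (grossencharacter χ k j.1 * grossencharacter χ k j.2))
    (fun u hu => by
      rw [norm_mul]
      exact mul_le_one₀ (norm_moebius_le_one _) (norm_nonneg _)
        (norm_grossencharacter_le_one hd χ k (hIp u hu).1.ne_zero))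
    (fun j hj => by
      rw [norm_mul, norm_mul]
      refine mul_le_one₀ ?_ (by positivity) (mul_le_one₀
        (norm_grossencharacter_le_one hd χ k (hJp j hj).1.1.ne_zero) (norm_nonneg _)
        (norm_grossencharacter_le_one hd χ k (hJp j hj).2.1.ne_zero))
      split_ifs
      · exact norm_moebius_le_one _
      · simp)
  rw [one_mul, one_mul] at happ
  refine le_of_eq_of_le (congrArg _ ?_) (happ.trans_eq ?_)
  · rw [hI, sum_filter]
    refine sum_congr rfl fun u hu => ?_
    rw [mem_primaryBall] at hu
    by_cases hc : (Y < nrm u ∧ (nrm u : ℝ) ≤ Y * greatestPrimeFactor (nrm u)) ∧ nrm u ∣ M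
    · rw [if_pos hc]
      refine sum_congr rfl fun j hj => ?_
      have hj' := hJp j hj
      have hb0 : nrm j.1 ≠ 0 := (nrm_pos.2 hj'.1.1.ne_zero).ne'
      have hlt := lt_leastPrimeFactor_iff (B := T + 1) (a := nrm u) (b := nrm j.1)
        (Nat.lt_succ_of_le (greatestPrimeFactor_le.trans hu.1)) hb0
      have hsplit : IsPrefixSplit Y (nrm u) (nrm j.1) ↔
          (greatestPrimeFactor (nrm u) : ℝ) < (leastPrimeFactor (T + 1) (nrm j.1) : ℝ) := by
        rw [Nat.cast_lt, hlt, IsPrefixSplit]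
        exact and_iff_right hc.1
      have hcut : (nrm (w * u) * nrm (j.1 * j.2) : ℝ) ≤ nrm w * T ↔
          nrm u * nrm j.1 * nrm j.2 ≤ T := by
        rw [nrm_mul, nrm_mul]
        push_cast
        rw [mul_assoc, mul_le_mul_iff_right₀ (by linarith), ← mul_assoc]
        norm_cast
      simp only [hG, hH, hsplit, hcut, hc.2, if_true, le_refl]
      split_ifs
      · rw [grossencharacter_mul, grossencharacter_mul, mul_assoc u j.1 j.2, ← mul_assoc w u]
        ring
      all_goals simp
    · rw [if_neg hc]
      refine sum_eq_zero fun j _ => ?_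
      have : G (nrm u) (nrm j.1) = 0 := by
        simp only [hG]
        by_cases h1 : IsPrefixSplit Y (nrm u) (nrm j.1)
        · have : ¬ nrm u ∣ M := fun h => hc ⟨h1.1, h⟩
          simp [this]
        · simp [h1]
      simp [this]
  · rw [mul_pow, ← Real.rpow_natCast (Z ^ (δ / 14)), ← Real.rpow_mul hZ0.le, ← mul_assoc, mul_assoc,
      ← Real.rpow_add hZ0]
    congr 2
    push_cast; ring

/-- Sums of the Jacobi–Kubota symbol over Gaussian primes of degree one. -/
theorem exists_norm_sum_prime_le : ∃ δ C : ℝ, 0 < δ ∧ 0 < C ∧ ∀ (w : GaussianInt) (d : ℕ)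
    (χ : MulChar (ResidueRing d) ℂ) (k : ℤ) (T : ℕ) (Z : ℝ), IsPrimary w → 1 ≤ d →
    1 ≤ Z → (nrm w : ℝ) ≤ Z ^ (1 / 10 : ℝ) → (nrm w * T : ℝ) ≤ Z →
    ‖∑ v ∈ primaryBall T with (nrm v).Prime, jacobiKubota (w * v) * grossencharacter χ k v‖ ≤
      C * (d * nrm w) * (|(k : ℝ)| + 1) * Z ^ (1 - δ) := by
  obtain ⟨C₁, hC₁, h1⟩ := exists_norm_sum_small_divisor_le
  obtain ⟨δ, C₂, hδ, hC₂, h2⟩ := exists_norm_sum_large_divisor_le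
  -- The small divisors give the exponent `2/400 + 49/50 = 1 - 3/200`, below `1 - 1/100`.
  refine ⟨min δ (1 / 100), 9 + C₁ + C₂, by positivity, by positivity, ?_⟩
  intro w d χ k T Z hw hd hZ hwZ hTZ
  have hZ0 : 0 < Z := by linarith
  have hw1' : (1 : ℝ) ≤ nrm w := by exact_mod_cast nrm_pos.2 hw.ne_zero
  have hT : (T : ℝ) ≤ Z := by nlinarith
  have h3 := norm_sum_prime_sub_le hd χ k hw T
  have h4 := h1 w d χ k T Z (Z ^ (1 / 400 : ℝ))
    (fun n => if n ∣ primorial (Nat.sqrt T) then (μ n : ℂ) else 0) hw hd hZ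
    (Real.one_le_rpow hZ (by norm_num)) hTZ
    (fun n => by split_ifs; exacts [norm_moebius_le_one _, by simp])
  have h5 := h2 w d χ k T Z hw hd hZ hwZ hTZ
  have hs : (Nat.sqrt T : ℝ) ≤ Z ^ (1 - min δ (1 / 100)) := by
    have h6 : (Nat.sqrt T : ℝ) ≤ Real.sqrt T := Real.le_sqrt_of_sq_le (by exact_mod_cast Nat.sqrt_le' T)
    calc (Nat.sqrt T : ℝ) ≤ Real.sqrt Z := h6.trans (Real.sqrt_le_sqrt hT)
      _ = Z ^ (1 / 2 : ℝ) := Real.sqrt_eq_rpow _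
      _ ≤ _ := Real.rpow_le_rpow_of_exponent_le hZ (by linarith [min_le_right δ (1 / 100)])
  have e4 : (Z ^ (1 / 400 : ℝ)) ^ 2 * Z ^ (49 / 50 : ℝ) ≤ Z ^ (1 - min δ (1 / 100)) := by
    rw [← Real.rpow_natCast, ← Real.rpow_mul hZ0.le, ← Real.rpow_add hZ0]
    exact Real.rpow_le_rpow_of_exponent_le hZ (by push_cast; linarith [min_le_right δ (1 / 100)])
  have e5 : Z ^ (1 - δ) ≤ Z ^ (1 - min δ (1 / 100)) :=
    Real.rpow_le_rpow_of_exponent_le hZ (by linarith [min_le_left δ (1 / 100)])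
  have hd' : (1 : ℝ) ≤ d := by exact_mod_cast hd
  have hD : (1 : ℝ) ≤ (d * nrm w) * (|(k : ℝ)| + 1) :=
    one_le_mul_of_one_le_of_one_le (one_le_mul_of_one_le_of_one_le hd' hw1')
      (by linarith [abs_nonneg (k : ℝ)])
  set E := Z ^ (1 - min δ (1 / 100)) with hE
  have hE0 : 0 ≤ E := by positivity
  set S := ∑ v ∈ primaryBall T with (nrm v).Prime, jacobiKubota (w * v) * grossencharacter χ k v
  set R := ∑ u ∈ primaryBall T, ∑ v ∈ primaryBall T, (if nrm u * nrm v ≤ T then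
        jacobiKubota (w * (u * v)) * grossencharacter χ k (u * v) *
          (if nrm u ∣ primorial (Nat.sqrt T) then (μ (nrm u) : ℂ) else 0) else 0) with hR
  set D := (d * nrm w) * (|(k : ℝ)| + 1)
  have hRle : ‖R‖ ≤ C₁ * D * E + C₂ * E := by
    have e : R = (∑ u ∈ primaryBall T, ∑ v ∈ primaryBall T, (if nrm u * nrm v ≤ T then
        jacobiKubota (w * (u * v)) * grossencharacter χ k (u * v) *
          (if (nrm u : ℝ) ≤ Z ^ (1 / 400 : ℝ) then
            (fun n => if n ∣ primorial (Nat.sqrt T) then (μ n : ℂ) else 0) (nrm u) else 0) else 0)) +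
        ∑ u ∈ primaryBall T, ∑ v ∈ primaryBall T, (if nrm u * nrm v ≤ T then
        jacobiKubota (w * (u * v)) * grossencharacter χ k (u * v) *
          (if nrm u ∣ primorial (Nat.sqrt T) ∧ Z ^ (1 / 400 : ℝ) < nrm u then
            (μ (nrm u) : ℂ) else 0) else 0) := by
      rw [hR, ← sum_add_distrib]
      refine sum_congr rfl fun u _ => ?_
      rw [← sum_add_distrib]
      refine sum_congr rfl fun v _ => ?_
      by_cases hu : (nrm u : ℝ) ≤ Z ^ (1 / 400 : ℝ)
      · simp only [hu, not_lt.2 hu, if_true, and_false, if_false, mul_zero, ite_self, add_zero]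
      · simp only [hu, not_le.1 hu, if_false, and_true, mul_zero, ite_self, zero_add]
    rw [e]
    refine (norm_add_le _ _).trans (add_le_add (h4.trans ?_) (h5.trans ?_))
    · rw [mul_assoc C₁]; gcongr
    · gcongr
  calc ‖S‖ = ‖(S - R) + R‖ := by rw [sub_add_cancel]
    _ ≤ 9 * Nat.sqrt T + (C₁ * D * E + C₂ * E) := (norm_add_le _ _).trans (add_le_add h3 hRle)
    _ ≤ 9 * (D * E) + (C₁ * D * E + C₂ * (D * E)) := by
      have : E ≤ D * E := le_mul_of_one_le_left hE0 hD
      gcongr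
      exact hs.trans this
    _ = (9 + C₁ + C₂) * (d * nrm w) * (|(k : ℝ)| + 1) * E := by ring

end GaussSum

/-! ### The truncated divisor sum and the decomposition of squarefree norms -/

theorem sum_divisors_mul_of_coprime {β : Type*} [AddCommMonoid β] {a b : ℕ} (hab : Nat.Coprime a b)
    (f : ℕ → β) : ∑ c ∈ (a * b).divisors, f c = ∑ c₁ ∈ a.divisors, ∑ c₂ ∈ b.divisors, f (c₁ * c₂) := by
  rw [← sum_product', Nat.divisors_mul, ← Finset.image_mul_product, sum_image]
  rintro ⟨x, y⟩ h ⟨x', y'⟩ h' e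
  rw [mem_coe, mem_product, Nat.mem_divisors, Nat.mem_divisors] at h h'
  dsimp only at h h' e
  have h1 : Nat.Coprime x y' := Nat.Coprime.of_dvd h.1.1 h'.2.1 hab
  have h2 : Nat.Coprime x' y := Nat.Coprime.of_dvd h'.1.1 h.2.1 hab
  have ex : x = x' := Nat.dvd_antisymm (h1.dvd_of_dvd_mul_right (Dvd.intro _ e))
    (h2.dvd_of_dvd_mul_right (Dvd.intro _ e.symm))
  subst ex
  have hx : 0 < x := Nat.pos_of_dvd_of_pos h.1.1 (Nat.pos_of_ne_zero h.1.2)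
  rw [Nat.eq_of_mul_eq_mul_left hx e]

namespace GaussSum

/-- The truncated divisor sum of the Möbius function, restricted to numbers without prime factor
`≤ P`. -/
noncomputable def sieveWeight (C : ℝ) (P n : ℕ) : ℂ :=
  if Nat.Coprime n (primorial P) then
    (μ n : ℂ) * ∑ c ∈ n.divisors with ((c : ℕ) : ℝ) ≤ C, (μ c : ℂ) else 0

theorem sieveWeight_of_not_squarefree {C : ℝ} {P n : ℕ} (hn : ¬ Squarefree n) :
    sieveWeight C P n = 0 := by
  simp [sieveWeight, ArithmeticFunction.moebius_eq_zero_of_not_squarefree hn]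

/-- Crude, but applied only to norms at most `Y`. -/
theorem norm_sieveWeight_le (C : ℝ) (P n : ℕ) : ‖sieveWeight C P n‖ ≤ n := by
  rw [sieveWeight]
  split_ifs
  · rw [norm_mul]
    have h1 : ‖∑ c ∈ n.divisors with ((c : ℕ) : ℝ) ≤ C, (μ c : ℂ)‖ ≤ n := by
      refine (norm_sum_le_card_mul _ _ (A := 1) fun c _ => norm_moebius_le_one c).trans ?_
      rw [mul_one]
      exact_mod_cast (card_filter_le _ _).trans (Nat.card_divisors_le_self n)
    calc _ ≤ 1 * (n : ℝ) := by
          gcongr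
          exact norm_moebius_le_one n
      _ = n := one_mul _
  · simp

/-- Once divisors `c₁ ∣ a` and `c₂ ∣ b` are attached to the indices, the weight is separated except
for the single inequality `c₁ c₂ ≤ C`. -/
theorem sieveWeight_mul_of_coprime (C : ℝ) (P : ℕ) {a b : ℕ} (hab : Nat.Coprime a b) :
    sieveWeight C P (a * b) = ∑ c₁ ∈ a.divisors, ∑ c₂ ∈ b.divisors,
      ((if Nat.Coprime a (primorial P) then (μ a : ℂ) else 0) * (μ c₁ : ℂ)) *
      ((if Nat.Coprime b (primorial P) then (μ b : ℂ) else 0) * (μ c₂ : ℂ)) *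
      (if (c₁ * c₂ : ℝ) ≤ C then 1 else 0) := by
  have h1 : ∑ c ∈ (a * b).divisors with ((c : ℕ) : ℝ) ≤ C, (μ c : ℂ) =
      ∑ c₁ ∈ a.divisors, ∑ c₂ ∈ b.divisors, (μ c₁ : ℂ) * (μ c₂ : ℂ) *
        (if (c₁ * c₂ : ℝ) ≤ C then 1 else 0) := by
    rw [sum_filter, sum_divisors_mul_of_coprime hab]
    refine sum_congr rfl fun c₁ h₁ => sum_congr rfl fun c₂ h₂ => ?_
    have hc : Nat.Coprime c₁ c₂ :=
      Nat.Coprime.of_dvd (Nat.dvd_of_mem_divisors h₁) (Nat.dvd_of_mem_divisors h₂) hab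
    rw [ArithmeticFunction.isMultiplicative_moebius.map_mul_of_coprime hc]
    push_cast
    split_ifs <;> ring
  rw [sieveWeight, h1, ArithmeticFunction.isMultiplicative_moebius.map_mul_of_coprime hab]
  have hiff := Nat.coprime_mul_iff_left (m := a) (n := b) (k := primorial P)
  by_cases ha : Nat.Coprime a (primorial P)
  · by_cases hb : Nat.Coprime b (primorial P)
    · rw [if_pos (hiff.2 ⟨ha, hb⟩), if_pos ha, if_pos hb, mul_sum]
      simp only [mul_sum]
      refine sum_congr rfl fun c₁ _ => sum_congr rfl fun c₂ _ => ?_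
      push_cast; ring
    · rw [if_neg fun h => hb (hiff.1 h).2, if_neg hb]; simp
  · rw [if_neg fun h => ha (hiff.1 h).1, if_neg ha]; simp

/-- Because `q > C`, the divisors of `mq` up to `C` are those of `m`. Only `μ(q) = -1` and the
condition that `q` escapes the sieve remain. -/
theorem sieveWeight_mul_prime {C : ℝ} {P m q : ℕ} (hq : q.Prime) (hqm : ¬ q ∣ m) (hqC : C < q) :
    sieveWeight C P (m * q) = if P < q then -sieveWeight C P m else 0 := by
  have hco : Nat.Coprime m q := ((hq.coprime_iff_not_dvd).2 hqm).symm
  have hm0 : m ≠ 0 := by rintro rfl; simp at hqm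
  have h1 : {c ∈ (m * q).divisors | ((c : ℕ) : ℝ) ≤ C} = {c ∈ m.divisors | ((c : ℕ) : ℝ) ≤ C} := by
    ext c
    rw [mem_filter, mem_filter, Nat.mem_divisors, Nat.mem_divisors]
    constructor
    · rintro ⟨⟨h1, _⟩, h2⟩
      refine ⟨⟨?_, hm0⟩, h2⟩
      refine Nat.Coprime.dvd_of_dvd_mul_right (Nat.Coprime.symm ((hq.coprime_iff_not_dvd).2 ?_)) h1
      intro h3
      have h4 : q ≤ c := Nat.le_of_dvd (Nat.pos_of_dvd_of_pos h1
        (Nat.mul_pos (Nat.pos_of_ne_zero hm0) hq.pos)) h3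
      have h5 : (q : ℝ) ≤ c := by exact_mod_cast h4
      linarith
    · rintro ⟨⟨h1, _⟩, h2⟩
      exact ⟨⟨h1.mul_right _, mul_ne_zero hm0 hq.ne_zero⟩, h2⟩
  have h2 : Nat.Coprime q (primorial P) ↔ P < q := by
    rw [hq.coprime_iff_not_dvd, hq.dvd_primorial_iff, not_le]
  have hiff := Nat.coprime_mul_iff_left (m := m) (n := q) (k := primorial P)
  rw [h2] at hiff
  rw [sieveWeight, sieveWeight, h1,
    ArithmeticFunction.isMultiplicative_moebius.map_mul_of_coprime hco,
    ArithmeticFunction.moebius_apply_prime hq]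
  by_cases h3 : P < q
  · by_cases h4 : Nat.Coprime m (primorial P)
    · rw [if_pos (hiff.2 ⟨h4, h3⟩), if_pos h3, if_pos h4]; push_cast; ring
    · rw [if_neg fun h => h4 (hiff.1 h).1, if_neg h4]; simp
  · rw [if_neg fun h => h3 (hiff.1 h).2, if_neg h3]

end GaussSum

theorem sum_ite_eq_ite_exists {ι : Type*} (s : Finset ι) (p : ι → Prop) [DecidablePred p]
    [Decidable (∃ i ∈ s, p i)] (h : ∀ i ∈ s, ∀ j ∈ s, p i → p j → i = j) :
    ∑ i ∈ s, (if p i then 1 else 0 : ℂ) = if ∃ i ∈ s, p i then 1 else 0 := by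
  classical
  split_ifs with hex
  · obtain ⟨i, hi, hp⟩ := hex
    rw [sum_eq_single_of_mem i hi, if_pos hp]
    intro j hj hne
    rw [if_neg fun hpj => hne (h j hj i hi hpj hp)]
  · exact sum_eq_zero fun i hi => if_neg fun hp => hex ⟨i, hi, hp⟩

open Classical in
/-- A squarefree number at most `Z` is at most `Y`, or has a prefix of size between `Y` and `W`,
or is a large prime times a cofactor at most `Y`. -/
theorem one_eq_sum_prefix_add_sum_prime {Y W Z : ℝ} (hY : 1 ≤ Y) (hYW : Y * Y ≤ W)
    (hWZ : Y * Z ≤ W * W) {n : ℕ} (hn : Squarefree n) (hnZ : (n : ℝ) ≤ Z) :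
    (1 : ℂ) = (if (n : ℝ) ≤ Y then 1 else 0) +
      ∑ p ∈ n.divisorsAntidiagonal, (if IsPrefixSplit Y p.1 p.2 ∧ (p.1 : ℝ) ≤ W then 1 else 0) +
      ∑ p ∈ n.divisorsAntidiagonal,
        (if p.2.Prime ∧ (p.1 : ℝ) ≤ Y ∧ W < (p.1 * p.2 : ℝ) then 1 else 0) := by
  have hY0 : 0 < Y := by linarith
  have hn0 : n ≠ 0 := hn.ne_zero
  have hn1 : 0 < n := Nat.pos_of_ne_zero hn0
  have hsum := sum_isPrefixSplit hY hn
  have hsplit : ∑ p ∈ n.divisorsAntidiagonal, (if IsPrefixSplit Y p.1 p.2 then 1 else 0 : ℂ) =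
      ∑ p ∈ n.divisorsAntidiagonal, (if IsPrefixSplit Y p.1 p.2 ∧ (p.1 : ℝ) ≤ W then 1 else 0 : ℂ) +
      ∑ p ∈ n.divisorsAntidiagonal, (if IsPrefixSplit Y p.1 p.2 ∧ W < (p.1 : ℝ) then 1 else 0 : ℂ) := by
    rw [← sum_add_distrib]
    refine sum_congr rfl fun p _ => ?_
    by_cases h1 : IsPrefixSplit Y p.1 p.2
    · by_cases h2 : (p.1 : ℝ) ≤ W
      · simp [h1, h2, not_lt.2 h2]
      · simp [h1, h2, not_le.1 h2]
    · simp [h1]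
  have hprime : ∀ m q : ℕ, q.Prime → (m : ℝ) ≤ Y → W < (m * q : ℝ) → Y < q := by
    intro m q hq h1 h2
    by_contra h3
    push Not at h3
    have : (m * q : ℝ) ≤ Y * Y := by gcongr
    linarith
  -- Both sums have at most one nonzero term, so it suffices that one is nonempty exactly when the
  -- other is.
  have hkey : ∑ p ∈ n.divisorsAntidiagonal, (if IsPrefixSplit Y p.1 p.2 ∧ W < (p.1 : ℝ) then 1 else 0 : ℂ)
      = ∑ p ∈ n.divisorsAntidiagonal,
        (if p.2.Prime ∧ (p.1 : ℝ) ≤ Y ∧ W < (p.1 * p.2 : ℝ) then 1 else 0 : ℂ) := by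
    rw [sum_ite_eq_ite_exists, sum_ite_eq_ite_exists]
    · refine if_congr ⟨?_, ?_⟩ rfl rfl
      · rintro ⟨⟨a, b⟩, hp, h1, h2⟩
        have hab := (Nat.mem_divisorsAntidiagonal.1 hp).1
        dsimp only at hab h1 h2
        have hb0 : b ≠ 0 := right_ne_zero_of_mul (hab ▸ hn0)
        have haW : 0 < (a : ℝ) := by nlinarith
        have hga : W < Y * greatestPrimeFactor a := h2.trans_le h1.1.2
        -- If `b ≠ 1`, then `b > P(a) > W/Y`, and `n = ab > W²/Y ≥ Z`, a contradiction. So `n = a`,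
        -- and its greatest prime leaves a cofactor at most `Y`.
        have hb : b = 1 := by
          by_contra hb1
          have h3 := h1.2 b.minFac (Nat.mem_primeFactors.2 ⟨Nat.minFac_prime hb1, Nat.minFac_dvd b, hb0⟩)
          have h4 : b.minFac ≤ b := Nat.minFac_le (Nat.pos_of_ne_zero hb0)
          have h5 : (greatestPrimeFactor a : ℝ) ≤ b := by exact_mod_cast (h3.trans_le h4).le
          have h6 : (a * b : ℝ) ≤ Z := by rw [← hab] at hnZ; exact_mod_cast hnZ
          have h7 : W * W < Y * Z := by
            calc W * W < a * (Y * greatestPrimeFactor a) := by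
                  have : 0 < W := by nlinarith
                  exact mul_lt_mul'' h2 hga this.le this.le
              _ ≤ a * (Y * b) := by gcongr
              _ = Y * (a * b) := by ring
              _ ≤ Y * Z := by gcongr
          linarith
        subst hb
        rw [mul_one] at hab
        subst hab
        have ha2 : 2 ≤ a := by
          have : (1 : ℝ) < a := hY.trans_lt h1.1.1
          exact_mod_cast this
        have hg := greatestPrimeFactor_mem ha2
        obtain ⟨m, hm⟩ := Nat.dvd_of_mem_primeFactors hg
        have hgp := Nat.prime_of_mem_primeFactors hg
        have e : (a : ℝ) = greatestPrimeFactor a * m := by exact_mod_cast hm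
        refine ⟨(m, greatestPrimeFactor a), ?_, hgp, ?_, ?_⟩
        · rw [Nat.mem_divisorsAntidiagonal]; exact ⟨by rw [mul_comm]; exact hm.symm, hn0⟩
        · have h3 := h1.1.2
          have hgpos : (0 : ℝ) < greatestPrimeFactor a := by exact_mod_cast hgp.pos
          rw [e, mul_comm] at h3
          exact le_of_mul_le_mul_right h3 hgpos
        · dsimp only; rw [mul_comm, ← e]; exact h2
      · rintro ⟨⟨m, q⟩, hp, hq, h1, h2⟩
        have hmq := (Nat.mem_divisorsAntidiagonal.1 hp).1
        dsimp only at hmq hq h1 h2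
        have hnW : W < n := by rw [← hmq]; exact_mod_cast h2
        have hYq := hprime m q hq h1 h2
        obtain ⟨a, b, hab, h⟩ := exists_isPrefixSplit hY hn (show Y < n by nlinarith)
        refine ⟨(a, b), Nat.mem_divisorsAntidiagonal.2 ⟨hab, hn0⟩, h, ?_⟩
        dsimp only
        have hm0 : 0 < m := Nat.pos_of_ne_zero (left_ne_zero_of_mul (hmq ▸ hn0))
        have hb0 : b ≠ 0 := right_ne_zero_of_mul (hab ▸ hn0)
        have hco : Nat.Coprime a b := Nat.coprime_of_squarefree_mul (hab ▸ hn)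
        have hqab : q ∣ a * b := by rw [hab, ← hmq]; exact dvd_mul_left _ _
        have hdvd : ∀ c, c ∣ n → Nat.Coprime c q → (c : ℝ) ≤ Y := by
          intro c hc hcq
          rw [← hmq] at hc
          have h3 : c ≤ m := Nat.le_of_dvd hm0 (hcq.dvd_of_dvd_mul_right hc)
          have h4 : (c : ℝ) ≤ m := by exact_mod_cast h3
          linarith
        -- A divisor of `n` prime to `q` divides `m`, so it is at most `Y`; hence `q` must lie in
        -- `a`, and then `b` has no room for a prime beyond `q`.
        rcases (hq.dvd_mul).1 hqab with hqa | hqb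
        · have hbq : Nat.Coprime b q := (hco.coprime_dvd_left hqa).symm
          have hbY := hdvd b (Dvd.intro_left _ hab) hbq
          have hb1 : b = 1 := by
            by_contra hb1
            have h3 := h.2 b.minFac
              (Nat.mem_primeFactors.2 ⟨Nat.minFac_prime hb1, Nat.minFac_dvd b, hb0⟩)
            have h4 : b.minFac ≤ b := Nat.minFac_le (Nat.pos_of_ne_zero hb0)
            have h5 : q ≤ greatestPrimeFactor a := le_greatestPrimeFactor
              (Nat.mem_primeFactors.2 ⟨hq, hqa, left_ne_zero_of_mul (hab ▸ hn0)⟩)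
            have h6 : (q : ℝ) ≤ b := by exact_mod_cast h5.trans (h3.le.trans h4)
            linarith
          rw [hb1, mul_one] at hab
          rw [hab]; exact hnW
        · have haq : Nat.Coprime a q := hco.coprime_dvd_right hqb
          have := hdvd a (Dvd.intro _ hab) haq
          linarith [h.1.1]
    · rintro ⟨m, q⟩ hp ⟨m', q'⟩ hp' ⟨hq, h1, h2⟩ ⟨hq', h1', h2'⟩
      have hmq := (Nat.mem_divisorsAntidiagonal.1 hp).1
      have hmq' := (Nat.mem_divisorsAntidiagonal.1 hp').1
      dsimp only at *
      have hYq := hprime m q hq h1 h2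
      have hm0 : 0 < m' := Nat.pos_of_ne_zero (left_ne_zero_of_mul (hmq' ▸ hn0))
      have hqq : q = q' := by
        by_contra hne
        have h3 : q ∣ m' * q' := by rw [hmq', ← hmq]; exact dvd_mul_left _ _
        have h4 : q ∣ m' := Nat.Coprime.dvd_of_dvd_mul_right ((Nat.coprime_primes hq hq').2 hne) h3
        have h5 : (q : ℝ) ≤ m' := by exact_mod_cast Nat.le_of_dvd hm0 h4
        linarith
      subst hqq
      rw [Nat.eq_of_mul_eq_mul_right hq.pos (hmq.trans hmq'.symm)]
    · rintro ⟨a, b⟩ hp ⟨a', b'⟩ hp' h h'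
      obtain ⟨h1, h2⟩ := h.1.unique hY hn (Nat.mem_divisorsAntidiagonal.1 hp).1
        (Nat.mem_divisorsAntidiagonal.1 hp').1 h'.1
      exact Prod.ext h1 h2
  rw [← hkey, add_assoc, ← hsplit, hsum]
  by_cases h : (n : ℝ) ≤ Y
  · simp [h, not_lt.2 h]
  · simp [h, not_le.1 h]

/-! ### The prefix part and the large prime part -/

namespace GaussSum

-- This is the bilinear range: the prefix lies between `Z^η` and `Z^(1-2η)`. Indices are pairs of a
-- Gaussian integer and a divisor of its norm; the two linking inequalities are the prefix condition
-- and `c₁ ≤ C/c₂`, and the divisor bound controls the fibres.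
open Classical in
theorem exists_norm_sum_prefix_le (η : ℝ) (hη : 0 < η) (hη1 : η ≤ 1 / 10) :
    ∃ δ M : ℝ, 0 < δ ∧ 0 < M ∧ ∀ (d : ℕ) (χ : MulChar (ResidueRing d) ℂ) (k : ℤ) (X P : ℕ)
      (Z C : ℝ), 1 ≤ d → 1 ≤ Z → (X : ℝ) ≤ Z →
      ‖∑ w ∈ primaryBall X, ∑ v ∈ primaryBall X, (if nrm w * nrm v ≤ X then
        jacobiKubota (w * v) * grossencharacter χ k (w * v) * sieveWeight C P (nrm (w * v)) *
          (if IsPrefixSplit (Z ^ η) (nrm w) (nrm v) ∧ (nrm w : ℝ) ≤ Z ^ (1 - 2 * η) then 1 else 0)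
          else 0)‖ ≤ M * Z ^ (1 - δ) := by
  obtain ⟨δ, C₀, hδ, hC₀, hII⟩ := exists_bilinBound_jacobiKubota η hη (by linarith)
  obtain ⟨C₁, hC₁, hdiv⟩ := exists_card_nat_divisors_le (δ / 14) (by positivity)
  refine ⟨δ / 2, C₀ * C₁ ^ 7, by positivity, by positivity, ?_⟩
  intro d χ k X P Z C hd hZ hXZ
  have hZ0 : 0 < Z := by linarith
  set Y := Z ^ η with hY
  set I : Finset (Σ _ : GaussianInt, ℕ) := {w ∈ primaryBall X |
    (Y < nrm w ∧ (nrm w : ℝ) ≤ Y * greatestPrimeFactor (nrm w)) ∧ (nrm w : ℝ) ≤ Z ^ (1 - 2 * η)}.sigma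
      (fun w => (nrm w).divisors) with hI
  set J : Finset (Σ _ : GaussianInt, ℕ) := (primaryBall X).sigma (fun v => (nrm v).divisors) with hJ
  have hF1 : 1 ≤ C₁ * Z ^ (δ / 14) :=
    one_le_mul_of_one_le_of_one_le hC₁ (Real.one_le_rpow hZ (by positivity))
  have hJp : ∀ j ∈ J, IsPrimary j.1 ∧ nrm j.1 ≤ X ∧ j.2 ∈ (nrm j.1).divisors := by
    intro j hj
    rw [hJ, mem_sigma, mem_primaryBall] at hj
    exact ⟨hj.1.2, hj.1.1, hj.2⟩
  have hIJ : I ⊆ J := by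
    rw [hI, hJ]; exact sigma_mono (filter_subset _ _) fun _ => Subset.rfl
  have hfib : ∀ y, ∀ s ⊆ J, (∀ j ∈ s, j.1 = y) → (#s : ℝ) ≤ C₁ * Z ^ (δ / 14) := by
    intro y s hs hsy
    rcases s.eq_empty_or_nonempty with rfl | ⟨j₀, hj₀⟩
    · simp; linarith
    have h0 := hJp j₀ (hs hj₀)
    rw [hsy j₀ hj₀] at h0
    have h1 : #s ≤ #(nrm y).divisors := by
      refine card_le_card_of_injOn (fun j => j.2) (fun j hj => ?_) fun j hj j' hj' h => ?_
      · rw [← hsy j hj]; exact (hJp j (hs hj)).2.2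
      · exact Sigma.ext ((hsy j hj).trans (hsy j' hj').symm) (heq_of_eq h)
    have h2 : (nrm y : ℝ) ≤ Z := le_trans (by exact_mod_cast h0.2.1) hXZ
    calc (#s : ℝ) ≤ #(nrm y).divisors := by exact_mod_cast h1
      _ ≤ C₁ * (nrm y : ℝ) ^ (δ / 14) := hdiv _ (nrm_pos.2 h0.1.ne_zero).ne'
      _ ≤ _ := by gcongr
  have hbil := hII I J (fun i => i.1) (fun j => j.1)
    (fun i => greatestPrimeFactor (nrm i.1)) (fun i => i.2)
    (fun j => leastPrimeFactor (X + 1) (nrm j.1)) (fun j => C / j.2) Z X (C₁ * Z ^ (δ / 14))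
    hZ hXZ hF1
    (by
      intro i hi
      have hp := (hJp i (hIJ hi)).1
      rw [hI, mem_sigma, mem_filter] at hi
      obtain ⟨⟨_, ⟨h1, _⟩, h2⟩, _⟩ := hi
      exact ⟨hp, h1.le, h2.trans (Real.rpow_le_rpow_of_exponent_le hZ (by linarith))⟩)
    (fun j hj => (hJp j hj).1)
    (fun w s hs => hfib w s (hs.trans hIJ)) hfib
  have hcoef : ∀ j ∈ J, ‖(if Nat.Coprime (nrm j.1) (primorial P) then (μ (nrm j.1) : ℂ) else 0) *
      (μ j.2 : ℂ) * grossencharacter χ k j.1‖ ≤ 1 := by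
    intro j hj
    rw [norm_mul, norm_mul]
    refine mul_le_one₀ (mul_le_one₀ ?_ (norm_nonneg _) (norm_moebius_le_one _)) (norm_nonneg _)
      (norm_grossencharacter_le_one hd χ k (hJp j hj).1.ne_zero)
    split_ifs
    · exact norm_moebius_le_one _
    · simp
  have happ := hbil.apply_of_bounds (A := 1) (B := 1) zero_le_one zero_le_one
    (fun i hi => hcoef i (hIJ hi)) hcoef
  rw [one_mul, one_mul] at happ
  refine le_of_eq_of_le (congrArg _ ?_) (happ.trans_eq ?_)
  · rw [hI, sum_sigma, sum_filter]
    refine sum_congr rfl fun w hw => ?_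
    rw [mem_primaryBall] at hw
    by_cases hc : (Y < nrm w ∧ (nrm w : ℝ) ≤ Y * greatestPrimeFactor (nrm w)) ∧
        (nrm w : ℝ) ≤ Z ^ (1 - 2 * η)
    · rw [if_pos hc, sum_comm, hJ, sum_sigma]
      refine sum_congr rfl fun v hv => ?_
      rw [mem_primaryBall] at hv
      have hv0 : nrm v ≠ 0 := (nrm_pos.2 hv.2.ne_zero).ne'
      have hw0 : nrm w ≠ 0 := (nrm_pos.2 hw.2.ne_zero).ne'
      have hlt := lt_leastPrimeFactor_iff (B := X + 1) (a := nrm w) (b := nrm v)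
        (Nat.lt_succ_of_le (greatestPrimeFactor_le.trans hw.1)) hv0
      have hsplit : IsPrefixSplit Y (nrm w) (nrm v) ∧ (nrm w : ℝ) ≤ Z ^ (1 - 2 * η) ↔
          (greatestPrimeFactor (nrm w) : ℝ) < (leastPrimeFactor (X + 1) (nrm v) : ℝ) := by
        rw [Nat.cast_lt, hlt, IsPrefixSplit]
        exact ⟨fun h => h.1.2, fun h => ⟨⟨hc.1, h⟩, hc.2⟩⟩
      have hcut : (nrm w * nrm v : ℝ) ≤ X ↔ nrm w * nrm v ≤ X := by norm_cast
      simp only [hcut]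
      by_cases h1 : nrm w * nrm v ≤ X
      swap
      · simp [h1]
      by_cases h2 : (greatestPrimeFactor (nrm w) : ℝ) < (leastPrimeFactor (X + 1) (nrm v) : ℝ)
      swap
      · simp only [h2, hsplit]; simp
      have hco := coprime_of_forall_greatestPrimeFactor_lt hw0 hv0 (hlt.1 (by exact_mod_cast h2))
      simp only [h1, h2, hsplit, if_true, mul_one, one_mul]
      rw [nrm_mul,
        sieveWeight_mul_of_coprime C P hco, sum_comm, mul_sum]
      refine sum_congr rfl fun c₂ hc₂ => ?_
      rw [mul_sum]
      refine sum_congr rfl fun c₁ _ => ?_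
      have hc0 : (0 : ℝ) < c₂ := by exact_mod_cast Nat.pos_of_mem_divisors hc₂
      have h3 : (c₁ : ℝ) ≤ C / c₂ ↔ (c₁ * c₂ : ℝ) ≤ C := le_div_iff₀ hc0
      simp only [h3, grossencharacter_mul]
      ring
    · rw [if_neg hc]
      refine sum_eq_zero fun v _ => ?_
      have : ¬ (IsPrefixSplit Y (nrm w) (nrm v) ∧ (nrm w : ℝ) ≤ Z ^ (1 - 2 * η)) :=
        fun h => hc ⟨h.1.1, h.2⟩
      simp [this]
  · rw [mul_pow, ← Real.rpow_natCast (Z ^ (δ / 14)), ← Real.rpow_mul hZ0.le, ← mul_assoc, mul_assoc,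
      ← Real.rpow_add hZ0]
    congr 2
    push_cast; ring

/-- For fixed `w` the weight of `wv` is minus that of `w`, since `nrm v` exceeds both `C` and `Y`.
What remains is a difference of two sums over prime norms. The factor `Y³` comes from the number of
`w`, the size of the weight, and the factor `nrm w` in `exists_norm_sum_prime_le`. -/
theorem exists_norm_sum_large_prime_le : ∃ δ M : ℝ, 0 < δ ∧ 0 < M ∧ ∀ (d : ℕ)
    (χ : MulChar (ResidueRing d) ℂ) (k : ℤ) (X P : ℕ) (Z C Y W : ℝ), 1 ≤ d → 1 ≤ Z → (X : ℝ) ≤ Z →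
      1 ≤ Y → Y ≤ Z ^ (1 / 10 : ℝ) → Y * Y ≤ W → C * Y ≤ W →
      ‖∑ w ∈ primaryBall X, ∑ v ∈ primaryBall X, (if nrm w * nrm v ≤ X then
        jacobiKubota (w * v) * grossencharacter χ k (w * v) * sieveWeight C P (nrm (w * v)) *
          (if (nrm v).Prime ∧ (nrm w : ℝ) ≤ Y ∧ W < (nrm w * nrm v : ℝ) then 1 else 0)
          else 0)‖ ≤ M * (d * (|(k : ℝ)| + 1)) * (Y ^ 3 * Z ^ (1 - δ)) := by
  obtain ⟨δ, C₀, hδ, hC₀, hQ⟩ := exists_norm_sum_prime_le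
  refine ⟨δ, 18 * C₀, hδ, by positivity, ?_⟩
  intro d χ k X P Z C Y W hd hZ hXZ hY1 hYZ hYW hCW
  have hY0 : 0 < Y := by linarith
  set B := C₀ * (d * Y) * (|(k : ℝ)| + 1) * Z ^ (1 - δ) with hB
  have hB0 : 0 ≤ B := by positivity
  have hterm : ∀ w ∈ primaryBall X, ‖∑ v ∈ primaryBall X, (if nrm w * nrm v ≤ X then
        jacobiKubota (w * v) * grossencharacter χ k (w * v) * sieveWeight C P (nrm (w * v)) *
          (if (nrm v).Prime ∧ (nrm w : ℝ) ≤ Y ∧ W < (nrm w * nrm v : ℝ) then 1 else 0)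
          else 0)‖ ≤ if (nrm w : ℝ) ≤ Y then Y * (2 * B) else 0 := by
    intro w hw
    rw [mem_primaryBall] at hw
    by_cases hwY : (nrm w : ℝ) ≤ Y
    swap
    · simp [hwY]
    rw [if_pos hwY]
    have hw0 : 0 < nrm w := nrm_pos.2 hw.2.ne_zero
    have hw0' : (0 : ℝ) < nrm w := by exact_mod_cast hw0
    set T := X / nrm w with hT
    -- The surviving `v` have norm above both `W / nrm w` and `P`, and at most `T`; the `min` keeps
    -- the subtracted range inside the full one.
    set T' := min T (max ⌊W / nrm w⌋₊ P) with hT'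
    set h : GaussianInt → ℂ := fun v => jacobiKubota (w * v) * grossencharacter χ k v with hh
    have hQle : ∀ t ≤ T, ‖∑ v ∈ primaryBall t with (nrm v).Prime, h v‖ ≤ B := by
      intro t ht
      have h1 : nrm w * t ≤ X := (Nat.mul_le_mul_left _ ht).trans (Nat.mul_div_le _ _)
      refine (hQ w d χ k t Z hw.2 hd hZ (hwY.trans hYZ) (le_trans (by exact_mod_cast h1) hXZ)).trans ?_
      rw [hB]; gcongr
    have hW0 : 0 ≤ W := by nlinarith
    have e : ∑ v ∈ primaryBall X, (if nrm w * nrm v ≤ X then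
        jacobiKubota (w * v) * grossencharacter χ k (w * v) * sieveWeight C P (nrm (w * v)) *
          (if (nrm v).Prime ∧ (nrm w : ℝ) ≤ Y ∧ W < (nrm w * nrm v : ℝ) then 1 else 0)
          else 0) = -(grossencharacter χ k w * sieveWeight C P (nrm w)) *
        (∑ v ∈ primaryBall T with (nrm v).Prime, h v -
          ∑ v ∈ primaryBall T' with (nrm v).Prime, h v) := by
      have hsub : (primaryBall T').filter (fun v => (nrm v).Prime) ⊆
          (primaryBall T).filter (fun v => (nrm v).Prime) := by
        intro v hv
        rw [mem_filter, mem_primaryBall] at hv ⊢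
        exact ⟨⟨hv.1.1.trans (min_le_left _ _), hv.1.2⟩, hv.2⟩
      have hsd := sum_sdiff (f := h) hsub
      rw [← hsd, add_sub_cancel_right, mul_sum]
      symm
      refine sum_subset_zero_on_sdiff ?_ ?_ ?_
      · intro v hv
        rw [mem_sdiff, mem_filter, mem_primaryBall] at hv
        rw [mem_primaryBall]
        exact ⟨hv.1.1.1.trans (Nat.div_le_self _ _), hv.1.1.2⟩
      · intro v hv
        rw [mem_sdiff, mem_primaryBall] at hv
        obtain ⟨⟨hvX, hvp⟩, hno⟩ := hv
        by_cases h1 : nrm w * nrm v ≤ X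
        swap
        · rw [if_neg h1]
        rw [if_pos h1]
        by_cases h2 : (nrm v).Prime ∧ (nrm w : ℝ) ≤ Y ∧ W < (nrm w * nrm v : ℝ)
        swap
        · rw [if_neg h2, mul_zero]
        have hYv : C < nrm v ∧ Y < nrm v := by
          constructor
          · by_contra h3; push Not at h3
            have : (nrm w * nrm v : ℝ) ≤ Y * C := mul_le_mul hwY h3 (by positivity) hY0.le
            linarith [h2.2.2]
          · by_contra h3; push Not at h3
            have : (nrm w * nrm v : ℝ) ≤ Y * Y := by gcongr
            linarith [h2.2.2]
        have hndvd : ¬ nrm v ∣ nrm w := fun hdv => by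
          have : (nrm v : ℝ) ≤ nrm w := by exact_mod_cast Nat.le_of_dvd hw0 hdv
          linarith [hYv.2]
        rw [nrm_mul, sieveWeight_mul_prime h2.1 hndvd hYv.1]
        have hPv : ¬ P < nrm v := by
          intro hPv
          apply hno
          have hvT : nrm v ≤ T := (Nat.le_div_iff_mul_le hw0).2 (by rw [mul_comm]; exact h1)
          rw [mem_sdiff, mem_filter, mem_filter, mem_primaryBall, mem_primaryBall]
          refine ⟨⟨⟨hvT, hvp⟩, h2.1⟩, fun h4 => ?_⟩
          have h5 : nrm v ≤ max ⌊W / nrm w⌋₊ P := h4.1.1.trans (min_le_right _ _)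
          rcases le_max_iff.1 h5 with h6 | h6
          · have h7 : (nrm v : ℝ) ≤ W / nrm w := (Nat.le_floor_iff (by positivity)).1 h6
            rw [le_div_iff₀ hw0'] at h7
            linarith [h2.2.2]
          · omega
        rw [if_neg hPv]; simp
      · intro v hv
        rw [mem_sdiff, mem_filter, mem_filter, mem_primaryBall, mem_primaryBall] at hv
        obtain ⟨⟨⟨hvT, hvp⟩, hpr⟩, hno⟩ := hv
        have h1 : nrm w * nrm v ≤ X := by
          rw [mul_comm]; exact (Nat.le_div_iff_mul_le hw0).1 hvT
        have h3 : max ⌊W / nrm w⌋₊ P < nrm v := by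
          by_contra h3
          exact hno ⟨⟨le_min hvT (not_lt.1 h3), hvp⟩, hpr⟩
        rw [max_lt_iff, Nat.floor_lt (by positivity), div_lt_iff₀ hw0'] at h3
        have h2 : (nrm v).Prime ∧ (nrm w : ℝ) ≤ Y ∧ W < (nrm w * nrm v : ℝ) :=
          ⟨hpr, hwY, by rw [mul_comm]; exact h3.1⟩
        have hYv : C < nrm v ∧ Y < nrm v := by
          constructor
          · by_contra h3; push Not at h3
            have : (nrm w * nrm v : ℝ) ≤ Y * C := mul_le_mul hwY h3 (by positivity) hY0.le
            linarith [h2.2.2]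
          · by_contra h3; push Not at h3
            have : (nrm w * nrm v : ℝ) ≤ Y * Y := by gcongr
            linarith [h2.2.2]
        have hndvd : ¬ nrm v ∣ nrm w := fun hdv => by
          have : (nrm v : ℝ) ≤ nrm w := by exact_mod_cast Nat.le_of_dvd hw0 hdv
          linarith [hYv.2]
        rw [if_pos h1, if_pos h2, nrm_mul, sieveWeight_mul_prime h2.1 hndvd hYv.1, if_pos h3.2, hh,
          grossencharacter_mul]
        ring
    rw [e, norm_mul, norm_neg, norm_mul]
    have h1 := norm_grossencharacter_le_one hd χ k hw.2.ne_zero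
    have h2 := (norm_sieveWeight_le C P (nrm w)).trans hwY
    have h3 := hQle T le_rfl
    have h4 := hQle T' (min_le_left _ _)
    calc _ ≤ 1 * Y * (B + B) := by
          gcongr
          exact (norm_sub_le _ _).trans (add_le_add h3 h4)
      _ = _ := by ring
  refine (norm_sum_le _ _).trans ((sum_le_sum hterm).trans ?_)
  rw [← sum_filter, sum_const, nsmul_eq_mul]
  have hcard : (#{u ∈ primaryBall X | (nrm u : ℝ) ≤ Y} : ℝ) ≤ 9 * Y := by
    have h1 : #{u ∈ primaryBall X | (nrm u : ℝ) ≤ Y} ≤ #(primaryBall ⌊Y⌋₊) := by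
      refine card_le_card fun u hu => ?_
      rw [mem_filter, mem_primaryBall] at hu
      rw [mem_primaryBall]
      exact ⟨Nat.le_floor hu.2, hu.1.2⟩
    have h3 : (#{u ∈ primaryBall X | (nrm u : ℝ) ≤ Y} : ℝ) ≤ 9 * ⌊Y⌋₊ := by
      exact_mod_cast h1.trans (card_primaryBall_le _)
    linarith [Nat.floor_le hY0.le]
  calc _ ≤ (9 * Y) * (Y * (2 * B)) := by gcongr
    _ = _ := by rw [hB]; ring

end GaussSum

/-! ### Assembly: sharp cutoff, smooth weight and conclusion -/

namespace GaussSum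

open Classical in
/-- The sum over primary numbers with a sharp cutoff. -/
theorem exists_norm_sum_sieveWeight_le (η : ℝ) (hη : 0 < η) :
    ∃ δ M : ℝ, 0 < δ ∧ 0 < M ∧ ∀ (d : ℕ) (χ : MulChar (ResidueRing d) ℂ) (k : ℤ) (X P : ℕ)
      (Z C : ℝ), 1 ≤ d → 1 ≤ Z → (X : ℝ) ≤ Z → C ≤ Z ^ (1 - η) →
      ‖∑ z ∈ primaryBall X, sieveWeight C P (nrm z) * jacobiKubota z * grossencharacter χ k z‖ ≤
        M * (d * (|(k : ℝ)| + 1)) * Z ^ (1 - δ) := by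
  obtain ⟨δ₁, M₁, hδ₁, hM₁, h1⟩ := exists_norm_sum_large_prime_le
  -- `1/10` serves the size conditions on `Y` and `W`, `η/3` gives `C Y ≤ W`, and `δ₁/6` keeps `Y³`
  -- within half of the saving over primes.
  set ε : ℝ := min (1 / 10) (min (η / 3) (δ₁ / 6)) with hε
  have hε0 : 0 < ε := by positivity
  have hε1 : ε ≤ 1 / 10 := min_le_left _ _
  have hε2 : ε ≤ η / 3 := (min_le_right _ _).trans (min_le_left _ _)
  have hε3 : ε ≤ δ₁ / 6 := (min_le_right _ _).trans (min_le_right _ _)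
  obtain ⟨δ₂, M₂, hδ₂, hM₂, h2⟩ := exists_norm_sum_prefix_le ε hε0 hε1
  set δ : ℝ := min (1 / 2) (min (δ₁ / 2) δ₂) with hδ
  have hδ' : δ ≤ 1 / 2 := min_le_left _ _
  have hδ1' : δ ≤ δ₁ / 2 := (min_le_right _ _).trans (min_le_left _ _)
  have hδ2' : δ ≤ δ₂ := (min_le_right _ _).trans (min_le_right _ _)
  refine ⟨δ, 9 + M₂ + M₁, by positivity, by positivity, ?_⟩
  intro d χ k X P Z C hd hZ hXZ hC
  have hZ0 : 0 < Z := by linarith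
  set Y := Z ^ ε with hY
  set W := Z ^ (1 - 2 * ε) with hW
  set H : GaussianInt → ℂ := fun z =>
    jacobiKubota z * grossencharacter χ k z * sieveWeight C P (nrm z) with hH
  have hY1 : 1 ≤ Y := Real.one_le_rpow hZ hε0.le
  have hYY : Y * Y ≤ W := by
    rw [hY, hW, ← Real.rpow_add hZ0]
    exact Real.rpow_le_rpow_of_exponent_le hZ (by linarith)
  have hYZ : Y * Z ≤ W * W := by
    calc Y * Z = Z ^ (ε + 1) := by rw [Real.rpow_add hZ0, Real.rpow_one]
      _ ≤ Z ^ ((1 - 2 * ε) + (1 - 2 * ε)) := Real.rpow_le_rpow_of_exponent_le hZ (by linarith)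
      _ = W * W := Real.rpow_add hZ0 _ _
  have hCY : C * Y ≤ W := by
    calc C * Y ≤ Z ^ (1 - η) * Y := by gcongr
      _ = Z ^ (1 - η + ε) := by rw [hY, ← Real.rpow_add hZ0]
      _ ≤ W := Real.rpow_le_rpow_of_exponent_le hZ (by linarith)
  have hHco : ∀ z, IsPrimary z → H z ≠ 0 → IsCoprime z.re z.im := fun z hz h0 =>
    isCoprime_of_jacobiKubota_ne_zero hz.isOddEven (left_ne_zero_of_mul (left_ne_zero_of_mul h0))
  have hdec : ∑ z ∈ primaryBall X, sieveWeight C P (nrm z) * jacobiKubota z * grossencharacter χ k z =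
      ∑ z ∈ primaryBall X, (if (nrm z : ℝ) ≤ Y then H z else 0) +
      ∑ z ∈ primaryBall X, H z * ∑ p ∈ (nrm z).divisorsAntidiagonal,
        (if IsPrefixSplit Y p.1 p.2 ∧ (p.1 : ℝ) ≤ W then 1 else 0) +
      ∑ z ∈ primaryBall X, H z * ∑ p ∈ (nrm z).divisorsAntidiagonal,
        (if p.2.Prime ∧ (p.1 : ℝ) ≤ Y ∧ W < (p.1 * p.2 : ℝ) then 1 else 0) := by
    rw [← sum_add_distrib, ← sum_add_distrib]
    refine sum_congr rfl fun z hz => ?_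
    rw [mem_primaryBall] at hz
    by_cases hsq : Squarefree (nrm z)
    · have h3 := one_eq_sum_prefix_add_sum_prime hY1 hYY hYZ hsq
        (le_trans (by exact_mod_cast hz.1) hXZ)
      have e : (if (nrm z : ℝ) ≤ Y then H z else 0) = H z * (if (nrm z : ℝ) ≤ Y then 1 else 0) := by
        split_ifs <;> simp
      rw [e, ← mul_add, ← mul_add, ← h3, hH]
      ring
    · have h3 : H z = 0 := by simp [hH, sieveWeight_of_not_squarefree hsq]
      rw [sieveWeight_of_not_squarefree hsq, h3]; simp
  have hA : ‖∑ z ∈ primaryBall X, (if (nrm z : ℝ) ≤ Y then H z else 0)‖ ≤ 9 * (Y * Y) := by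
    rw [← sum_filter]
    refine (norm_sum_le_card_mul _ _ (A := Y) fun z hz => ?_).trans ?_
    · rw [mem_filter, mem_primaryBall] at hz
      have h3 := norm_twist_le_one hd χ k 1 hz.1.2.ne_zero
      rw [one_mul] at h3
      rw [hH, norm_mul]
      calc _ ≤ 1 * (nrm z : ℝ) := by
            gcongr
            exact norm_sieveWeight_le C P _
        _ ≤ Y := by rw [one_mul]; exact hz.2
    · have h3 : #{u ∈ primaryBall X | (nrm u : ℝ) ≤ Y} ≤ #(primaryBall ⌊Y⌋₊) := by
        refine card_le_card fun u hu => ?_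
        rw [mem_filter, mem_primaryBall] at hu
        rw [mem_primaryBall]
        exact ⟨Nat.le_floor hu.2, hu.1.2⟩
      have h4 : (#{u ∈ primaryBall X | (nrm u : ℝ) ≤ Y} : ℝ) ≤ 9 * ⌊Y⌋₊ := by
        exact_mod_cast h3.trans (card_primaryBall_le _)
      have h5 := Nat.floor_le (show 0 ≤ Y by linarith)
      calc _ ≤ (9 * Y) * Y := by gcongr; linarith
        _ = _ := by ring
  have hB := h2 d χ k X P Z C hd hZ hXZ
  have hB' := sum_mul_sum_divisorsAntidiagonal_nrm hHco X
    (fun a b => if IsPrefixSplit Y a b ∧ (a : ℝ) ≤ W then 1 else 0)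
  have hD := h1 d χ k X P Z C Y W hd hZ hXZ hY1
    (Real.rpow_le_rpow_of_exponent_le hZ hε1) hYY hCY
  have hD' := sum_mul_sum_divisorsAntidiagonal_nrm hHco X
    (fun a b => if b.Prime ∧ (a : ℝ) ≤ Y ∧ W < (a * b : ℝ) then 1 else 0)
  have hDk : (1 : ℝ) ≤ d * (|(k : ℝ)| + 1) :=
    one_le_mul_of_one_le_of_one_le (by exact_mod_cast hd) (by linarith [abs_nonneg (k : ℝ)])
  rw [hdec, hB', hD']
  refine (norm_add₃_le).trans ((add_le_add_three hA hB hD).trans ?_)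
  have e1 : Y * Y ≤ Z ^ (1 - δ) := by
    rw [hY, ← Real.rpow_add hZ0]
    exact Real.rpow_le_rpow_of_exponent_le hZ (by linarith)
  have e2 : Z ^ (1 - δ₂) ≤ Z ^ (1 - δ) := Real.rpow_le_rpow_of_exponent_le hZ (by linarith)
  have e3 : Y ^ 3 * Z ^ (1 - δ₁) ≤ Z ^ (1 - δ) := by
    rw [hY, ← Real.rpow_natCast, ← Real.rpow_mul hZ0.le, ← Real.rpow_add hZ0]
    exact Real.rpow_le_rpow_of_exponent_le hZ (by push_cast; linarith)
  set E := Z ^ (1 - δ)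
  have hE0 : 0 ≤ E := by positivity
  set D := d * (|(k : ℝ)| + 1)
  calc 9 * (Y * Y) + M₂ * Z ^ (1 - δ₂) + M₁ * D * (Y ^ 3 * Z ^ (1 - δ₁))
      ≤ 9 * (D * E) + M₂ * (D * E) + M₁ * D * E := by
        have : E ≤ D * E := le_mul_of_one_le_left hE0 hDk
        have e1' : Y * Y ≤ D * E := e1.trans this
        have e2' : Z ^ (1 - δ₂) ≤ D * E := e2.trans this
        exact add_le_add_three (mul_le_mul_of_nonneg_left e1' (by norm_num))
          (mul_le_mul_of_nonneg_left e2' hM₂.le) (mul_le_mul_of_nonneg_left e3 (by positivity))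
    _ = _ := by ring

/-- As `m` is its own conjugate, coprimality of `z` with `m` passes to the conjugate of `z` and so
to the norm. -/
theorem isCoprime_natCast_iff {z : GaussianInt} {m : ℕ} :
    IsCoprime z (m : GaussianInt) ↔ Nat.Coprime (nrm z) m := by
  have hm : star (m : GaussianInt) = m := by ext <;> simp
  constructor
  · intro h
    have h1 : IsCoprime (star z) (m : GaussianInt) := by
      obtain ⟨a, b, e⟩ := h
      refine ⟨star a, star b, ?_⟩
      have := congrArg star e
      rw [star_add, star_mul, star_mul, star_one, hm] at this
      linear_combination this
    have h2 : IsCoprime ((nrm z : ℕ) : GaussianInt) (m : GaussianInt) := by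
      rw [natCast_nrm]; exact h.mul_left h1
    have h3 : IsUnit ((Nat.gcd (nrm z) m : ℕ) : GaussianInt) := by
      refine h2.isUnit_of_dvd' ?_ ?_
      · exact Nat.cast_dvd_cast (Nat.gcd_dvd_left _ _)
      · exact Nat.cast_dvd_cast (Nat.gcd_dvd_right _ _)
    rw [isUnit_iff_nrm, nrm_natCast] at h3
    exact (pow_eq_one_iff.1 h3).resolve_right two_ne_zero
  · intro h
    have h1 : IsCoprime ((nrm z : ℕ) : GaussianInt) (m : GaussianInt) := by
      have := (Nat.isCoprime_iff_coprime.2 h).map (Int.castRingHom GaussianInt)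
      simpa using this
    rw [natCast_nrm] at h1
    exact h1.of_mul_left_left

theorem beta_eq {p : ℝ → ℝ} {C : ℝ} {P : ℕ} {z : GaussianInt}
    (hz : IsCoprime z ((primorial P : ℕ) : GaussianInt)) :
    (beta p C z : ℂ) = p (nrm z) * sieveWeight C P (nrm z) := by
  rw [isCoprime_natCast_iff] at hz
  rw [sieveWeight, if_pos hz, beta]
  push_cast
  rw [nrm]
  ring

/-- Summation by parts over the norm. -/
theorem sum_mul_eq_sum_range_mul_sum {p : ℝ → ℝ} {X : ℕ} (hp : p (X + 1 : ℕ) = 0)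
    (f : GaussianInt → ℂ) :
    ∑ z ∈ primaryBall X, (p (nrm z) : ℂ) * f z =
      ∑ m ∈ range (X + 1), ((p m - p (m + 1 : ℕ) : ℝ) : ℂ) * ∑ z ∈ primaryBall m, f z := by
  have h1 : ∀ n ≤ X, (p n : ℂ) =
      ∑ m ∈ range (X + 1), if n ≤ m then ((p m - p (m + 1 : ℕ) : ℝ) : ℂ) else 0 := by
    intro n hn
    rw [← sum_filter]
    have e : {m ∈ range (X + 1) | n ≤ m} = Ico n (X + 1) := by
      ext m; rw [mem_filter, mem_range, mem_Ico]; tauto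
    rw [e, ← Complex.ofReal_sum]
    have h2 := sum_range_sub' (fun i => p (n + i : ℕ)) (X + 1 - n)
    rw [sum_Ico_eq_sum_range]
    simp only [← add_assoc] at h2
    rw [show n + (X + 1 - n) = X + 1 by omega, hp, add_zero, sub_zero] at h2
    rw [h2]
  have h3 : ∀ z ∈ primaryBall X, (p (nrm z) : ℂ) * f z = ∑ m ∈ range (X + 1),
      (if nrm z ≤ m then ((p m - p (m + 1 : ℕ) : ℝ) : ℂ) * f z else 0) := by
    intro z hz
    rw [h1 _ (mem_primaryBall.1 hz).1, sum_mul]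
    refine sum_congr rfl fun m _ => ?_
    split_ifs <;> simp
  rw [sum_congr rfl h3, sum_comm]
  refine sum_congr rfl fun m hm => ?_
  rw [← sum_filter, mul_sum]
  refine sum_congr ?_ fun _ _ => rfl
  ext z
  rw [mem_filter, mem_primaryBall, mem_primaryBall]
  rw [mem_range] at hm
  constructor
  · rintro ⟨⟨_, h4⟩, h5⟩; exact ⟨h5, h4⟩
  · rintro ⟨h4, h5⟩; exact ⟨⟨by omega, h5⟩, h4⟩

/-- The support has length `θN' < 2θN` and the derivative is at most `K/(θN)`, so the total
variation is `O(K)`, uniformly in `θ`. When `θN < 1` at most four integers are involved, and the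
trivial bound `2K` for each is used. -/
theorem IsRadiusMollifier.sum_abs_sub_le {K N N' θ : ℝ} {p : ℝ → ℝ}
    (h : IsRadiusMollifier K N N' θ p) (hN : 1 ≤ N) (hN' : N < N') (hN2 : N' < 2 * N) (hθ : 0 < θ)
    (X : ℕ) : ∑ m ∈ range X, |p m - p (m + 1 : ℕ)| ≤ 8 * K := by
  have hb : ∀ t, |p t| ≤ K := fun t => by simpa using h.bound 0 (by norm_num) t
  have hK : 0 ≤ K := (abs_nonneg _).trans (hb 0)
  have hθN : 0 < θ * N := by positivity
  have hd : ∀ t, ‖deriv p t‖ ≤ K / (θ * N) := fun t => by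
    simpa [iteratedDeriv_one] using h.bound 1 (by norm_num) t
  have h1 : ∀ m : ℕ, |p m - p (m + 1 : ℕ)| ≤ 2 * K := fun m =>
    (abs_sub _ _).trans (by linarith [hb m, hb (m + 1 : ℕ)])
  have h2 : ∀ m : ℕ, |p m - p (m + 1 : ℕ)| ≤ K / (θ * N) := fun m => by
    have := convex_univ.norm_image_sub_le_of_norm_deriv_le (f := p) (x := ((m + 1 : ℕ) : ℝ))
      (y := (m : ℝ)) (fun x _ => h.differentiable x) (fun x _ => hd x) (Set.mem_univ _)
      (Set.mem_univ _)
    simpa using this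
  have hz : ∀ t, p t ≠ 0 → N' < t ∧ t ≤ (1 + θ) * N' := fun t ht => h.support_subset ht
  -- The interval starts one unit before the support, because the difference at `m` also involves `p
  -- (m + 1)`.
  set S := Ioc ⌊N' - 1⌋₊ ⌊(1 + θ) * N'⌋₊ with hS
  have hN0 : 0 ≤ N' - 1 := by linarith
  have hle : N' - 1 ≤ (1 + θ) * N' := by nlinarith
  have hmem : ∀ m : ℕ, |p m - p (m + 1 : ℕ)| ≠ 0 → m ∈ S := by
    intro m hm
    rw [hS, mem_Ioc, Nat.floor_lt hN0, Nat.le_floor_iff (by linarith)]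
    by_cases h3 : p m = 0
    · have h4 : p (m + 1 : ℕ) ≠ 0 := by
        intro h4; rw [h3, h4] at hm; simp at hm
      have h5 := hz _ h4
      push_cast at h5
      constructor <;> linarith
    · have h5 := hz _ h3
      constructor <;> linarith
  have hcard : (#S : ℝ) ≤ 2 * (θ * N) + 2 := by
    rw [hS, Nat.card_Ioc, Nat.cast_sub (Nat.floor_mono hle)]
    have h3 := Nat.floor_le (show 0 ≤ (1 + θ) * N' by linarith)
    have h4 := Nat.lt_floor_add_one (N' - 1)
    nlinarith
  have hsum : ∑ m ∈ range X, |p m - p (m + 1 : ℕ)| ≤ ∑ m ∈ S, |p m - p (m + 1 : ℕ)| := by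
    rw [← sum_filter_ne_zero]
    exact sum_le_sum_of_subset_of_nonneg (fun m hm => hmem m (mem_filter.1 hm).2)
      fun _ _ _ => abs_nonneg _
  refine hsum.trans ?_
  rcases le_or_gt 1 (θ * N) with h3 | h3
  · calc ∑ m ∈ S, |p m - p (m + 1 : ℕ)| ≤ #S * (K / (θ * N)) := by
          rw [← nsmul_eq_mul]; exact sum_le_card_nsmul _ _ _ fun m _ => h2 m
      _ ≤ (4 * (θ * N)) * (K / (θ * N)) := by gcongr; linarith
      _ = 4 * K := by field_simp
      _ ≤ 8 * K := by linarith
  · calc ∑ m ∈ S, |p m - p (m + 1 : ℕ)| ≤ #S * (2 * K) := by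
          rw [← nsmul_eq_mul]; exact sum_le_card_nsmul _ _ _ fun m _ => h1 m
      _ ≤ 4 * (2 * K) := by gcongr; linarith
      _ = 8 * K := by ring

/-- The coprimality condition moves into `sieveWeight`, and the vanishing of `p` beyond `X` makes
the sum finite. -/
theorem charSum_eq_sum {p : ℝ → ℝ} {C P : ℝ} {d X : ℕ} (χ : MulChar (ResidueRing d) ℂ) (k : ℤ)
    (hp : ∀ n : ℕ, X < n → p n = 0) :
    charSum p C P χ k = ∑ z ∈ primaryBall X, (p (nrm z) : ℂ) *
      (sieveWeight C ⌊P⌋₊ (nrm z) * jacobiKubota z * grossencharacter χ k z) := by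
  classical
  rw [charSum, finsum_mem_eq_sum_of_inter_support_eq (t := {z ∈ primaryBall X |
    IsCoprime z ((primorial ⌊P⌋₊ : ℕ) : GaussianInt)}), sum_filter]
  · refine sum_congr rfl fun z _ => ?_
    split_ifs with hz
    · rw [beta_eq hz]; ring
    · rw [isCoprime_natCast_iff] at hz
      rw [sieveWeight, if_neg hz]; simp
  · ext z
    rw [Set.mem_inter_iff, Set.mem_inter_iff]
    refine and_congr_left fun hsup => ?_
    rw [mem_coe, mem_filter, mem_primaryBall, Set.mem_ofPred_eq]
    constructor
    · rintro ⟨h1, h2⟩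
      refine ⟨⟨?_, h1⟩, h2⟩
      by_contra h3
      apply hsup
      have h4 : p (nrm z) = 0 := hp _ (not_le.1 h3)
      dsimp only
      rw [beta_eq h2, h4]; simp
    · rintro ⟨⟨_, h1⟩, h2⟩; exact ⟨h1, h2⟩

end GaussSum

theorem proposition17p2 (η : ℝ) (hη : 0 < η) :
    ∃ δ : ℝ, 0 < δ ∧ ∀ K : ℝ, ∃ M : ℝ,
      ∀ (N N' θ C P : ℝ) (p : ℝ → ℝ) (d : ℕ) (k : ℤ)
        (χ : MulChar (GaussSum.ResidueRing d) ℂ),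
        1 ≤ N → N < N' → N' < 2 * N → 0 < θ → θ ≤ 1 →
        1 ≤ C → C ≤ N ^ (1 - η) →
        GaussSum.IsRadiusMollifier K N N' θ p →
        1 ≤ d → (d : ℝ) * (|(k : ℝ)| + 1) ≤ N ^ δ →
        ‖GaussSum.charSum p C P χ k‖ ≤ M * N ^ (1 - δ) := by
  -- With `min η 1` the exponent `1 - min η 1` is nonnegative, so enlarging the base from `N` to
  -- `4N` keeps the bound on `C`.
  obtain ⟨δ, M, hδ, hM, hB⟩ := GaussSum.exists_norm_sum_sieveWeight_le (min η 1) (by positivity)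
  -- Half of the saving absorbs the factor `d (|k| + 1) ≤ N^(δ/2)`.
  refine ⟨δ / 2, by positivity, fun K => ⟨8 * K * (M * 4), ?_⟩⟩
  intro N N' θ C P p d k χ hN hN' hN2 hθ hθ1 _ hC hp hd hdk
  have hN0 : 0 < N := by linarith
  have hK : 0 ≤ K := (abs_nonneg _).trans (by simpa using hp.bound 0 (by norm_num) 0)
  -- The support ends at `(1 + θ) N' < 4N`.
  set X := ⌊4 * N⌋₊ with hX
  have hX4 : (X : ℝ) ≤ 4 * N := Nat.floor_le (by linarith)
  have hX4' : 4 * N < X + 1 := Nat.lt_floor_add_one _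
  have hvanish : ∀ n : ℕ, X < n → p n = 0 := by
    intro n hn
    by_contra h0
    have h1 : (n : ℝ) ≤ (1 + θ) * N' := (hp.support_subset h0).2
    have h2 : (X : ℝ) + 1 ≤ n := by exact_mod_cast hn
    nlinarith
  have hC4 : C ≤ (4 * N) ^ (1 - min η 1) := by
    calc C ≤ N ^ (1 - η) := hC
      _ ≤ N ^ (1 - min η 1) :=
        Real.rpow_le_rpow_of_exponent_le hN (by linarith [min_le_left η 1])
      _ ≤ _ := Real.rpow_le_rpow hN0.le (by linarith) (by linarith [min_le_right η 1])
  set B := M * (d * (|(k : ℝ)| + 1)) * (4 * N) ^ (1 - δ) with hB'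
  have hB0 : 0 ≤ B := by positivity
  rw [GaussSum.charSum_eq_sum χ k hvanish,
    GaussSum.sum_mul_eq_sum_range_mul_sum (hvanish _ (Nat.lt_succ_self X))]
  have hbound : ‖∑ m ∈ range (X + 1), ((p m - p (m + 1 : ℕ) : ℝ) : ℂ) *
      ∑ z ∈ GaussSum.primaryBall m, GaussSum.sieveWeight C ⌊P⌋₊ (GaussSum.nrm z) *
        GaussSum.jacobiKubota z * GaussSum.grossencharacter χ k z‖ ≤ 8 * K * B := by
    refine (norm_sum_le _ _).trans (le_trans (b := ∑ m ∈ range (X + 1),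
      |p m - p (m + 1 : ℕ)| * B) (sum_le_sum fun m hm => ?_) ?_)
    · rw [norm_mul, Complex.norm_real, Real.norm_eq_abs]
      have hmX : (m : ℝ) ≤ X := by
        rw [mem_range] at hm
        exact_mod_cast Nat.lt_succ_iff.1 hm
      gcongr
      exact hB d χ k m ⌊P⌋₊ (4 * N) C hd (by linarith) (hmX.trans hX4) hC4
    · rw [← sum_mul]
      gcongr
      exact hp.sum_abs_sub_le hN hN' hN2 hθ _
  refine hbound.trans ?_
  have h4 : (4 * N) ^ (1 - δ) ≤ 4 * N ^ (1 - δ) := by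
    rw [Real.mul_rpow (by norm_num) hN0.le]
    gcongr
    calc (4 : ℝ) ^ (1 - δ) ≤ 4 ^ (1 : ℝ) :=
          Real.rpow_le_rpow_of_exponent_le (by norm_num) (by linarith)
      _ = 4 := Real.rpow_one 4
  calc 8 * K * B ≤ 8 * K * (M * N ^ (δ / 2) * (4 * N ^ (1 - δ))) := by rw [hB']; gcongr
    _ = 8 * K * (M * 4) * (N ^ (δ / 2) * N ^ (1 - δ)) := by ring
    _ = _ := by
      rw [← Real.rpow_add hN0]
      congr 2
      ring
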